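/- Let $n\ge 0$, let $(M,g)$ be a smooth Lorentzian manifold of dimension $n+2$ with Levi-Civita connection $\nabla$, and let $V$ be a smooth vector field on $M$. The triple $(M,g,V)$ is a Kundt space if $V$ is nowhere zero, lightlike ($g(V,V)=0$) and geodesic ($\nabla_VV=0$), and the distribution $V^\perp$ is integrable, tangent to a codimension-one foliation $\mathcal F$ that is totally geodesic ($\nabla_XY$ is tangent to $\mathcal F$ whenever $X,Y$ are). It is a Brinkmann space if moreover $V$ is parallel ($\nabla V=0$). It is a pp-wave if it is a Brinkmann space and the leaves of $\mathcal F$ are flat for the connection induced by $\nabla$ on $T\mathcal F$, i.e. $\nabla_X\nabla_YZ-\nabla_Y\nabla_XZ-\nabla_{[X,Y]}Z=0$ for all local vector fields $X,Y,Z$ tangent to $\mathcal F$. Then $(M,g,V)$ is a pp-wave if and only if every point of $M$ lies in the domain of a smooth chart $(u,v,x^1,\dots,x^n)$ in which $V=\partial_v$ and $$g = 2\,du\,dv + H(u,x)\,du^2 + \sum_{i=1}^n (dx^i)^2$$ for some smooth function $H$ of $(u,x)=(u,x^1,\dots,x^n)$ (independent of $v$). -/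

import Mathlib

open scoped Manifold ContDiff
open Bundle VectorField

noncomputable section

/-- A smooth semi-Riemannian (symmetric, nondegenerate) metric on a manifold. -/
structure SemiRiemannianMetric {E : Type*} [NormedAddCommGroup E] [NormedSpace ℝ E]
    {H : Type*} [TopologicalSpace H] (I : ModelWithCorners ℝ E H)
    (M : Type*) [TopologicalSpace M] [ChartedSpace H M] [IsManifold I ∞ M] where
  inner (x : M) : TangentSpace I x →L[ℝ] TangentSpace I x →L[ℝ] ℝ
  symm (x : M) (v w : TangentSpace I x) : inner x v w = inner x w v
  nondegenerate (x : M) (v : TangentSpace I x) (h : ∀ w, inner x v w = 0) : v = 0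
  contMDiff : ContMDiff I (I.prod 𝓘(ℝ, E →L[ℝ] E →L[ℝ] ℝ)) ∞
    (fun x ↦ TotalSpace.mk' (E →L[ℝ] E →L[ℝ] ℝ) x (inner x))

namespace SemiRiemannianMetric

variable {E : Type*} [NormedAddCommGroup E] [NormedSpace ℝ E]
  {H : Type*} [TopologicalSpace H] {I : ModelWithCorners ℝ E H}
  {M : Type*} [TopologicalSpace M] [ChartedSpace H M] [IsManifold I ∞ M]
  (g : SemiRiemannianMetric I M)

/-- The metric is Lorentzian: at each point it has signature `(-, +, …, +)`. -/
def IsLorentzian : Prop :=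
  ∀ x : M, ∃ (k : ℕ) (b : Module.Basis (Fin (k + 1)) ℝ (TangentSpace I x)),
    ∀ i j, g.inner x (b i) (b j) = if i = j then (if i = 0 then -1 else 1) else 0

/-! ### The Levi-Civita connection, through the Koszul formula -/

/-- The function `g(X, Y)`. -/
def pair (X Y : Π x : M, TangentSpace I x) (x : M) : ℝ := g.inner x (X x) (Y x)

/-- The Koszul expression
`(X g(Y,Z) + Y g(Z,X) - Z g(X,Y) + g([X,Y],Z) - g([Y,Z],X) + g([Z,X],Y)) / 2`. -/
def koszul (X Y Z : Π x : M, TangentSpace I x) (x : M) : ℝ :=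
  (d% (g.pair Y Z) x (X x) + d% (g.pair Z X) x (Y x) - d% (g.pair X Y) x (Z x)
    + g.inner x (mlieBracket I X Y x) (Z x)
    - g.inner x (mlieBracket I Y Z x) (X x)
    + g.inner x (mlieBracket I Z X x) (Y x)) / 2

section Koszul

variable {g} {X X' Y Y' Z Z' : Π x : M, TangentSpace I x} {f : M → ℝ} {x : M}

theorem mdifferentiableAt_pair (hX : MDiffAt (T% X) x) (hY : MDiffAt (T% Y) x) :
    MDiffAt (g.pair X Y) x := by
  have hg := (g.contMDiff.contMDiffAt (x := x)).mdifferentiableAt (by simp)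
  have := MDifferentiableAt.clm_bundle_apply₂ (F₁ := E) (F₂ := E) (F₃ := ℝ)
    (E₃ := Bundle.Trivial M ℝ) (b := fun x : M ↦ x) hg hX hY
  rw [mdifferentiableAt_totalSpace] at this
  exact this.2

theorem pair_add_left : g.pair (X + X') Y = g.pair X Y + g.pair X' Y := by
  funext q; simp [pair]

theorem pair_add_right : g.pair X (Y + Y') = g.pair X Y + g.pair X Y' := by
  funext q; simp [pair]

theorem pair_smul_left : g.pair (f • X) Y = f * g.pair X Y := by
  funext q; simp [pair]

theorem pair_smul_right : g.pair X (f • Y) = f * g.pair X Y := by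
  funext q; simp [pair]

variable [FiniteDimensional ℝ E]

theorem koszul_add_left (hX : MDiffAt (T% X) x) (hX' : MDiffAt (T% X') x)
    (hY : MDiffAt (T% Y) x) (hZ : MDiffAt (T% Z) x) :
    g.koszul (X + X') Y Z x = g.koszul X Y Z x + g.koszul X' Y Z x := by
  simp only [koszul, pair_add_left, pair_add_right, mlieBracket_add_left hX hX',
    mlieBracket_add_right hX hX',
    mvfderiv_add (mdifferentiableAt_pair hZ hX) (mdifferentiableAt_pair (g := g) hZ hX'),
    mvfderiv_add (mdifferentiableAt_pair hX hY) (mdifferentiableAt_pair (g := g) hX' hY),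
    Pi.add_apply, map_add, add_apply]
  ring

theorem koszul_smul_left (hf : MDiffAt f x) (hX : MDiffAt (T% X) x)
    (hY : MDiffAt (T% Y) x) (hZ : MDiffAt (T% Z) x) :
    g.koszul (f • X) Y Z x = f x * g.koszul X Y Z x := by
  have e1 := g.symm x (X x) (Y x)
  have e2 := g.symm x (X x) (Z x)
  simp only [koszul, pair_smul_left, pair_smul_right, mlieBracket_smul_left hf hX,
    mlieBracket_smul_right hf hX,
    mvfderiv_mul hf (mdifferentiableAt_pair (g := g) hZ hX),
    mvfderiv_mul hf (mdifferentiableAt_pair (g := g) hX hY),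
    Pi.smul_apply', map_add, map_smul, add_apply, smul_apply, smul_eq_mul, pair]
  rw [e1, e2]
  ring

theorem koszul_add_right (hX : MDiffAt (T% X) x) (hY : MDiffAt (T% Y) x)
    (hZ : MDiffAt (T% Z) x) (hZ' : MDiffAt (T% Z') x) :
    g.koszul X Y (Z + Z') x = g.koszul X Y Z x + g.koszul X Y Z' x := by
  simp only [koszul, pair_add_left, pair_add_right, mlieBracket_add_left hZ hZ',
    mlieBracket_add_right hZ hZ',
    mvfderiv_add (mdifferentiableAt_pair hY hZ) (mdifferentiableAt_pair (g := g) hY hZ'),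
    mvfderiv_add (mdifferentiableAt_pair hZ hX) (mdifferentiableAt_pair (g := g) hZ' hX),
    Pi.add_apply, map_add, add_apply]
  ring

theorem koszul_smul_right (hf : MDiffAt f x) (hX : MDiffAt (T% X) x)
    (hY : MDiffAt (T% Y) x) (hZ : MDiffAt (T% Z) x) :
    g.koszul X Y (f • Z) x = f x * g.koszul X Y Z x := by
  have e1 := g.symm x (Z x) (Y x)
  have e2 := g.symm x (Z x) (X x)
  simp only [koszul, pair_smul_left, pair_smul_right, mlieBracket_smul_left hf hZ,
    mlieBracket_smul_right hf hZ,
    mvfderiv_mul hf (mdifferentiableAt_pair (g := g) hY hZ),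
    mvfderiv_mul hf (mdifferentiableAt_pair (g := g) hZ hX),
    Pi.smul_apply', map_add, map_smul, add_apply, smul_apply, smul_eq_mul, pair]
  rw [e1, e2]
  ring

theorem koszul_add_middle (hX : MDiffAt (T% X) x) (hY : MDiffAt (T% Y) x)
    (hY' : MDiffAt (T% Y') x) (hZ : MDiffAt (T% Z) x) :
    g.koszul X (Y + Y') Z x = g.koszul X Y Z x + g.koszul X Y' Z x := by
  simp only [koszul, pair_add_left, pair_add_right, mlieBracket_add_left hY hY',
    mlieBracket_add_right hY hY',
    mvfderiv_add (mdifferentiableAt_pair hY hZ) (mdifferentiableAt_pair (g := g) hY' hZ),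
    mvfderiv_add (mdifferentiableAt_pair hX hY) (mdifferentiableAt_pair (g := g) hX hY'),
    Pi.add_apply, map_add, add_apply]
  ring

theorem koszul_smul_middle (hf : MDiffAt f x) (hX : MDiffAt (T% X) x)
    (hY : MDiffAt (T% Y) x) (hZ : MDiffAt (T% Z) x) :
    g.koszul X (f • Y) Z x = f x * g.koszul X Y Z x + d% f x (X x) * g.inner x (Y x) (Z x) := by
  have e1 := g.symm x (Y x) (X x)
  simp only [koszul, pair_smul_left, pair_smul_right, mlieBracket_smul_left hf hY,
    mlieBracket_smul_right hf hY,
    mvfderiv_mul hf (mdifferentiableAt_pair (g := g) hY hZ),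
    mvfderiv_mul hf (mdifferentiableAt_pair (g := g) hX hY),
    Pi.smul_apply', map_add, map_smul, add_apply, smul_apply, smul_eq_mul, pair]
  rw [e1]
  ring

end Koszul

variable {g} in
theorem clm_ext {x : M} {A B : TangentSpace I x →L[ℝ] TangentSpace I x}
    (h : ∀ X Z : Π x : M, TangentSpace I x, MDiffAt (T% X) x → MDiffAt (T% Z) x →
      g.inner x (A (X x)) (Z x) = g.inner x (B (X x)) (Z x)) : A = B := by
  ext1 v
  rw [← sub_eq_zero]
  refine g.nondegenerate x _ fun w ↦ ?_
  have := h (FiberBundle.extend E v) (FiberBundle.extend E w)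
    (FiberBundle.mdifferentiableAt_extend ..) (FiberBundle.mdifferentiableAt_extend ..)
  simpa [sub_eq_zero] using this

variable [FiniteDimensional ℝ E]

/-- The musical isomorphism `v ↦ g(v, ·)`. -/
def flat (x : M) : TangentSpace I x ≃ₗ[ℝ] (TangentSpace I x →L[ℝ] ℝ) :=
  haveI : FiniteDimensional ℝ (TangentSpace I x) := inferInstanceAs (FiniteDimensional ℝ E)
  haveI : FiniteDimensional ℝ (TangentSpace I x →L[ℝ] ℝ) :=
    inferInstanceAs (FiniteDimensional ℝ (E →L[ℝ] ℝ))
  LinearMap.linearEquivOfInjective (g.inner x).toLinearMap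
    (by
      rw [← LinearMap.ker_eq_bot, LinearMap.ker_eq_bot']
      intro v hv
      exact g.nondegenerate x v fun w ↦ by
        simpa using congrArg (fun φ : TangentSpace I x →L[ℝ] ℝ ↦ φ w) hv)
    (by
      change Module.finrank ℝ E = Module.finrank ℝ (E →L[ℝ] ℝ)
      rw [← LinearEquiv.finrank_eq (LinearMap.toContinuousLinearMap (E := E) (F' := ℝ) (𝕜 := ℝ))]
      exact (Subspace.dual_finrank_eq).symm)

/-- The inverse musical isomorphism, as a continuous linear map. -/
def sharp (x : M) : (TangentSpace I x →L[ℝ] ℝ) →L[ℝ] TangentSpace I x :=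
  haveI : FiniteDimensional ℝ (TangentSpace I x →L[ℝ] ℝ) :=
    inferInstanceAs (FiniteDimensional ℝ (E →L[ℝ] ℝ))
  haveI : T2Space (TangentSpace I x →L[ℝ] ℝ) := inferInstanceAs (T2Space (E →L[ℝ] ℝ))
  LinearMap.toContinuousLinearMap (g.flat x).symm.toLinearMap

theorem inner_sharp (x : M) (φ : TangentSpace I x →L[ℝ] ℝ) (w : TangentSpace I x) :
    g.inner x (g.sharp x φ) w = φ w := by
  have h : g.flat x ((g.flat x).symm φ) = φ := (g.flat x).apply_symm_apply φ
  exact congrArg (fun ψ : TangentSpace I x →L[ℝ] ℝ ↦ ψ w) h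

/-- For a vector field `Y` differentiable at `x`, the Koszul expression as a bilinear form
in the values of `X` and `Z` at `x`. -/
def koszulForm (Y : Π x : M, TangentSpace I x) (x : M) (hY : MDiffAt (T% Y) x) :
    TangentSpace I x →L[ℝ] TangentSpace I x →L[ℝ] ℝ :=
  TensorialAt.mkHom₂ (I := I) (F := E) (F' := E) (fun X Z ↦ g.koszul X Y Z x) x
    (fun _ hZ ↦ ⟨fun hf hX ↦ koszul_smul_left hf hX hY hZ,
      fun hX hX' ↦ koszul_add_left hX hX' hY hZ⟩)
    (fun _ hX ↦ ⟨fun hf hZ ↦ koszul_smul_right hf hX hY hZ,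
      fun hZ hZ' ↦ koszul_add_right hX hY hZ hZ'⟩)

open Classical in
/-- `(∇_v Y)(x)` as a linear function of `v`, with the value `0` if `Y` is not differentiable
at `x`. -/
def leviCivitaFun (Y : Π x : M, TangentSpace I x) (x : M) :
    TangentSpace I x →L[ℝ] TangentSpace I x :=
  if hY : MDiffAt (T% Y) x then (g.sharp x).comp (g.koszulForm Y x hY) else 0

variable {g} in
/-- The Koszul formula. -/
theorem inner_leviCivitaFun {X Y Z : Π x : M, TangentSpace I x} {x : M}
    (hX : MDiffAt (T% X) x) (hY : MDiffAt (T% Y) x) (hZ : MDiffAt (T% Z) x) :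
    g.inner x (g.leviCivitaFun Y x (X x)) (Z x) = g.koszul X Y Z x := by
  rw [leviCivitaFun, dif_pos hY]
  refine (g.inner_sharp x _ _).trans ?_
  exact TensorialAt.mkHom₂_apply _ _ hX hZ

/-- The Levi-Civita connection of `g`; `g.leviCivita Y x (X x)` is `∇_X Y` at `x`. -/
def leviCivita : CovariantDerivative I E (TangentSpace I : M → Type _) where
  toFun := g.leviCivitaFun
  isCovariantDerivativeOnUniv :=
    { add := fun {Y Y' x} hY hY' _ ↦ clm_ext (g := g) fun X Z hX hZ ↦ by
        rw [inner_leviCivitaFun hX (mdifferentiableAt_add_section hY hY') hZ,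
          koszul_add_middle hX hY hY' hZ]
        simp [inner_leviCivitaFun hX hY hZ, inner_leviCivitaFun hX hY' hZ]
      leibniz := fun {Y f x} hY hf _ ↦ clm_ext (g := g) fun X Z hX hZ ↦ by
        rw [inner_leviCivitaFun hX (hf.smul_section hY) hZ, koszul_smul_middle hf hX hY hZ]
        simp [inner_leviCivitaFun hX hY hZ] }

/-- The orthogonal distribution `V^⊥` of a vector field `V`. -/
def orthogonal (V : Π x : M, TangentSpace I x) (x : M) : Submodule ℝ (TangentSpace I x) :=
  LinearMap.ker (g.inner x (V x)).toLinearMap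

end SemiRiemannianMetric

/-! ### Distributions, foliations and curvature -/

section Distributions

variable {E : Type*} [NormedAddCommGroup E] [NormedSpace ℝ E]
  {H : Type*} [TopologicalSpace H] {I : ModelWithCorners ℝ E H}
  {M : Type*} [TopologicalSpace M] [ChartedSpace H M] [IsManifold I ∞ M]

/-- `X` is a smooth vector field on `M`. -/
def IsSmoothVectorField (X : Π x : M, TangentSpace I x) : Prop := CMDiff ∞ (T% X)

/-- `X` is, over the open set `U`, a smooth vector field with values in the distribution `D`. -/
def IsSmoothSectionOn (D : Π x : M, Submodule ℝ (TangentSpace I x)) (U : Set M)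
    (X : Π x : M, TangentSpace I x) : Prop :=
  IsOpen U ∧ CMDiff[U] ∞ (T% X) ∧ ∀ x ∈ U, X x ∈ D x

/-- The distribution `D` is totally geodesic for `∇`: if `X` and `Y` are (local) vector fields
tangent to `D`, so is `∇_X Y`. -/
def IsTotallyGeodesic (nabla : CovariantDerivative I E (TangentSpace I : M → Type _))
    (D : Π x : M, Submodule ℝ (TangentSpace I x)) : Prop :=
  ∀ (U : Set M) (X Y : Π x : M, TangentSpace I x),
    IsSmoothSectionOn D U X → IsSmoothSectionOn D U Y → ∀ x ∈ U, nabla Y x (X x) ∈ D x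

/-- The curvature `R(X,Y)Z = ∇_X ∇_Y Z - ∇_Y ∇_X Z - ∇_[X,Y] Z` at `x`. -/
def curvature (nabla : CovariantDerivative I E (TangentSpace I : M → Type _))
    (X Y Z : Π x : M, TangentSpace I x) (x : M) : TangentSpace I x :=
  nabla (fun q ↦ nabla Z q (Y q)) x (X x) - nabla (fun q ↦ nabla Z q (X q)) x (Y x)
    - nabla Z x (mlieBracket I X Y x)

/-- The leaves of the totally geodesic foliation tangent to `D` are flat for the connection
`(X, Y) ↦ ∇_X Y` that `∇` induces on them: the curvature of this connection,
computed on vector fields tangent to the leaves, vanishes. (As the leaves are totally geodesic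
and `D` is involutive, all derivatives that enter into it are along the leaves and tangent
to them.) -/
def IsLeafwiseFlat (nabla : CovariantDerivative I E (TangentSpace I : M → Type _))
    (D : Π x : M, Submodule ℝ (TangentSpace I x)) : Prop :=
  ∀ (U : Set M) (X Y Z : Π x : M, TangentSpace I x),
    IsSmoothSectionOn D U X → IsSmoothSectionOn D U Y → IsSmoothSectionOn D U Z →
    ∀ x ∈ U, curvature nabla X Y Z x = 0

end Distributions

section Coordinates

variable {n : ℕ} {M : Type*} [TopologicalSpace M]
  [ChartedSpace (EuclideanSpace ℝ (Fin (n + 2))) M]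

/-- The differential at `q` of the `i`-th coordinate function of the chart `e`. -/
def coordDiff (e : OpenPartialHomeomorph M (EuclideanSpace ℝ (Fin (n + 2))))
    (i : Fin (n + 2)) (q : M) : TangentSpace (𝓡 (n + 2)) q →L[ℝ] ℝ :=
  (EuclideanSpace.proj i : EuclideanSpace ℝ (Fin (n + 2)) →L[ℝ] ℝ).comp
    (mfderiv (𝓡 (n + 2)) (𝓡 (n + 2)) e q)

/-- The `n` coordinates after the first two: `(u, v, x¹, …, xⁿ) ↦ (x¹, …, xⁿ)`. -/
def transverse (y : EuclideanSpace ℝ (Fin (n + 2))) : EuclideanSpace ℝ (Fin n) :=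
  WithLp.toLp 2 fun i ↦ y i.succ.succ

variable [IsManifold (𝓡 (n + 2)) ∞ M]

/-- The distribution `D` is integrable, tangent to a smooth foliation of codimension one: near
each point there is a foliation chart, in which `D` is tangent to the levels of the first
coordinate. -/
def IsIntegrableHyperplaneField
    (D : Π x : M, Submodule ℝ (TangentSpace (𝓡 (n + 2)) x)) : Prop :=
  ∀ p : M, ∃ e ∈ IsManifold.maximalAtlas (𝓡 (n + 2)) ∞ M, p ∈ e.source ∧
    ∀ q ∈ e.source, D q = LinearMap.ker (coordDiff e 0 q).toLinearMap

variable (g : SemiRiemannianMetric (𝓡 (n + 2)) M) (V : Π x : M, TangentSpace (𝓡 (n + 2)) x)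

/-- `(M, g, V)` is a Kundt space: `V` is a non-singular, lightlike, geodesic smooth vector field
whose orthogonal distribution is integrable, tangent to a totally geodesic foliation. -/
structure IsKundt : Prop where
  lorentzian : g.IsLorentzian
  smooth : IsSmoothVectorField V
  ne_zero (x : M) : V x ≠ 0
  lightlike (x : M) : g.inner x (V x) (V x) = 0
  geodesic (x : M) : g.leviCivita V x (V x) = 0
  integrable : IsIntegrableHyperplaneField (g.orthogonal V)
  totallyGeodesic : IsTotallyGeodesic g.leviCivita (g.orthogonal V)

/-- `(M, g, V)` is a Brinkmann space: a Kundt space for which `V` is parallel. -/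
structure IsBrinkmann : Prop extends IsKundt g V where
  parallel (x : M) (w : TangentSpace (𝓡 (n + 2)) x) : g.leviCivita V x w = 0

/-- `(M, g, V)` is a pp-wave: a Brinkmann space such that the leaves of the foliation tangent to
`V^⊥` are flat for the induced connection. -/
structure IsPPWave : Prop extends IsBrinkmann g V where
  flat : IsLeafwiseFlat g.leviCivita (g.orthogonal V)

/-- The chart `e`, with coordinates written `(u, v, x¹, …, xⁿ)`, satisfies `V = ∂_v` and
`g = 2 du dv + H(u, x) du² + ∑ (dxⁱ)²` for a smooth function `H` of `(u, x)`. -/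
def IsPPWaveChart (e : OpenPartialHomeomorph M (EuclideanSpace ℝ (Fin (n + 2)))) : Prop :=
  e ∈ IsManifold.maximalAtlas (𝓡 (n + 2)) ∞ M ∧
  (∀ q ∈ e.source, ∀ i, coordDiff e i q (V q) = if i = 1 then 1 else 0) ∧
  ∃ h : ℝ × EuclideanSpace ℝ (Fin n) → ℝ,
    ContDiffOn ℝ ∞ h ((fun y : EuclideanSpace ℝ (Fin (n + 2)) ↦ (y 0, transverse y)) '' e.target) ∧
    ∀ q ∈ e.source, ∀ a b : TangentSpace (𝓡 (n + 2)) q,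
      g.inner q a b =
        coordDiff e 0 q a * coordDiff e 1 q b + coordDiff e 1 q a * coordDiff e 0 q b
        + h (e q 0, transverse (e q)) * (coordDiff e 0 q a * coordDiff e 0 q b)
        + ∑ i : Fin n, coordDiff e i.succ.succ q a * coordDiff e i.succ.succ q b

end Coordinates

end

/-!
Whether `(M, g, V)` is a pp-wave can be read off in charts, where the Levi-Civita connection is
given by Christoffel symbols `Γ` and its curvature by `christoffelCurvature Γ`
(`leviCivita_chart`, `curvature_chart`).

*From the normal form to the geometry.* If `g = 2 du dv + H(u, x) du² + ∑ (dxⁱ)²`, the derivative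
of the metric is `dH ⊗ du²`, and `H` does not depend on `v`. The Koszul formula gives
`Γ(·, ∂_v) = 0`, and `Γ(a, b) = 0` whenever `a` and `b` are tangent to the levels of `u`
(`IsPPWaveChart.christoffel_eq_zero`). Hence `∂_v` is parallel, its orthogonal distribution is
tangent to the levels of `u`, and these are totally geodesic and flat.

*From the geometry to the normal form.* Take a foliation chart, in which `V^⊥` is the kernel of a
fixed linear form `τ`, and a vector `e` with `τ e = 1`. A null frame `V, U, F₁, …, Fₙ` at the
origin is extended by parallel transport, first along the axis spanned by `e`, then along the rays
that issue from the axis in each leaf (`IsLocalPPWave.exists_frame`). This is a linear ordinary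
differential equation depending smoothly on parameters (`exists_linear_ode_solution`), and the
result is again a null frame, as transport preserves scalar products.

* The leaves are flat, so the `Fᵢ`, which are tangent to them, are parallel in all directions of
  the leaves (`IsLocalPPWave.eventually_leafwise_parallel`).
* The functions `g(∇_e Fᵢ, Fⱼ)` vanish on the axis. Their derivative along the leaves is a
  curvature `R(a, e, Fᵢ, Fⱼ) = R(Fᵢ, Fⱼ, a, e)` with `a`, `Fᵢ`, `Fⱼ` in `V^⊥`, which is zero by
  flatness, so they vanish identically (`IsLocalPPWave.eventually_rotation_eq_zero`).

Consequently the forms `g(V, ·)` and `g(Fᵢ, ·)` are closed, while `g(U, ·)` is closed along the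
leaves. A Poincaré lemma relative to the foliation (`exists_primitive`) gives functions with
`du = g(V, ·)`, `dxⁱ = g(Fᵢ, ·)`, and `dv = g(U, ·) + k₀ du`. Expanding `g` in the null frame yields the
normal form with `H = -2 k₀`, and `d² v = 0` shows that `H` is constant along `V`
(`IsLocalPPWave.exists_coordinates`). The nondegeneracy of `g` makes `(u, v, x)` a local
diffeomorphism; restricted to have a ball as its image, it is the required chart, since on a ball
a function with `∂_v H = 0` is a function of `(u, x)` (`exists_isPPWaveChart_of_coordinates`).
-/

noncomputable section

set_option linter.unusedSectionVars false
set_option synthInstance.maxHeartbeats 200000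
set_option maxSynthPendingDepth 3

/-! ### Smooth families of paths and linear differential equations with parameters -/

section Paths

open Set Filter Topology

variable {P F : Type} [NormedAddCommGroup P] [NormedSpace ℝ P]
  [NormedAddCommGroup F] [NormedSpace ℝ F]

/-- The Banach space `C([0, 1], G)` of paths in `G`. It is a type of its own, and not an
abbreviation, in order to keep instance search short. -/
def Path01 (G : Type) [NormedAddCommGroup G] : Type := C(Icc (0 : ℝ) 1, G)

namespace Path01

variable {G : Type} [NormedAddCommGroup G]

instance : NormedAddCommGroup (Path01 G) := inferInstanceAs (NormedAddCommGroup C(Icc (0 : ℝ) 1, G))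

instance [NormedSpace ℝ G] : NormedSpace ℝ (Path01 G) :=
  inferInstanceAs (NormedSpace ℝ C(Icc (0 : ℝ) 1, G))

instance [CompleteSpace G] : CompleteSpace (Path01 G) :=
  inferInstanceAs (CompleteSpace C(Icc (0 : ℝ) 1, G))

instance : FunLike (Path01 G) (Icc (0 : ℝ) 1) G :=
  inferInstanceAs (FunLike C(Icc (0 : ℝ) 1, G) (Icc (0 : ℝ) 1) G)

/-- A continuous map on `[0, 1]` as a path. -/
def mk (f : Icc (0 : ℝ) 1 → G) (hf : Continuous f) : Path01 G := (⟨f, hf⟩ : C(Icc (0 : ℝ) 1, G))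

@[simp] theorem mk_apply (f : Icc (0 : ℝ) 1 → G) (hf : Continuous f) (t : Icc (0 : ℝ) 1) :
    mk f hf t = f t := rfl

@[fun_prop] protected theorem continuous (φ : Path01 G) : Continuous φ :=
  ContinuousMap.continuous (φ : C(Icc (0 : ℝ) 1, G))

@[ext] theorem ext {φ ψ : Path01 G} (h : ∀ t, φ t = ψ t) : φ = ψ := DFunLike.ext _ _ h

@[simp] theorem add_apply (φ ψ : Path01 G) (t : Icc (0 : ℝ) 1) : (φ + ψ) t = φ t + ψ t := rfl

@[simp] theorem sub_apply (φ ψ : Path01 G) (t : Icc (0 : ℝ) 1) : (φ - ψ) t = φ t - ψ t := rfl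

@[simp] theorem zero_apply (t : Icc (0 : ℝ) 1) : (0 : Path01 G) t = 0 := rfl

@[simp] theorem smul_apply [NormedSpace ℝ G] (c : ℝ) (φ : Path01 G) (t : Icc (0 : ℝ) 1) :
    (c • φ) t = c • φ t := rfl

theorem norm_le (φ : Path01 G) {C : ℝ} (hC : 0 ≤ C) : ‖φ‖ ≤ C ↔ ∀ t, ‖φ t‖ ≤ C :=
  ContinuousMap.norm_le (φ : C(Icc (0 : ℝ) 1, G)) hC

theorem norm_coe_le_norm (φ : Path01 G) (t : Icc (0 : ℝ) 1) : ‖φ t‖ ≤ ‖φ‖ :=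
  ContinuousMap.norm_coe_le_norm (φ : C(Icc (0 : ℝ) 1, G)) t

/-- The constant path at `x`, as a linear function of `x`. -/
def constL [NormedSpace ℝ G] : G →L[ℝ] Path01 G :=
  LinearMap.mkContinuous
    { toFun := fun x ↦ mk (fun _ ↦ x) continuous_const
      map_add' := fun _ _ ↦ rfl
      map_smul' := fun _ _ ↦ rfl } 1
    (fun x ↦ (norm_le _ (by positivity)).2 fun _ ↦ le_of_eq (one_mul _).symm)

@[simp] theorem constL_apply [NormedSpace ℝ G] (x : G) (t : Icc (0 : ℝ) 1) :
    constL x t = x := rfl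

end Path01

open Classical in
/-- The restriction of `f p` to `[0, 1]`, as an element of the Banach space `C([0, 1], F)`; it is
`0` if that restriction is not continuous. -/
def pathMap (f : P → ℝ → F) (p : P) : Path01 F :=
  if h : Continuous (fun t : Icc (0 : ℝ) 1 ↦ f p t) then Path01.mk _ h else 0

theorem pathMap_apply {f : P → ℝ → F} {p : P}
    (h : ∀ t ∈ Icc (0 : ℝ) 1, ContinuousAt (Function.uncurry f) (p, t)) (t : Icc (0 : ℝ) 1) :
    pathMap f p t = f p t := by
  have : Continuous (fun t : Icc (0 : ℝ) 1 ↦ f p t) := by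
    refine continuous_iff_continuousAt.2 fun t ↦ ?_
    exact ContinuousAt.comp (f := fun t : Icc (0 : ℝ) 1 ↦ (p, (t : ℝ))) (h t t.2) (by fun_prop)
  rw [pathMap, dif_pos this]
  rfl

theorem continuousOn_pathMap {f : P → ℝ → F} {S : Set P}
    (h : ∀ p ∈ S, ∀ t ∈ Icc (0 : ℝ) 1, ContinuousAt (Function.uncurry f) (p, t)) :
    ContinuousOn (pathMap f) S := by
  have hc : Continuous (fun z : S × Icc (0 : ℝ) 1 ↦ f z.1 z.2) := by
    refine continuous_iff_continuousAt.2 fun z ↦ ?_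
    exact ContinuousAt.comp (f := fun z : S × Icc (0 : ℝ) 1 ↦ ((z.1 : P), (z.2 : ℝ)))
      (h _ z.1.2 _ z.2.2) (by fun_prop)
  rw [continuousOn_iff_continuous_domRestrict]
  refine (ContinuousMap.curry ⟨_, hc⟩).continuous.congr fun p ↦ ?_
  exact Path01.ext fun t ↦ (pathMap_apply (h p p.2) t).symm

/-- A path of linear maps, seen as a linear map with values in paths. -/
def pathEval : Path01 (P →L[ℝ] F) →L[ℝ] P →L[ℝ] Path01 F :=
  LinearMap.mkContinuous₂
    (LinearMap.mk₂ ℝ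
      (fun (φ : Path01 (P →L[ℝ] F)) v ↦
        Path01.mk (fun t ↦ φ t v) (by fun_prop))
      (by intros; ext; simp) (by intros; ext; simp) (by intros; ext; simp) (by intros; ext; simp))
    1 (fun φ v ↦ by
      rw [Path01.norm_le _ (by positivity), one_mul]
      intro t
      exact ((φ t).le_opNorm v).trans (by gcongr; exact φ.norm_coe_le_norm t))

@[simp] theorem pathEval_apply (φ : Path01 (P →L[ℝ] F)) (v : P) (t : Icc (0 : ℝ) 1) :
    pathEval φ v t = φ t v := rfl

/-- The derivative of a family of paths with respect to its parameter is computed pointwise. -/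
theorem hasFDerivAt_pathMap {f : P → ℝ → F} {S : Set P} (hS : IsOpen S)
    (h : ∀ p ∈ S, ∀ t ∈ Icc (0 : ℝ) 1, ContDiffAt ℝ 1 (Function.uncurry f) (p, t))
    {p : P} (hp : p ∈ S) :
    HasFDerivAt (pathMap f) (pathEval (pathMap (fun p t ↦
      (fderiv ℝ (Function.uncurry f) (p, t)).comp (ContinuousLinearMap.inl ℝ P ℝ)) p)) p := by
  set f' : P → ℝ → P →L[ℝ] F := fun p t ↦
      (fderiv ℝ (Function.uncurry f) (p, t)).comp (ContinuousLinearMap.inl ℝ P ℝ) with hf'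
  have hc : ∀ p ∈ S, ∀ t ∈ Icc (0 : ℝ) 1, ContinuousAt (Function.uncurry f) (p, t) :=
    fun p hp t ht ↦ (h p hp t ht).continuousAt
  have hc' : ∀ p ∈ S, ∀ t ∈ Icc (0 : ℝ) 1, ContinuousAt (Function.uncurry f') (p, t) := by
    intro p hp t ht
    have : ContinuousAt (fderiv ℝ (Function.uncurry f)) (p, t) :=
      ((h p hp t ht).fderiv_right (m := 0) (by simp)).continuousAt
    exact this.clm_comp continuousAt_const
  have hd : ∀ p ∈ S, ∀ t ∈ Icc (0 : ℝ) 1, HasFDerivAt (fun p ↦ f p t) (f' p t) p := by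
    intro p hp t ht
    have h1 := ((h p hp t ht).differentiableAt (by simp)).hasFDerivAt
    exact HasFDerivAt.comp (f := fun p ↦ (p, t)) p h1 (hasFDerivAt_prodMk_left p t)
  rw [hasFDerivAt_iff_isLittleO, Asymptotics.isLittleO_iff]
  intro ε hε
  have hcont := (continuousOn_pathMap hc').continuousAt (hS.mem_nhds hp)
  obtain ⟨δ, hδ, hball⟩ := Metric.mem_nhds_iff.1
    (inter_mem (hS.mem_nhds hp) (hcont (Metric.ball_mem_nhds _ hε)))
  filter_upwards [Metric.ball_mem_nhds p hδ] with q hq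
  rw [Path01.norm_le _ (by positivity)]
  intro t
  have hqS := (hball hq).1
  simp only [Path01.sub_apply, pathEval_apply, pathMap_apply (hc q hqS),
    pathMap_apply (hc p hp), pathMap_apply (hc' p hp)]
  refine Convex.norm_image_sub_le_of_norm_hasFDerivWithin_le' (f := fun p ↦ f p t)
    (f' := fun p ↦ f' p t) (s := Metric.ball p δ) ?_ ?_ (convex_ball p δ)
    (Metric.mem_ball_self hδ) hq
  · exact fun x hx ↦ (hd x (hball hx).1 t t.2).hasFDerivWithinAt
  · intro x hx
    have h2 := (hball hx).2
    simp only [mem_preimage, Metric.mem_ball, dist_eq_norm] at h2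
    have h3 := (Path01.norm_coe_le_norm _ t).trans h2.le
    simpa only [Path01.sub_apply, pathMap_apply (hc' x (hball hx).1),
      pathMap_apply (hc' p hp)] using h3

theorem contDiffOn_pathMap_nat (k : ℕ) : ∀ {F : Type} [NormedAddCommGroup F] [NormedSpace ℝ F]
    {f : P → ℝ → F} {S : Set P}, IsOpen S →
    (∀ p ∈ S, ∀ t ∈ Icc (0 : ℝ) 1, ContDiffAt ℝ k (Function.uncurry f) (p, t)) →
    ContDiffOn ℝ k (pathMap f) S := by
  induction k with
  | zero =>
    intro F _ _ f S hS h
    exact contDiffOn_zero.2 (continuousOn_pathMap fun p hp t ht ↦ (h p hp t ht).continuousAt)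
  | succ k ih =>
    intro F _ _ f S hS h
    have h1 : ∀ p ∈ S, ∀ t ∈ Icc (0 : ℝ) 1, ContDiffAt ℝ 1 (Function.uncurry f) (p, t) :=
      fun p hp t ht ↦ (h p hp t ht).of_le (by push_cast; exact le_add_self)
    push_cast
    rw [contDiffOn_succ_iff_fderiv_of_isOpen hS]
    refine ⟨fun p hp ↦ (hasFDerivAt_pathMap hS h1 hp).differentiableAt.differentiableWithinAt,
      by simp, ?_⟩
    refine ContDiffOn.congr (f := fun p ↦ pathEval (pathMap (fun p t ↦
      (fderiv ℝ (Function.uncurry f) (p, t)).comp (ContinuousLinearMap.inl ℝ P ℝ)) p)) ?_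
      fun p hp ↦ (hasFDerivAt_pathMap hS h1 hp).fderiv
    refine (pathEval (P := P) (F := F)).contDiff.comp_contDiffOn (ih hS fun p hp t ht ↦ ?_)
    have := (h p hp t ht).fderiv_right (m := k) (by push_cast; exact le_rfl)
    exact this.clm_comp contDiffAt_const

/-- A smooth family of paths depends smoothly on its parameter as an element of
`C([0, 1], F)`. -/
theorem contDiffOn_pathMap {f : P → ℝ → F} {S : Set P} (hS : IsOpen S)
    (h : ∀ p ∈ S, ∀ t ∈ Icc (0 : ℝ) 1, ContDiffAt ℝ ∞ (Function.uncurry f) (p, t)) :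
    ContDiffOn ℝ ∞ (pathMap f) S :=
  contDiffOn_infty.2 fun k ↦ contDiffOn_pathMap_nat k hS fun p hp t ht ↦
    (h p hp t ht).of_le (by exact_mod_cast le_top)

variable [CompleteSpace F]

/-- The primitive `t ↦ ∫₀ᵗ φ` as a bounded operator on `C([0, 1], F)`. -/
def pathPrimitive : Path01 F →L[ℝ] Path01 F :=
  LinearMap.mkContinuous
    { toFun := fun φ ↦ Path01.mk (fun t ↦ ∫ s in (0 : ℝ)..t, IccExtend zero_le_one φ s)
        ((intervalIntegral.continuous_primitive
          (fun a b ↦ (φ.continuous.Icc_extend').intervalIntegrable a b) 0).comp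
          continuous_subtype_val)
      map_add' := fun φ ψ ↦ by
        ext t
        simp only [Path01.mk_apply, Path01.add_apply]
        rw [← intervalIntegral.integral_add
          (φ.continuous.Icc_extend'.intervalIntegrable _ _)
          (ψ.continuous.Icc_extend'.intervalIntegrable _ _)]
        rfl
      map_smul' := fun c φ ↦ by
        ext t
        simp only [Path01.mk_apply, Path01.smul_apply, RingHom.id_apply]
        rw [← intervalIntegral.integral_smul]
        rfl }
    1 (fun φ ↦ by
      rw [Path01.norm_le _ (by positivity), one_mul]
      intro t
      refine (intervalIntegral.norm_integral_le_of_norm_le_const (C := ‖φ‖)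
        fun s _ ↦ φ.norm_coe_le_norm _).trans ?_
      have h0 := t.2.1
      have h1 := t.2.2
      rw [sub_zero, abs_of_nonneg h0]
      exact mul_le_of_le_one_right (norm_nonneg _) h1)

theorem pathPrimitive_apply (φ : Path01 F) (t : Icc (0 : ℝ) 1) :
    pathPrimitive φ t = ∫ s in (0 : ℝ)..t, IccExtend zero_le_one φ s := rfl

theorem hasDerivWithinAt_pathPrimitive (φ : Path01 F) (t : Icc (0 : ℝ) 1) :
    HasDerivWithinAt (IccExtend zero_le_one (pathPrimitive φ)) (φ t) (Icc 0 1) t := by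
  have h := (intervalIntegral.integral_hasDerivAt_right
    (φ.continuous.Icc_extend'.intervalIntegrable 0 (t : ℝ))
    (φ.continuous.Icc_extend'.stronglyMeasurableAtFilter _ _)
    (φ.continuous.Icc_extend' (h := zero_le_one)).continuousAt).hasDerivWithinAt (s := Icc 0 1)
  rw [IccExtend_val] at h
  refine h.congr (fun s hs ↦ ?_) ?_
  · rw [IccExtend_of_mem _ _ hs]; rfl
  · rw [IccExtend_val]; rfl

/-- Pointwise application of a path of operators to a path of vectors. -/
def pathMul : Path01 (F →L[ℝ] F) →L[ℝ] Path01 F →L[ℝ] Path01 F :=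
  LinearMap.mkContinuous₂
    (LinearMap.mk₂ ℝ
      (fun (A : Path01 (F →L[ℝ] F)) (φ : Path01 F) ↦
        Path01.mk (fun t ↦ A t (φ t)) (by fun_prop))
      (by intros; ext; simp) (by intros; ext; simp) (by intros; ext; simp) (by intros; ext; simp))
    1 (fun A φ ↦ by
      rw [Path01.norm_le _ (by positivity), one_mul]
      intro t
      exact ((A t).le_opNorm _).trans
        (mul_le_mul (A.norm_coe_le_norm t) (φ.norm_coe_le_norm t) (norm_nonneg _) (norm_nonneg _)))

omit [CompleteSpace F] in
@[simp] theorem pathMul_apply (A : Path01 (F →L[ℝ] F)) (φ : Path01 F)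
    (t : Icc (0 : ℝ) 1) : pathMul A φ t = A t (φ t) := rfl

/-- The Volterra operator `Y ↦ (t ↦ ∫₀ᵗ A(s) Y(s) ds)` of the linear equation `Y' = A Y`. -/
def volterra : Path01 (F →L[ℝ] F) →L[ℝ] Path01 F →L[ℝ] Path01 F :=
  (ContinuousLinearMap.compL ℝ (Path01 F) (Path01 F) (Path01 F)
    pathPrimitive).comp pathMul

theorem volterra_apply (A : Path01 (F →L[ℝ] F)) (φ : Path01 F) :
    volterra A φ = pathPrimitive (pathMul A φ) := rfl

/-- The linear equation `Y' = A(p, t) Y`, `Y(0) = Y₀(p)` with parameter `p` and with small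
coefficients has a solution on `[0, 1]` that depends smoothly on `p`; the solution of the
associated integral equation is unique. -/
theorem exists_linear_ode_solution {A : P → ℝ → F →L[ℝ] F} {Y₀ : P → F} {p₀ : P}
    (hA : ∀ᶠ p in 𝓝 p₀, ∀ t ∈ Icc (0 : ℝ) 1, ContDiffAt ℝ ∞ (Function.uncurry A) (p, t))
    (hA₀ : ∀ t ∈ Icc (0 : ℝ) 1, A p₀ t = 0) (hY₀ : ∀ᶠ p in 𝓝 p₀, ContDiffAt ℝ ∞ Y₀ p) :
    ∃ Y : P → (Path01 F), ∀ᶠ p in 𝓝 p₀, ContDiffAt ℝ ∞ Y p ∧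
      (∀ t, pathMap A p t = A p t) ∧
      ∀ Z : Path01 F,
        Z = Path01.constL (Y₀ p) + volterra (pathMap A p) Z ↔ Z = Y p := by
  obtain ⟨S, hS, hSo, hpS⟩ := eventually_nhds_iff.1 hA
  have hsm : ContDiffOn ℝ ∞ (pathMap A) S := contDiffOn_pathMap hSo hS
  have happ : ∀ p ∈ S, ∀ t, pathMap A p t = A p t := fun p hp t ↦
    pathMap_apply (fun t ht ↦ (hS p hp t ht).continuousAt) t
  have h0 : pathMap A p₀ = 0 := by
    ext1 t
    rw [happ p₀ hpS, hA₀ t t.2]; rfl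
  have hK : ∀ p ∈ S, ContDiffAt ℝ ∞ (fun p ↦ volterra (pathMap A p)) p := fun p hp ↦
    (volterra (F := F)).contDiff.contDiffAt.comp p (hsm.contDiffAt (hSo.mem_nhds hp))
  have hsmall : ∀ᶠ p in 𝓝 p₀, ‖volterra (pathMap A p)‖ < 1 := by
    refine (hK p₀ hpS).continuousAt.norm.eventually_lt continuousAt_const ?_
    simp [h0]
  refine ⟨fun p ↦ Ring.inverse (1 - volterra (pathMap A p)) (Path01.constL (Y₀ p)), ?_⟩
  filter_upwards [hsmall, hSo.mem_nhds hpS, hY₀] with p hp hpS hYp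
  obtain ⟨w, hw⟩ : ∃ w : (Path01 F →L[ℝ] Path01 F)ˣ,
    (w : Path01 F →L[ℝ] Path01 F) = 1 - volterra (pathMap A p) :=
    ⟨Units.oneSub _ hp, rfl⟩
  refine ⟨?_, happ p hpS, fun Z ↦ ?_⟩
  · refine ContDiffAt.clm_apply ?_ ?_
    · refine ContDiffAt.comp p (g := Ring.inverse) ?_ (contDiffAt_const.sub (hK p hpS))
      rw [← hw]
      exact contDiffAt_ringInverse ℝ w
    · exact (Path01.constL (G := F)).contDiff.contDiffAt.comp p hYp
  · rw [← hw, Ring.inverse_unit]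
    have h1 : Z = Path01.constL (Y₀ p) + volterra (pathMap A p) Z ↔
        (w : Path01 F →L[ℝ] Path01 F) Z = Path01.constL (Y₀ p) := by
      rw [hw, ← sub_eq_iff_eq_add]; rfl
    rw [h1]
    constructor
    · intro h
      rw [← h, ← mul_apply_eq_comp, Units.inv_mul]; rfl
    · intro h
      rw [h, ← mul_apply_eq_comp, Units.mul_inv]; rfl

end Paths

/-! ### Radial parallel transport and the Poincaré lemma -/

section Transport

open Set Filter Topology

variable {E F : Type} [NormedAddCommGroup E] [NormedSpace ℝ E]
  [NormedAddCommGroup F] [NormedSpace ℝ F]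

theorem fderiv_clm_apply_apply {G : Type} [NormedAddCommGroup G] [NormedSpace ℝ G]
    {c : E → F →L[ℝ] G} {u : E → F} {y : E} (hc : DifferentiableAt ℝ c y)
    (hu : DifferentiableAt ℝ u y) (a : E) :
    fderiv ℝ (fun z ↦ c z (u z)) y a = fderiv ℝ c y a (u y) + c y (fderiv ℝ u y a) := by
  rw [fderiv_clm_apply hc hu]
  exact add_comm _ _

theorem fderiv_clm_apply_const {G : Type} [NormedAddCommGroup G] [NormedSpace ℝ G]
    {c : E → F →L[ℝ] G} {y : E} (hc : DifferentiableAt ℝ c y)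
    (b : F) (a : E) : fderiv ℝ (fun z ↦ c z b) y a = fderiv ℝ c y a b := by
  rw [fderiv_clm_apply_apply hc (differentiableAt_const b)]
  simp

/-- The straight path from `y - Q y` (at `t = 0`) to `y` (at `t = 1`) in the direction `Q y`. -/
def ray (Q : E →L[ℝ] E) (y : E) (t : ℝ) : E := y - Q y + t • Q y

variable {Q : E →L[ℝ] E}

@[simp] theorem ray_one (y : E) : ray Q y 1 = y := by simp [ray]

@[simp] theorem ray_zero (y : E) : ray Q y 0 = y - Q y := by simp [ray]

theorem map_ray (hQ : ∀ y, Q (Q y) = Q y) (y : E) (t : ℝ) : Q (ray Q y t) = t • Q y := by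
  simp [ray, hQ]

theorem ray_ray (hQ : ∀ y, Q (Q y) = Q y) (y : E) (s t : ℝ) :
    ray Q (ray Q y t) s = ray Q y (t * s) := by
  rw [ray, map_ray hQ, ray, ray, smul_smul, mul_comm t s]
  abel

theorem hasDerivAt_ray (y : E) (t : ℝ) : HasDerivAt (ray Q y) (Q y) t := by
  have := ((hasDerivAt_id t).smul_const (Q y)).const_add (y - Q y)
  rw [one_smul] at this
  exact this

theorem contDiff_ray : ContDiff ℝ ∞ (fun z : E × ℝ ↦ ray Q z.1 z.2) := by
  unfold ray; fun_prop

theorem eventually_ray {p : E → Prop} (h : ∀ᶠ y in 𝓝 0, p y) :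
    ∀ᶠ y in 𝓝 0, ∀ t ∈ Icc (0 : ℝ) 1, p (ray Q y t) := by
  obtain ⟨r, hr, hp⟩ := Metric.eventually_nhds_iff_ball.1 h
  have hpos : 0 < 1 + 2 * ‖Q‖ := by positivity
  filter_upwards [Metric.ball_mem_nhds (0 : E) (div_pos hr hpos)] with y hy t ht
  refine hp _ ?_
  rw [mem_ball_zero_iff, lt_div_iff₀ hpos] at hy
  rw [mem_ball_zero_iff]
  refine lt_of_le_of_lt ?_ hy
  have h1 := Q.le_opNorm y
  have h2 : ‖t • Q y‖ ≤ ‖Q y‖ := by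
    rw [norm_smul, Real.norm_of_nonneg ht.1]
    exact mul_le_of_le_one_left (norm_nonneg _) ht.2
  calc ‖ray Q y t‖ ≤ ‖y‖ + ‖Q y‖ + ‖t • Q y‖ :=
        (norm_add_le _ _).trans (by gcongr; exact norm_sub_le _ _)
    _ ≤ ‖y‖ * (1 + 2 * ‖Q‖) := by linarith

/-- If a field of linear maps kills the radial direction `Q y` at `y`, then at every point of the
ray of `y`, the starting point included, it kills the direction of that ray. -/
theorem eventually_ray_of_radial (hQ : ∀ y, Q (Q y) = Q y) {f : E → E →L[ℝ] F}
    (hf : ∀ᶠ y in 𝓝 0, ContinuousAt f y) (h : ∀ᶠ y in 𝓝 0, f y (Q y) = 0) :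
    ∀ᶠ y in 𝓝 0, ∀ t ∈ Icc (0 : ℝ) 1, f (ray Q y t) (Q y) = 0 := by
  filter_upwards [eventually_ray (Q := Q) (hf.and h)] with y hy t ht
  have hpos : ∀ t ∈ Ioc (0 : ℝ) 1, f (ray Q y t) (Q y) = 0 := fun t ht ↦ by
    have := (hy t (Ioc_subset_Icc_self ht)).2
    rw [map_ray hQ, map_smul] at this
    exact (smul_eq_zero.1 this).resolve_left ht.1.ne'
  rcases ht.1.eq_or_lt with rfl | h0
  · -- The case `t = 0` follows by continuity from the points `t > 0` of the ray.
    have hc : ContinuousAt (fun t ↦ f (ray Q y t) (Q y)) 0 :=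
      ContinuousAt.clm_apply
        (ContinuousAt.comp (f := ray Q y) (g := f) (hy 0 ht).1 (hasDerivAt_ray y 0).continuousAt)
        continuousAt_const
    refine tendsto_nhds_unique (hc.tendsto.mono_left (nhdsWithin_le_nhds (s := Ioi 0))) ?_
    refine tendsto_const_nhds.congr' ?_
    filter_upwards [Ioc_mem_nhdsGT zero_lt_one] with t ht
    exact (hpos t ht).symm
  · exact hpos t ⟨h0, ht.2⟩

/-- A function whose radial derivative vanishes is constant along the rays. -/
theorem eventually_eq_of_fderiv_radial (hQ : ∀ y, Q (Q y) = Q y) {f : E → F}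
    (hf : ∀ᶠ y in 𝓝 0, ContDiffAt ℝ 1 f y) (h : ∀ᶠ y in 𝓝 0, fderiv ℝ f y (Q y) = 0) :
    ∀ᶠ y in 𝓝 0, f y = f (y - Q y) := by
  have hc : ∀ᶠ y in 𝓝 0, ContinuousAt (fderiv ℝ f) y := by
    filter_upwards [hf] with y hy
    exact (hy.fderiv_right (m := 0) (by simp)).continuousAt
  filter_upwards [eventually_ray (Q := Q) hf, eventually_ray_of_radial hQ hc h] with y hy hy'
  have hd : ∀ t ∈ Icc (0 : ℝ) 1, HasDerivAt (fun t ↦ f (ray Q y t)) 0 t := fun t ht ↦ by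
    rw [← hy' t ht]
    exact ((hy t ht).differentiableAt (by simp)).hasFDerivAt.comp_hasDerivAt t (hasDerivAt_ray y t)
  have := constant_of_has_deriv_right_zero (f := fun t ↦ f (ray Q y t)) (a := 0) (b := 1)
    (fun t ht ↦ (hd t ht).continuousAt.continuousWithinAt)
    (fun t ht ↦ (hd t (Ico_subset_Icc_self ht)).hasDerivWithinAt) 1 (by simp)
  simpa using this

/-- Radial parallel transport: for a connection form `Γ` with values in the endomorphisms of `F`
there is a smooth `X` that is parallel in the radial direction `Q y` and has prescribed values
on `Q y = 0`. -/
theorem exists_radial_transport [CompleteSpace F] (hQ : ∀ y, Q (Q y) = Q y)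
    {Γ : E → E →L[ℝ] F →L[ℝ] F} (hΓ : ∀ᶠ y in 𝓝 0, ContDiffAt ℝ ∞ Γ y) {X₀ : E → F}
    (hX₀ : ∀ᶠ y in 𝓝 0, ContDiffAt ℝ ∞ X₀ y) (hinv : ∀ y, X₀ (y - Q y) = X₀ y) :
    ∃ X : E → F, ∀ᶠ y in 𝓝 0, ContDiffAt ℝ ∞ X y ∧ fderiv ℝ X y (Q y) + Γ y (Q y) (X y) = 0 ∧
      (Q y = 0 → X y = X₀ y) := by
  set A : E → ℝ → F →L[ℝ] F := fun y t ↦ -Γ (ray Q y t) (Q y) with hA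
  have hAs : ∀ᶠ y in 𝓝 0, ∀ t ∈ Icc (0 : ℝ) 1, ContDiffAt ℝ ∞ (Function.uncurry A) (y, t) := by
    filter_upwards [eventually_ray (Q := Q) hΓ] with y hy t ht
    have h1 : ContDiffAt ℝ ∞ (fun z : E × ℝ ↦ Γ (ray Q z.1 z.2)) (y, t) :=
      ContDiffAt.comp (y, t) (f := fun z : E × ℝ ↦ ray Q z.1 z.2) (hy t ht) contDiff_ray.contDiffAt
    exact (h1.clm_apply (Q.contDiff.comp contDiff_fst).contDiffAt).neg
  obtain ⟨Y, hY⟩ := exists_linear_ode_solution hAs (fun t _ ↦ by simp [hA]) hX₀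
  refine ⟨fun y ↦ Y y ⟨1, by simp⟩, ?_⟩
  have hsm : ∀ᶠ y in 𝓝 0, ContDiffAt ℝ ∞ (fun y ↦ Y y ⟨1, by simp⟩) y := by
    filter_upwards [hY] with y hy
    have : ContDiff ℝ ∞ (fun φ : Path01 F ↦ φ ⟨1, by simp⟩) :=
      (LinearMap.mkContinuous (σ := RingHom.id ℝ)
        { toFun := fun φ : Path01 F ↦ φ ⟨1, by simp⟩
          map_add' := fun _ _ ↦ rfl
          map_smul' := fun _ _ ↦ rfl } 1
        (fun φ ↦ (φ.norm_coe_le_norm _).trans (one_mul _).ge)).contDiff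
    exact this.contDiffAt.comp y hy.1
  filter_upwards [eventually_ray (Q := Q) hY, hY, hsm] with y hray hy hsmy
  obtain ⟨-, hpath, huniq⟩ := hy
  have hYy : Y y = Path01.constL (X₀ y) + volterra (pathMap A y) (Y y) := (huniq _).2 rfl
  have hval : ∀ t : Icc (0 : ℝ) 1, Y y t = X₀ y +
      ∫ s in (0 : ℝ)..t, IccExtend zero_le_one (pathMul (pathMap A y) (Y y)) s := fun t ↦ by
    conv_lhs => rw [hYy]
    rfl
  -- By uniqueness, the solution at a point of the ray is a rescaling of the solution at `y`.
  have hscale : ∀ t : Icc (0 : ℝ) 1, Y (ray Q y t) ⟨1, by simp⟩ = Y y t := by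
    intro t
    obtain ⟨-, hpath', huniq'⟩ := hray t t.2
    have hmem : ∀ s : Icc (0 : ℝ) 1, (t * s : ℝ) ∈ Icc (0 : ℝ) 1 := fun s ↦
      ⟨mul_nonneg t.2.1 s.2.1, mul_le_one₀ t.2.2 s.2.1 s.2.2⟩
    set Z : Path01 F := Path01.mk (fun s ↦ Y y ⟨t * s, hmem s⟩)
      ((Y y).continuous.comp (by fun_prop)) with hZ
    have hZeq : Z = Y (ray Q y t) := by
      rw [← huniq' Z]
      ext s
      have h0 : X₀ (ray Q y t) = X₀ y := by
        rw [← hinv (ray Q y t), ← hinv y, map_ray hQ, ray, add_sub_cancel_right]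
      simp only [hZ, Path01.mk_apply, Path01.add_apply, Path01.constL_apply, volterra_apply,
        pathPrimitive_apply, h0]
      rw [hval, ← hZ]
      congr 1
      have := intervalIntegral.smul_integral_comp_mul_left (a := 0) (b := (s : ℝ))
        (fun s ↦ IccExtend zero_le_one (pathMul (pathMap A y) (Y y)) s) (t : ℝ)
      rw [mul_zero] at this
      rw [← this, ← intervalIntegral.integral_smul]
      refine intervalIntegral.integral_congr fun r hr ↦ ?_
      rw [uIcc_of_le s.2.1] at hr
      have hr1 : r ∈ Icc (0 : ℝ) 1 := ⟨hr.1, hr.2.trans s.2.2⟩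
      have hr2 := hmem ⟨r, hr1⟩
      rw [IccExtend_of_mem _ _ hr1, IccExtend_of_mem _ _ hr2, pathMul_apply, pathMul_apply,
        hpath, hpath']
      simp [hA, hZ, ray_ray hQ, map_ray hQ]
    rw [← hZeq, hZ, Path01.mk_apply]
    simp
  refine ⟨hsmy, ?_, fun h0 ↦ ?_⟩
  · have h1 : HasDerivWithinAt (IccExtend zero_le_one (Y y)) (A y 1 (Y y ⟨1, by simp⟩))
        (Icc 0 1) 1 := by
      have := (hasDerivWithinAt_pathPrimitive (pathMul (pathMap A y) (Y y)) ⟨1, by simp⟩).const_add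
        (X₀ y)
      rw [pathMul_apply, hpath] at this
      refine this.congr (fun s hs ↦ ?_) ?_
      · rw [IccExtend_of_mem _ _ hs, IccExtend_of_mem _ _ hs, hval]; rfl
      · rw [IccExtend_of_mem _ _ (by simp : (1 : ℝ) ∈ Icc (0 : ℝ) 1),
          IccExtend_of_mem _ _ (by simp : (1 : ℝ) ∈ Icc (0 : ℝ) 1), hval]; rfl
    have h2 : HasDerivAt (fun t ↦ Y (ray Q y t) ⟨1, by simp⟩)
        (fderiv ℝ (fun y ↦ Y y ⟨1, by simp⟩) y (Q y)) 1 := by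
      refine HasFDerivAt.comp_hasDerivAt (l := fun y ↦ Y y ⟨1, by simp⟩) (1 : ℝ) ?_
        (hasDerivAt_ray y 1)
      rw [ray_one]
      exact (hsmy.differentiableAt (by simp)).hasFDerivAt
    have h3 := h2.hasDerivWithinAt (s := Icc 0 1) |>.congr (f₁ := IccExtend zero_le_one (Y y))
      (fun s hs ↦ by rw [IccExtend_of_mem _ _ hs, ← hscale ⟨s, hs⟩])
      (by rw [IccExtend_of_mem _ _ (by simp : (1 : ℝ) ∈ Icc (0 : ℝ) 1), ray_one])
    rw [(uniqueDiffOn_Icc zero_lt_one 1 (by simp)).eq_deriv _ h3 h1]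
    simp [hA]
  · have hA0 : pathMap A y = 0 := by
      ext1 t
      rw [hpath]
      simp [hA, h0]
    rw [hYy, hA0]
    simp

/-- If the curvature of `Γ` vanishes in the directions of the range of `Q`, a section that is
parallel in the radial direction is parallel in all these directions. -/
theorem eventually_parallel_of_radial (hQ : ∀ y, Q (Q y) = Q y)
    {Γ : E → E →L[ℝ] F →L[ℝ] F} (hΓ : ∀ᶠ y in 𝓝 0, ContDiffAt ℝ ∞ Γ y) {X : E → F}
    (hX : ∀ᶠ y in 𝓝 0, ContDiffAt ℝ ∞ X y)
    (hrad : ∀ᶠ y in 𝓝 0, fderiv ℝ X y (Q y) + Γ y (Q y) (X y) = 0)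
    (hcurv : ∀ᶠ y in 𝓝 0, ∀ a b, Q a = a → Q b = b →
      fderiv ℝ Γ y a b (X y) - fderiv ℝ Γ y b a (X y)
        + Γ y a (Γ y b (X y)) - Γ y b (Γ y a (X y)) = 0) :
    ∀ᶠ y in 𝓝 0, ∀ b, Q b = b → fderiv ℝ X y b + Γ y b (X y) = 0 := by
  obtain ⟨C, hC⟩ : ∃ C, ∀ᶠ y in 𝓝 0, ‖Γ y‖ ≤ C :=
    ⟨‖Γ 0‖ + 1, ((ContinuousAt.norm (f := Γ) hΓ.self_of_nhds.continuousAt).eventually_lt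
      continuousAt_const (lt_add_one _)).mono fun _ h ↦ le_of_lt h⟩
  set N : E → E →L[ℝ] F := fun y ↦
    fderiv ℝ X y + (ContinuousLinearMap.apply ℝ F (X y)).comp (Γ y) with hN
  have hNapp : ∀ y b, N y b = fderiv ℝ X y b + Γ y b (X y) := fun y b ↦ rfl
  have hNs : ∀ᶠ y in 𝓝 0, ContDiffAt ℝ ∞ N y := by
    filter_upwards [hX, hΓ] with y h1 h2
    have h3 : ContDiffAt ℝ ∞ (fun y ↦ ContinuousLinearMap.apply ℝ F (X y)) y :=
      (ContinuousLinearMap.apply (E := F) ℝ F).contDiff.contDiffAt.comp y h1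
    exact (h1.fderiv_right (m := ∞) (by simp)).add (h3.clm_comp h2)
  -- The derivative of `N` in the radial direction, found by differentiating the radial equation.
  have hNder : ∀ᶠ y in 𝓝 0, ∀ b, Q b = b →
      fderiv ℝ N y (Q y) b = - N y b - Γ y (Q y) (N y b) := by
    filter_upwards [hX, hΓ, hcurv, hrad, hNs, hrad.eventually_nhds] with y h1 h2 h3 h4 h5 h6 b hb
    have hX1 : DifferentiableAt ℝ X y := h1.differentiableAt (by simp)
    have hX2 : DifferentiableAt ℝ (fderiv ℝ X) y :=
      (h1.fderiv_right (m := ∞) (by simp)).differentiableAt (by simp)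
    have hΓ1 : DifferentiableAt ℝ Γ y := h2.differentiableAt (by simp)
    have hN1 : ∀ a b, fderiv ℝ N y a b =
        fderiv ℝ (fderiv ℝ X) y a b + fderiv ℝ Γ y a b (X y) + Γ y b (fderiv ℝ X y a) := by
      intro a b
      rw [← fderiv_clm_apply_const (h5.differentiableAt (by simp)) b a]
      change fderiv ℝ (fun z ↦ fderiv ℝ X z b + Γ z b (X z)) y a = _
      have hΓ2 : DifferentiableAt ℝ (fun z ↦ Γ z b) y := hΓ1.clm_apply (differentiableAt_const b)
      rw [fderiv_fun_add (hX2.clm_apply (differentiableAt_const b)) (hΓ2.clm_apply hX1), add_apply,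
        fderiv_clm_apply_const hX2, fderiv_clm_apply_apply hΓ2 hX1, fderiv_clm_apply_const hΓ1,
        add_assoc]
    have hsymm : fderiv ℝ (fderiv ℝ X) y (Q y) b = fderiv ℝ (fderiv ℝ X) y b (Q y) :=
      (h1.isSymmSndFDerivAt (by
        rw [minSmoothness_of_isRCLikeNormedField]
        exact ENat.LEInfty.out)).eq _ _
    have hdiff : fderiv ℝ N y b (Q y) + N y b = 0 := by
      have e1 := fderiv_clm_apply_apply (h5.differentiableAt (by simp)) Q.differentiableAt b
      have e2 : (fun z ↦ N z (Q z)) =ᶠ[𝓝 y] fun _ ↦ 0 := h6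
      rw [e2.fderiv_eq, ContinuousLinearMap.fderiv, hb] at e1
      simpa using e1.symm
    have e3 := h3 (Q y) b (hQ y) hb
    have e4 : fderiv ℝ X y b = N y b - Γ y b (X y) := by rw [hNapp]; abel
    have e5 : fderiv ℝ X y (Q y) = - Γ y (Q y) (X y) := eq_neg_of_add_eq_zero_left h4
    rw [hN1] at hdiff ⊢
    rw [hsymm]
    rw [e4, map_sub] at hdiff
    rw [e5, map_neg]
    rw [← sub_eq_zero]
    refine Eq.trans ?_ ((congrArg₂ (· + ·) hdiff e3).trans (add_zero 0))
    abel
  filter_upwards [eventually_ray (Q := Q) (hNder.and (hNs.and hC))] with y hy b hb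
  -- `t • N` solves a linear equation along the ray, with the initial value `0`.
  have hd : ∀ t ∈ Icc (0 : ℝ) 1, HasDerivAt (fun t : ℝ ↦ t • N (ray Q y t) b)
      (-Γ (ray Q y t) (Q y) (t • N (ray Q y t) b)) t := by
    intro t ht
    obtain ⟨h1, h2, -⟩ := hy t ht
    have e1 : HasDerivAt (fun t ↦ N (ray Q y t)) (fderiv ℝ N (ray Q y t) (Q y)) t :=
      (h2.differentiableAt (by simp)).hasFDerivAt.comp_hasDerivAt t (hasDerivAt_ray y t)
    have e2 := (hasDerivAt_id t).smul (e1.clm_apply (hasDerivAt_const t b))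
    have e3 := h1 b hb
    rw [map_ray hQ] at e3
    refine e2.congr_deriv ?_
    simp only [id, map_zero, add_zero, one_smul]
    rw [map_smul, smul_apply, map_smul, smul_apply] at e3
    rw [e3, map_smul]
    abel
  have h0 := eq_zero_of_abs_deriv_le_mul_abs_self_of_eq_zero_right (a := 0) (b := 1)
    (K := C * ‖Q y‖)
    (fun t ht ↦ (hd t ht).continuousAt.continuousWithinAt)
    (fun t ht ↦ (hd t (Ico_subset_Icc_self ht)).hasDerivWithinAt) (by simp)
    (fun t ht ↦ by
      rw [norm_neg]
      refine ((Γ (ray Q y t)).le_opNorm₂ _ _).trans ?_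
      gcongr
      exact (hy t (Ico_subset_Icc_self ht)).2.2) 1 (by simp)
  rw [← hNapp]
  simpa using h0

/-- `θ ↦ θ ⊗ c`, as a continuous linear map in `θ`. -/
def smulRightCLM (c : F) : (E →L[ℝ] ℝ) →L[ℝ] E →L[ℝ] F :=
  (ContinuousLinearMap.smulRightL ℝ E F).flip c

@[simp] theorem smulRightCLM_apply (c : F) (θ : E →L[ℝ] ℝ) (a : E) :
    smulRightCLM c θ a = θ a • c := rfl

/-- The Poincaré lemma along the range of `Q`: a form that is closed in these directions has a
primitive in these directions. -/
theorem exists_primitive (hQ : ∀ y, Q (Q y) = Q y) {θ : E → E →L[ℝ] ℝ}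
    (hθ : ∀ᶠ y in 𝓝 0, ContDiffAt ℝ ∞ θ y)
    (hclosed : ∀ᶠ y in 𝓝 0, ∀ a b, Q a = a → Q b = b → fderiv ℝ θ y a b = fderiv ℝ θ y b a) :
    ∃ f : E → ℝ, ∀ᶠ y in 𝓝 0, ContDiffAt ℝ ∞ f y ∧ ∀ b, Q b = b → fderiv ℝ f y b = θ y b := by
  -- A primitive is the first component of a section `(f, 1)` of the trivial plane bundle that
  -- is parallel for the connection form `-θ ⊗ N`, where `N (p, q) = (q, 0)`.
  set N : ℝ × ℝ →L[ℝ] ℝ × ℝ :=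
    (ContinuousLinearMap.inl ℝ ℝ ℝ).comp (ContinuousLinearMap.snd ℝ ℝ ℝ) with hN
  set L := smulRightCLM (E := E) (-N) with hL
  have hLapp : ∀ θ a z, L θ a z = (-(θ a * z.2), 0) := by
    intro θ a z
    simp [hL, hN]
  have hΓ : ∀ᶠ y in 𝓝 0, ContDiffAt ℝ ∞ (fun y ↦ L (θ y)) y := by
    filter_upwards [hθ] with y hy
    exact L.contDiff.contDiffAt.comp y hy
  obtain ⟨X, hX⟩ := exists_radial_transport hQ hΓ (X₀ := fun _ ↦ ((0 : ℝ), (1 : ℝ)))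
    (Eventually.of_forall fun _ ↦ contDiffAt_const) (fun _ ↦ rfl)
  have hpar := eventually_parallel_of_radial hQ hΓ (hX.mono fun _ h ↦ h.1)
    (hX.mono fun _ h ↦ h.2.1) (by
      filter_upwards [hθ, hclosed] with y h1 h2 a b ha hb
      have e : HasFDerivAt (fun y ↦ L (θ y)) _ y :=
        L.hasFDerivAt.comp y (h1.differentiableAt (by simp)).hasFDerivAt
      rw [e.fderiv]
      simp [hLapp, h2 a b ha hb])
  have hcomp : ∀ᶠ y in 𝓝 0, ContDiffAt ℝ ∞ (fun y ↦ (X y).1) y ∧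
      ContDiffAt ℝ ∞ (fun y ↦ (X y).2) y ∧ ∀ b,
      fderiv ℝ (fun y ↦ (X y).1) y b = (fderiv ℝ X y b).1 ∧
      fderiv ℝ (fun y ↦ (X y).2) y b = (fderiv ℝ X y b).2 := by
    filter_upwards [hX] with y hy
    refine ⟨contDiff_fst.contDiffAt.comp y hy.1, contDiff_snd.contDiffAt.comp y hy.1, fun b ↦ ?_⟩
    have h1 := (hy.1.differentiableAt (by simp)).hasFDerivAt
    rw [h1.fst.fderiv, h1.snd.fderiv]
    exact ⟨rfl, rfl⟩
  have hsnd := eventually_eq_of_fderiv_radial (f := fun y ↦ (X y).2) hQ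
    (hcomp.mono fun y h ↦ h.2.1.of_le (by exact_mod_cast le_top)) (by
      filter_upwards [hcomp, hX] with y h1 h2
      rw [(h1.2.2 _).2]
      have := congrArg Prod.snd h2.2.1
      simpa [hLapp] using this)
  have hbase := (eventually_ray (Q := Q) hX).mono fun y h ↦ (h 0 (by simp)).2.2
  refine ⟨fun y ↦ (X y).1, ?_⟩
  filter_upwards [hcomp, hpar, hsnd, hbase] with y h1 h2 h3 h4
  refine ⟨h1.1, fun b hb ↦ ?_⟩
  rw [ray_zero] at h4
  rw [h4 (by simp [hQ])] at h3
  have := congrArg Prod.fst (h2 b hb)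
  rw [(h1.2.2 b).1]
  simp only [hLapp, h3, Prod.fst_add, Prod.fst_zero] at this
  linarith

end Transport

/-! ### Levi-Civita connections on open subsets of a vector space -/

section LocalConnection

open Set Filter Topology

variable {E : Type} [NormedAddCommGroup E] [NormedSpace ℝ E]

/-- At `y`, the smooth symmetric bilinear forms `G` have `Γ` as Christoffel symbols of
their Levi-Civita connection: `Γ` is symmetric and compatible with `G`. -/
structure IsLeviCivitaAt (G : E → E →L[ℝ] E →L[ℝ] ℝ) (Γ : E → E →L[ℝ] E →L[ℝ] E) (y : E) :
    Prop where
  contDiffAt_metric : ContDiffAt ℝ ∞ G y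
  contDiffAt_christoffel : ContDiffAt ℝ ∞ Γ y
  symm (a b : E) : G y a b = G y b a
  torsionFree (a b : E) : Γ y a b = Γ y b a
  compatible (a b c : E) : fderiv ℝ G y a b c = G y (Γ y a b) c + G y b (Γ y a c)

/-- The covariant derivative `∇_a X = DX(a) + Γ(a, X)` at `y`, as a linear function of `a`. -/
def covDeriv (Γ : E → E →L[ℝ] E →L[ℝ] E) (X : E → E) (y : E) : E →L[ℝ] E :=
  fderiv ℝ X y + (ContinuousLinearMap.apply ℝ E (X y)).comp (Γ y)

/-- The curvature `R(a, b) c` of the connection with Christoffel symbols `Γ`. -/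
def christoffelCurvature (Γ : E → E →L[ℝ] E →L[ℝ] E) (y a b c : E) : E :=
  fderiv ℝ Γ y a b c - fderiv ℝ Γ y b a c + Γ y a (Γ y b c) - Γ y b (Γ y a c)

variable {G : E → E →L[ℝ] E →L[ℝ] ℝ} {Γ : E → E →L[ℝ] E →L[ℝ] E} {X Y : E → E} {y : E}

theorem covDeriv_apply (a : E) : covDeriv Γ X y a = fderiv ℝ X y a + Γ y a (X y) := rfl

theorem contDiffAt_covDeriv (hΓ : ContDiffAt ℝ ∞ Γ y) (hX : ContDiffAt ℝ ∞ X y) :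
    ContDiffAt ℝ ∞ (covDeriv Γ X) y := by
  have h3 : ContDiffAt ℝ ∞ (fun y ↦ ContinuousLinearMap.apply ℝ E (X y)) y :=
    (ContinuousLinearMap.apply (E := E) ℝ E).contDiff.contDiffAt.comp y hX
  exact (hX.fderiv_right (m := ∞) (by simp)).add (h3.clm_comp hΓ)

theorem contDiffAt_infty_differentiableAt {F : Type} [NormedAddCommGroup F] [NormedSpace ℝ F]
    {f : E → F} (hf : ContDiffAt ℝ ∞ f y) : DifferentiableAt ℝ f y :=
  hf.differentiableAt (by simp)

theorem contDiffAt_infty_differentiableAt_fderiv {F : Type} [NormedAddCommGroup F]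
    [NormedSpace ℝ F] {f : E → F} (hf : ContDiffAt ℝ ∞ f y) :
    DifferentiableAt ℝ (fderiv ℝ f) y :=
  (hf.fderiv_right (m := ∞) (by simp)).differentiableAt (by simp)

theorem fderiv_fderiv_symm {F : Type} [NormedAddCommGroup F] [NormedSpace ℝ F]
    {f : E → F} (hf : ContDiffAt ℝ ∞ f y) (a b : E) :
    fderiv ℝ (fderiv ℝ f) y a b = fderiv ℝ (fderiv ℝ f) y b a :=
  (hf.isSymmSndFDerivAt (by
    rw [minSmoothness_of_isRCLikeNormedField]
    exact ENat.LEInfty.out)).eq _ _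

/-- The derivative of the one-form `G(X, ·)`. -/
theorem fderiv_flat (h : IsLeviCivitaAt G Γ y) (hX : ContDiffAt ℝ ∞ X y) (a b : E) :
    fderiv ℝ (fun z ↦ G z (X z)) y a b = G y (covDeriv Γ X y a) b + G y (X y) (Γ y a b) := by
  rw [fderiv_clm_apply_apply (contDiffAt_infty_differentiableAt h.contDiffAt_metric)
    (contDiffAt_infty_differentiableAt hX), add_apply, h.compatible, covDeriv_apply, map_add,
    add_apply]
  ring

/-- Metric compatibility: `a (G(X, Y)) = G(∇_a X, Y) + G(X, ∇_a Y)`. -/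
theorem fderiv_metric_apply (h : IsLeviCivitaAt G Γ y) (hX : ContDiffAt ℝ ∞ X y)
    (hY : ContDiffAt ℝ ∞ Y y) (a : E) :
    fderiv ℝ (fun z ↦ G z (X z) (Y z)) y a =
      G y (covDeriv Γ X y a) (Y y) + G y (X y) (covDeriv Γ Y y a) := by
  have hG := contDiffAt_infty_differentiableAt h.contDiffAt_metric
  have hX' := contDiffAt_infty_differentiableAt hX
  rw [fderiv_clm_apply_apply (hG.clm_apply hX') (contDiffAt_infty_differentiableAt hY),
    fderiv_flat h hX, covDeriv_apply (X := Y), map_add]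
  ring

/-- The curvature as a commutator of covariant derivatives in constant directions. -/
theorem covDeriv_covDeriv_sub (hΓ : ContDiffAt ℝ ∞ Γ y) (hX : ContDiffAt ℝ ∞ X y) (a b : E) :
    covDeriv Γ (fun z ↦ covDeriv Γ X z b) y a - covDeriv Γ (fun z ↦ covDeriv Γ X z a) y b =
      christoffelCurvature Γ y a b (X y) := by
  have hΓ1 := contDiffAt_infty_differentiableAt hΓ
  have hX1 := contDiffAt_infty_differentiableAt hX
  have hX2 := contDiffAt_infty_differentiableAt_fderiv hX
  have key : ∀ a b, covDeriv Γ (fun z ↦ covDeriv Γ X z b) y a =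
      fderiv ℝ (fderiv ℝ X) y a b + (fderiv ℝ Γ y a b (X y) + Γ y b (fderiv ℝ X y a)) +
        (Γ y a (fderiv ℝ X y b) + Γ y a (Γ y b (X y))) := by
    intro a b
    have hΓ2 : DifferentiableAt ℝ (fun z ↦ Γ z b) y := hΓ1.clm_apply (differentiableAt_const b)
    rw [covDeriv_apply]
    congr 1
    · change fderiv ℝ (fun z ↦ fderiv ℝ X z b + Γ z b (X z)) y a = _
      rw [fderiv_fun_add (hX2.clm_apply (differentiableAt_const b)) (hΓ2.clm_apply hX1), add_apply,
        fderiv_clm_apply_const hX2, fderiv_clm_apply_apply hΓ2 hX1, fderiv_clm_apply_const hΓ1]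
    · rw [covDeriv_apply, map_add]
  rw [key, key, fderiv_fderiv_symm hX b a, christoffelCurvature]
  abel

theorem metric_curvature_skew (h : ∀ᶠ z in 𝓝 y, IsLeviCivitaAt G Γ z) (a b c d : E) :
    G y (christoffelCurvature Γ y a b c) d = - G y c (christoffelCurvature Γ y a b d) := by
  have h0 := h.self_of_nhds
  have hcov : ∀ c a : E, ContDiffAt ℝ ∞ (fun z ↦ covDeriv Γ (fun _ ↦ c) z a) y := fun c a ↦
    (contDiffAt_covDeriv h0.contDiffAt_christoffel contDiffAt_const).clm_apply contDiffAt_const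
  have hf : ContDiffAt ℝ ∞ (fun z ↦ G z c d) y :=
    (h0.contDiffAt_metric.clm_apply contDiffAt_const).clm_apply contDiffAt_const
  have key : ∀ a b, fderiv ℝ (fderiv ℝ (fun z ↦ G z c d)) y a b =
      (G y (covDeriv Γ (fun z ↦ covDeriv Γ (fun _ ↦ c) z b) y a) d +
        G y (covDeriv Γ (fun _ ↦ c) y b) (covDeriv Γ (fun _ ↦ d) y a)) +
      (G y (covDeriv Γ (fun _ ↦ c) y a) (covDeriv Γ (fun _ ↦ d) y b) +
        G y c (covDeriv Γ (fun z ↦ covDeriv Γ (fun _ ↦ d) z b) y a)) := by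
    intro a b
    rw [← fderiv_clm_apply_const (contDiffAt_infty_differentiableAt_fderiv hf)]
    have e : (fun z ↦ fderiv ℝ (fun z ↦ G z c d) z b) =ᶠ[𝓝 y] fun z ↦
        G z (covDeriv Γ (fun _ ↦ c) z b) d + G z c (covDeriv Γ (fun _ ↦ d) z b) := by
      filter_upwards [h] with z hz
      exact fderiv_metric_apply hz contDiffAt_const contDiffAt_const b
    have hG := h0.contDiffAt_metric
    rw [e.fderiv_eq, fderiv_fun_add
      (contDiffAt_infty_differentiableAt ((hG.clm_apply (hcov c b)).clm_apply contDiffAt_const))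
      (contDiffAt_infty_differentiableAt ((hG.clm_apply contDiffAt_const).clm_apply (hcov d b))),
      add_apply, fderiv_metric_apply h0 (hcov c b) contDiffAt_const,
      fderiv_metric_apply h0 contDiffAt_const (hcov d b)]
  have hs := fderiv_fderiv_symm hf a b
  rw [key, key] at hs
  rw [← covDeriv_covDeriv_sub (X := fun _ ↦ c) h0.contDiffAt_christoffel contDiffAt_const,
    ← covDeriv_covDeriv_sub (X := fun _ ↦ d) h0.contDiffAt_christoffel contDiffAt_const,
    map_sub, map_sub, sub_apply]
  linarith

theorem christoffelCurvature_swap (a b c : E) :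
    christoffelCurvature Γ y a b c = - christoffelCurvature Γ y b a c := by
  simp only [christoffelCurvature]; abel

/-- The first Bianchi identity. -/
theorem christoffelCurvature_cyclic (h : ∀ᶠ z in 𝓝 y, IsLeviCivitaAt G Γ z) (a b c : E) :
    christoffelCurvature Γ y a b c + christoffelCurvature Γ y b c a
      + christoffelCurvature Γ y c a b = 0 := by
  have h0 := h.self_of_nhds
  have hΓ1 := contDiffAt_infty_differentiableAt h0.contDiffAt_christoffel
  have hd : ∀ a b c, fderiv ℝ Γ y a b c = fderiv ℝ Γ y a c b := by
    intro a b c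
    have h2 : ∀ b, DifferentiableAt ℝ (fun z ↦ Γ z b) y :=
      fun b ↦ hΓ1.clm_apply (differentiableAt_const b)
    rw [← fderiv_clm_apply_const hΓ1, ← fderiv_clm_apply_const (h2 b),
      ← fderiv_clm_apply_const hΓ1, ← fderiv_clm_apply_const (h2 c)]
    have : (fun z ↦ Γ z b c) =ᶠ[𝓝 y] fun z ↦ Γ z c b := h.mono fun z hz ↦ hz.torsionFree b c
    rw [this.fderiv_eq]
  simp only [christoffelCurvature]
  rw [hd a c b, hd b c a, hd c b a, h0.torsionFree c b, h0.torsionFree c a, h0.torsionFree b a]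
  abel

/-- The pair symmetry of the curvature tensor. -/
theorem metric_curvature_pair_symm (h : ∀ᶠ z in 𝓝 y, IsLeviCivitaAt G Γ z) (a b c d : E) :
    G y (christoffelCurvature Γ y a b c) d = G y (christoffelCurvature Γ y c d a) b := by
  have skew : ∀ a b c d, G y (christoffelCurvature Γ y a b c) d =
      - G y (christoffelCurvature Γ y a b d) c := fun a b c d ↦ by
    rw [metric_curvature_skew h, h.self_of_nhds.symm]
  have swap : ∀ a b c d, G y (christoffelCurvature Γ y a b c) d =
      - G y (christoffelCurvature Γ y b a c) d := fun a b c d ↦ by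
    rw [christoffelCurvature_swap, map_neg, neg_apply]
  have cyc : ∀ a b c d, G y (christoffelCurvature Γ y a b c) d +
      G y (christoffelCurvature Γ y b c a) d + G y (christoffelCurvature Γ y c a b) d = 0 :=
    fun a b c d ↦ by
      rw [← add_apply, ← add_apply, ← map_add, ← map_add, christoffelCurvature_cyclic h]
      simp
  linarith [cyc a b c d, cyc b c d a, cyc c d a b, cyc d a b c,
    skew a b c d, skew b c a d, skew c a b d, skew b c d a, skew c d b a, skew d b c a,
    skew c d a b, skew d a c b, skew a c d b, skew d a b c, skew a b d c, skew b d a c,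
    swap c a b d, swap d b c a, swap a c d b, swap b d a c, swap a b c d, swap c d a b,
    swap b c a d, swap d a b c]

end LocalConnection

/-! ### Frames adapted to a flat foliation by hyperplanes -/

section AdaptedFrame

open Set Filter Topology

variable {E : Type} [NormedAddCommGroup E] [NormedSpace ℝ E]

/-- `X` is parallel along the axis spanned by `e`, and in each hyperplane `τ = const` it is
parallel in the radial direction from the axis. -/
structure IsAxiallyParallel (Γ : E → E →L[ℝ] E →L[ℝ] E) (τ : E →L[ℝ] ℝ) (e : E) (X : E → E) :
    Prop where
  smooth : ∀ᶠ y in 𝓝 0, ContDiffAt ℝ ∞ X y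
  radial : ∀ᶠ y in 𝓝 0, covDeriv Γ X y (y - τ y • e) = 0
  axis : ∀ᶠ y in 𝓝 0, covDeriv Γ X (τ y • e) e = 0

variable {G : E → E →L[ℝ] E →L[ℝ] ℝ} {Γ : E → E →L[ℝ] E →L[ℝ] E} {τ : E →L[ℝ] ℝ} {e : E}

/-- The projection `y ↦ τ(y) e` onto the axis. -/
def axisProj (τ : E →L[ℝ] ℝ) (e : E) : E →L[ℝ] E := τ.smulRight e

/-- The projection `y ↦ y - τ(y) e` onto the hyperplane `τ = 0` along the axis. -/
def leafProj (τ : E →L[ℝ] ℝ) (e : E) : E →L[ℝ] E := ContinuousLinearMap.id ℝ E - τ.smulRight e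

@[simp] theorem axisProj_apply (y : E) : axisProj τ e y = τ y • e := rfl

@[simp] theorem leafProj_apply (y : E) : leafProj τ e y = y - τ y • e := rfl

theorem axisProj_idem (he : τ e = 1) (y : E) : axisProj τ e (axisProj τ e y) = axisProj τ e y := by
  simp [he]

theorem leafProj_idem (he : τ e = 1) (y : E) : leafProj τ e (leafProj τ e y) = leafProj τ e y := by
  simp [he]

theorem leafProj_eq_self (b : E) (hb : τ b = 0) : leafProj τ e b = b := by simp [hb]

theorem tendsto_axis (τ : E →L[ℝ] ℝ) (e : E) : Tendsto (fun y ↦ τ y • e) (𝓝 0) (𝓝 (0 : E)) := by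
  have : Continuous (fun y ↦ τ y • e) := by fun_prop
  simpa using this.tendsto 0

theorem exists_isAxiallyParallel [CompleteSpace E] (he : τ e = 1)
    (hΓ : ∀ᶠ y in 𝓝 0, ContDiffAt ℝ ∞ Γ y) (a : E) :
    ∃ X, IsAxiallyParallel Γ τ e X ∧ X 0 = a := by
  obtain ⟨X₀, hX₀⟩ := exists_radial_transport (axisProj_idem he) hΓ (X₀ := fun _ ↦ a)
    (Eventually.of_forall fun _ ↦ contDiffAt_const) (fun _ ↦ rfl)
  have hax : ∀ᶠ y in 𝓝 0, ContDiffAt ℝ ∞ (fun y ↦ X₀ (τ y • e)) y := by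
    filter_upwards [(tendsto_axis τ e).eventually hX₀] with y hy
    exact ContDiffAt.comp (f := fun y ↦ τ y • e) y hy.1 (by fun_prop)
  obtain ⟨X, hX⟩ := exists_radial_transport (leafProj_idem he) hΓ hax (fun y ↦ by simp [he])
  have hXax : ∀ᶠ y in 𝓝 0, X (τ y • e) = X₀ (τ y • e) := by
    filter_upwards [(tendsto_axis τ e).eventually hX] with y hy
    simpa [he] using hy.2.2
  refine ⟨X, ⟨hX.mono fun y h ↦ h.1, hX.mono fun y h ↦ h.2.1, ?_⟩, ?_⟩
  · have h1 : ∀ᶠ y in 𝓝 0, covDeriv Γ X (τ y • e) e = covDeriv Γ X₀ (τ y • e) e := by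
      filter_upwards [hXax.eventually_nhds, (tendsto_axis τ e).eventually hX,
        (tendsto_axis τ e).eventually hX₀, (tendsto_axis τ e).eventually hXax.eventually_nhds]
        with y hy h1 h2 h3
      have hc : (fun s : ℝ ↦ X (τ y • e + s • e)) =ᶠ[𝓝 0] fun s ↦ X₀ (τ y • e + s • e) := by
        have ht : Tendsto (fun s : ℝ ↦ τ y • e + s • e) (𝓝 0) (𝓝 (τ y • e)) := by
          have : Continuous (fun s : ℝ ↦ τ y • e + s • e) := by fun_prop
          simpa using this.tendsto 0
        filter_upwards [ht.eventually h3] with s hs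
        simpa [he, add_smul] using hs
      have hd : ∀ Z : E → E, ContDiffAt ℝ ∞ Z (τ y • e) →
          HasDerivAt (fun s : ℝ ↦ Z (τ y • e + s • e)) (fderiv ℝ Z (τ y • e) e) 0 := by
        intro Z hZ
        have h5 : HasDerivAt (fun s : ℝ ↦ τ y • e + s • e) e 0 := by
          simpa using ((hasDerivAt_id (0 : ℝ)).smul_const e).const_add (τ y • e)
        refine HasFDerivAt.comp_hasDerivAt (0 : ℝ) ?_ h5
        simpa using (contDiffAt_infty_differentiableAt hZ).hasFDerivAt
      rw [covDeriv_apply, covDeriv_apply, hy.self_of_nhds,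
        ((hd X h1.1).congr_of_eventuallyEq hc.symm).unique (hd X₀ h2.1)]
    have hcont : ∀ᶠ y in 𝓝 0, ContinuousAt (covDeriv Γ X₀) y := by
      filter_upwards [hΓ, hX₀] with y h1 h2
      exact (contDiffAt_covDeriv h1 h2.1).continuousAt
    have h2 := eventually_ray_of_radial (axisProj_idem he) hcont (hX₀.mono fun y h ↦ h.2.1)
    filter_upwards [h1, h2, (tendsto_axis τ e).eventually h2] with y hy hy2 hy3
    rw [hy]
    by_cases h0 : τ y = 0
    · -- The point `y` of the axis is the origin: move slightly along the axis.
      have h3 : Tendsto (fun s : ℝ ↦ s • e) (𝓝[≠] 0) (𝓝 (0 : E)) := by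
        have : Continuous (fun s : ℝ ↦ s • e) := by fun_prop
        exact tendsto_nhdsWithin_of_tendsto_nhds (by simpa using this.tendsto 0)
      obtain ⟨s, hs, hs0⟩ := ((h3.eventually h2).and self_mem_nhdsWithin).exists
      have := hs 0 (by simp)
      rw [ray_zero, axisProj_apply, map_smul τ, he, smul_eq_mul, mul_one, sub_self, map_smul] at this
      rw [h0, zero_smul]
      exact (smul_eq_zero.1 this).resolve_left hs0
    · have := hy3 1 (by simp)
      rw [ray_one, axisProj_apply, map_smul τ, he, smul_eq_mul, mul_one, map_smul] at this
      exact (smul_eq_zero.1 this).resolve_left h0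
  · have h1 := hX.self_of_nhds.2.2 (by simp)
    have h2 := hX₀.self_of_nhds.2.2 (by simp)
    simpa [h2] using h1

/-- The scalar product of axially parallel fields is constant. -/
theorem IsAxiallyParallel.eventually_metric_eq (he : τ e = 1)
    (h : ∀ᶠ y in 𝓝 0, IsLeviCivitaAt G Γ y) {X Y : E → E} (hX : IsAxiallyParallel Γ τ e X)
    (hY : IsAxiallyParallel Γ τ e Y) :
    ∀ᶠ y in 𝓝 0, G y (X y) (Y y) = G 0 (X 0) (Y 0) := by
  have hsm : ∀ᶠ y in 𝓝 0, ContDiffAt ℝ ∞ (fun y ↦ G y (X y) (Y y)) y := by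
    filter_upwards [h, hX.smooth, hY.smooth] with y h1 h2 h3
    exact (h1.contDiffAt_metric.clm_apply h2).clm_apply h3
  have h1 := eventually_eq_of_fderiv_radial (f := fun y ↦ G y (X y) (Y y)) (leafProj_idem he)
    (hsm.mono fun y h ↦ h.of_le (by exact_mod_cast le_top)) (by
      filter_upwards [h, hX.smooth, hY.smooth, hX.radial, hY.radial] with y h1 h2 h3 h4 h5
      rw [fderiv_metric_apply h1 h2 h3, leafProj_apply, h4, h5]
      simp)
  have h2 := eventually_eq_of_fderiv_radial (axisProj_idem he)
    (f := fun y ↦ G (τ y • e) (X (τ y • e)) (Y (τ y • e)))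
    (by
      filter_upwards [(tendsto_axis τ e).eventually hsm] with y hy
      exact (ContDiffAt.comp (f := fun y ↦ τ y • e) y hy (by fun_prop)).of_le
        (by exact_mod_cast le_top))
    (by
      filter_upwards [(tendsto_axis τ e).eventually hsm, (tendsto_axis τ e).eventually h,
        (tendsto_axis τ e).eventually hX.smooth, (tendsto_axis τ e).eventually hY.smooth,
        hX.axis, hY.axis] with y h0 h1 h2 h3 h4 h5
      have hc : HasFDerivAt (fun y ↦ G (τ y • e) (X (τ y • e)) (Y (τ y • e))) _ y :=
        HasFDerivAt.comp (f := axisProj τ e) y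
          (contDiffAt_infty_differentiableAt h0).hasFDerivAt (axisProj τ e).hasFDerivAt
      rw [hc.fderiv, ContinuousLinearMap.comp_apply, axisProj_apply, axisProj_apply, map_smul,
        fderiv_metric_apply h1 h2 h3, h4, h5]
      simp)
  filter_upwards [h1, h2] with y h1 h2
  rw [h1, leafProj_apply, sub_sub_cancel, h2]
  simp [he]

end AdaptedFrame

/-! ### The coordinates of a pp-wave in a foliation chart -/

section Coordinates

open Set Filter Topology

variable {E : Type} [NormedAddCommGroup E] [NormedSpace ℝ E]
  {ι : Type} [Fintype ι] [DecidableEq ι]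

/-- `(V, U, F)` is a basis in which the bilinear form `B` is that of Minkowski space in null
coordinates; the field `span` expands a vector in this basis. -/
structure IsNullFrame (B : E →L[ℝ] E →L[ℝ] ℝ) (V U : E) (F : ι → E) : Prop where
  vv : B V V = 0
  uv : B U V = 1
  vu : B V U = 1
  uu : B U U = 0
  vf (i : ι) : B V (F i) = 0
  fv (i : ι) : B (F i) V = 0
  uf (i : ι) : B U (F i) = 0
  fu (i : ι) : B (F i) U = 0
  ff (i j : ι) : B (F i) (F j) = if i = j then 1 else 0
  span (a : E) : a = B U a • V + B V a • U + ∑ i, B (F i) a • F i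

/-- Near `0`, the metric `G` with Christoffel symbols `Γ` and the parallel vector field `V` form
a pp-wave whose foliation is that by the hyperplanes `τ = const`. -/
structure IsLocalPPWave (G : E → E →L[ℝ] E →L[ℝ] ℝ) (Γ : E → E →L[ℝ] E →L[ℝ] E)
    (τ : E →L[ℝ] ℝ) (V : E → E) : Prop where
  leviCivita : ∀ᶠ y in 𝓝 0, IsLeviCivitaAt G Γ y
  smooth : ∀ᶠ y in 𝓝 0, ContDiffAt ℝ ∞ V y
  parallel : ∀ᶠ y in 𝓝 0, covDeriv Γ V y = 0
  orthogonal : ∀ᶠ y in 𝓝 0, ∀ a, G y (V y) a = 0 ↔ τ a = 0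
  flat : ∀ᶠ y in 𝓝 0, ∀ a b c, τ a = 0 → τ b = 0 → τ c = 0 → christoffelCurvature Γ y a b c = 0

/-- The relations of a null frame are closed conditions except for completeness, which persists
on a neighbourhood. -/
theorem eventually_isNullFrame [CompleteSpace E] {G : E → E →L[ℝ] E →L[ℝ] ℝ}
    (hG : ContinuousAt G 0) {V U : E → E} {F : ι → E → E} (hV : ContinuousAt V 0)
    (hU : ContinuousAt U 0) (hF : ∀ i, ContinuousAt (F i) 0)
    (h0 : IsNullFrame (G 0) (V 0) (U 0) (fun i ↦ F i 0))
    (hvv : ∀ᶠ y in 𝓝 0, G y (V y) (V y) = 0) (huv : ∀ᶠ y in 𝓝 0, G y (U y) (V y) = 1)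
    (hvu : ∀ᶠ y in 𝓝 0, G y (V y) (U y) = 1)
    (huu : ∀ᶠ y in 𝓝 0, G y (U y) (U y) = 0) (hvf : ∀ i, ∀ᶠ y in 𝓝 0, G y (V y) (F i y) = 0)
    (hfv : ∀ i, ∀ᶠ y in 𝓝 0, G y (F i y) (V y) = 0)
    (huf : ∀ i, ∀ᶠ y in 𝓝 0, G y (U y) (F i y) = 0)
    (hfu : ∀ i, ∀ᶠ y in 𝓝 0, G y (F i y) (U y) = 0)
    (hff : ∀ i j, ∀ᶠ y in 𝓝 0, G y (F i y) (F j y) = if i = j then 1 else 0) :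
    ∀ᶠ y in 𝓝 0, IsNullFrame (G y) (V y) (U y) (fun i ↦ F i y) := by
  -- `P y` is the expansion of a vector in the frame; it is idempotent, and invertible near `0`.
  set P : E → E →L[ℝ] E := fun y ↦ (G y (U y)).smulRight (V y) + (G y (V y)).smulRight (U y) +
    ∑ i, (G y (F i y)).smulRight (F i y) with hP
  have hPc : ContinuousAt P 0 := by
    have hs : ∀ X Y : E → E, ContinuousAt X 0 → ContinuousAt Y 0 →
        ContinuousAt (fun y ↦ (G y (X y)).smulRight (Y y)) 0 := by
      intro X Y hX hY
      exact ((ContinuousLinearMap.smulRightL ℝ E E).continuous.continuousAt.comp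
        (hG.clm_apply hX)).clm_apply hY
    refine ((hs U V hU hV).add (hs V U hV hU)).add ?_
    exact tendsto_finsetSum _ fun i _ ↦ hs (F i) (F i) (hF i) (hF i)
  have hP0 : P 0 = 1 := by
    ext a
    have := h0.span a
    simp only [hP, add_apply, ContinuousLinearMap.smulRight_apply, sum_apply, one_apply_eq_self]
    exact this.symm
  have hunit : ∀ᶠ y in 𝓝 0, IsUnit (P y) := by
    refine hPc.eventually (Units.isOpen.mem_nhds ?_)
    rw [hP0]
    exact isUnit_one
  filter_upwards [hunit, hvv, huv, hvu, huu, eventually_all.2 hvf, eventually_all.2 hfv,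
    eventually_all.2 huf, eventually_all.2 hfu, eventually_all.2 fun i ↦ eventually_all.2 (hff i)]
    with y hu h1 h2 h3 h4 h5 h6 h7 h8 h9
  refine ⟨h1, h2, h3, h4, h5, h6, h7, h8, h9, fun a ↦ ?_⟩
  have hidem : P y (P y a) = P y a := by
    simp [hP, h1, h2, h3, h4, h5, h6, h7, h8, h9]
  obtain ⟨w, hw⟩ := hu
  have hinj : ∀ b, P y b = 0 → b = 0 := by
    intro b hb
    have : (↑w⁻¹ * ↑w : E →L[ℝ] E) b = b := by rw [Units.inv_mul]; rfl
    rw [← this, mul_apply_eq_comp, hw, hb, map_zero]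
  have := hinj (P y a - a) (by rw [map_sub, hidem, sub_self])
  rw [sub_eq_zero] at this
  conv_lhs => rw [← this]
  simp [hP]

variable {G : E → E →L[ℝ] E →L[ℝ] ℝ} {Γ : E → E →L[ℝ] E →L[ℝ] E} {τ : E →L[ℝ] ℝ} {e : E}
  {V : E → E}

namespace IsLocalPPWave

theorem isAxiallyParallel (h : IsLocalPPWave G Γ τ V) : IsAxiallyParallel Γ τ e V where
  smooth := h.smooth
  radial := h.parallel.mono fun y hy ↦ by rw [hy, zero_apply]
  axis := ((tendsto_axis τ e).eventually h.parallel).mono fun y hy ↦ by rw [hy, zero_apply]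

/-- A null frame at `0` extends to axially parallel fields, which form a null frame. -/
theorem exists_frame [CompleteSpace E] (h : IsLocalPPWave G Γ τ V) (he : τ e = 1) {U₀ : E}
    {F₀ : ι → E} (h0 : IsNullFrame (G 0) (V 0) U₀ F₀) :
    ∃ (U : E → E) (F : ι → E → E), IsAxiallyParallel Γ τ e U ∧
      (∀ i, IsAxiallyParallel Γ τ e (F i)) ∧
      ∀ᶠ y in 𝓝 0, IsNullFrame (G y) (V y) (U y) (fun i ↦ F i y) := by
  have hΓ := h.leviCivita.mono fun y h ↦ h.contDiffAt_christoffel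
  obtain ⟨U, hU, rfl⟩ := exists_isAxiallyParallel he hΓ U₀
  choose F hF hF0 using fun i ↦ exists_isAxiallyParallel he hΓ (F₀ i)
  obtain rfl : (fun i ↦ F i 0) = F₀ := funext hF0
  have hV : IsAxiallyParallel Γ τ e V := h.isAxiallyParallel
  have hm : ∀ {X Y : E → E} {c : ℝ}, IsAxiallyParallel Γ τ e X → IsAxiallyParallel Γ τ e Y →
      G 0 (X 0) (Y 0) = c → ∀ᶠ y in 𝓝 0, G y (X y) (Y y) = c := by
    rintro X Y c hX hY rfl
    exact hX.eventually_metric_eq he h.leviCivita hY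
  exact ⟨U, F, hU, hF, eventually_isNullFrame
    h.leviCivita.self_of_nhds.contDiffAt_metric.continuousAt
    hV.smooth.self_of_nhds.continuousAt hU.smooth.self_of_nhds.continuousAt
    (fun i ↦ (hF i).smooth.self_of_nhds.continuousAt) h0
    (hm hV hV h0.vv) (hm hU hV h0.uv) (hm hV hU h0.vu) (hm hU hU h0.uu)
    (fun i ↦ hm hV (hF i) (h0.vf i)) (fun i ↦ hm (hF i) hV (h0.fv i))
    (fun i ↦ hm hU (hF i) (h0.uf i)) (fun i ↦ hm (hF i) hU (h0.fu i))
    (fun i j ↦ hm (hF i) (hF j) (h0.ff i j))⟩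

variable {U : E → E} {F : ι → E → E}

/-- An axially parallel field tangent to the leaves is parallel along the leaves, since these are
flat. -/
theorem eventually_leafwise_parallel (h : IsLocalPPWave G Γ τ V) (he : τ e = 1) {X : E → E}
    (hX : IsAxiallyParallel Γ τ e X) (hXτ : ∀ᶠ y in 𝓝 0, τ (X y) = 0) :
    ∀ᶠ y in 𝓝 0, ∀ b, τ b = 0 → covDeriv Γ X y b = 0 := by
  have := eventually_parallel_of_radial (leafProj_idem he)
    (h.leviCivita.mono fun y h ↦ h.contDiffAt_christoffel) hX.smooth hX.radial (by
      filter_upwards [h.flat, hXτ] with y hy hy' a b ha hb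
      have hτ : ∀ a, leafProj τ e a = a → τ a = 0 := fun a ha ↦ by rw [← ha]; simp [he]
      exact hy a b (X y) (hτ a ha) (hτ b hb) hy')
  filter_upwards [this] with y hy b hb
  exact hy b (leafProj_eq_self b hb)

/-- Derivatives of a scalar product that is constant near a point. -/
theorem covDeriv_metric_eq {X Y : E → E} {y : E} {c : ℝ} (hl : IsLeviCivitaAt G Γ y)
    (hX : ContDiffAt ℝ ∞ X y) (hY : ContDiffAt ℝ ∞ Y y)
    (hc : ∀ᶠ z in 𝓝 y, G z (X z) (Y z) = c) (a : E) :
    G y (covDeriv Γ X y a) (Y y) = - G y (X y) (covDeriv Γ Y y a) := by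
  have h1 := fderiv_metric_apply hl hX hY a
  have h2 : (fun z ↦ G z (X z) (Y z)) =ᶠ[𝓝 y] fun _ ↦ c := hc
  rw [h2.fderiv_eq, fderiv_fun_const, Pi.zero_apply, zero_apply] at h1
  linarith

/-- The transverse rotation `G(∇_e Fᵢ, Fⱼ)` of the frame vanishes: by the pair symmetry of the
curvature it is constant along the flat leaves, and it vanishes on the axis. -/
theorem eventually_rotation_eq_zero (h : IsLocalPPWave G Γ τ V) (he : τ e = 1) {X Y : E → E}
    (hX : IsAxiallyParallel Γ τ e X) (hXτ : ∀ᶠ y in 𝓝 0, τ (X y) = 0)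
    (hY : IsAxiallyParallel Γ τ e Y) (hYτ : ∀ᶠ y in 𝓝 0, τ (Y y) = 0) :
    ∀ᶠ y in 𝓝 0, G y (covDeriv Γ X y e) (Y y) = 0 := by
  have hXp := h.eventually_leafwise_parallel he hX hXτ
  have hYp := h.eventually_leafwise_parallel he hY hYτ
  have hcov : ∀ᶠ y in 𝓝 0, ContDiffAt ℝ ∞ (fun z ↦ covDeriv Γ X z e) y := by
    filter_upwards [h.leviCivita, hX.smooth] with y h1 h2
    exact (contDiffAt_covDeriv h1.contDiffAt_christoffel h2).clm_apply contDiffAt_const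
  have := eventually_eq_of_fderiv_radial (leafProj_idem he)
    (f := fun y ↦ G y (covDeriv Γ X y e) (Y y))
    (by
      filter_upwards [h.leviCivita, hcov, hY.smooth] with y h1 h2 h3
      exact ((h1.contDiffAt_metric.clm_apply h2).clm_apply h3).of_le (by exact_mod_cast le_top))
    (by
      filter_upwards [h.leviCivita.eventually_nhds, hcov, hX.smooth, hY.smooth, hYp, hXτ, hYτ,
        hXp.eventually_nhds, h.flat] with y hl hc hXs hYs hYp hXτ hYτ hXp hflat
      have hw : τ (leafProj τ e y) = 0 := by simp [he]
      generalize leafProj τ e y = w at hw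
      have hl0 := hl.self_of_nhds
      rw [fderiv_metric_apply hl0 hc hYs, hYp w hw, map_zero, add_zero]
      have h1 := covDeriv_covDeriv_sub hl0.contDiffAt_christoffel hXs w e
      have h2 : covDeriv Γ (fun z ↦ covDeriv Γ X z w) y = 0 := by
        have : (fun z ↦ covDeriv Γ X z w) =ᶠ[𝓝 y] fun _ ↦ 0 := hXp.mono fun z hz ↦ hz w hw
        ext a
        rw [covDeriv_apply, this.fderiv_eq, hXp.self_of_nhds w hw]
        simp
      rw [h2, zero_apply, sub_zero] at h1
      rw [h1, metric_curvature_pair_symm hl, hflat _ _ _ hXτ hYτ hw, map_zero, zero_apply])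
  filter_upwards [this, hX.axis] with y h1 h2
  rw [h1, leafProj_apply, sub_sub_cancel, h2, map_zero, zero_apply]

/-- The form `G(Fᵢ, ·)` is closed. -/
theorem eventually_transverse_closed (h : IsLocalPPWave G Γ τ V) (he : τ e = 1)
    (hF : ∀ i, IsAxiallyParallel Γ τ e (F i))
    (hfr : ∀ᶠ y in 𝓝 0, IsNullFrame (G y) (V y) (U y) (fun i ↦ F i y)) (i : ι) :
    ∀ᶠ y in 𝓝 0, ∀ a b, fderiv ℝ (fun z ↦ G z (F i z)) y a b =
      fderiv ℝ (fun z ↦ G z (F i z)) y b a := by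
  have hτ : ∀ i, ∀ᶠ y in 𝓝 0, τ (F i y) = 0 := fun i ↦ by
    filter_upwards [h.orthogonal, hfr] with y h1 h2
    exact (h1 _).1 (h2.vf i)
  have hrot := eventually_all.2 fun j ↦
    h.eventually_rotation_eq_zero he (hF i) (hτ i) (hF j) (hτ j)
  filter_upwards [hfr, hfr.eventually_nhds, h.leviCivita, h.smooth, (hF i).smooth, h.parallel,
    h.orthogonal, hrot, h.eventually_leafwise_parallel he (hF i) (hτ i)]
    with y hfr hfr' hl hVs hFs hVp hVo hrot hleaf
  have hcov : ∀ a, covDeriv Γ (F i) y a = τ a • covDeriv Γ (F i) y e := by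
    intro a
    have := hleaf (a - τ a • e) (by simp [he])
    rwa [map_sub, map_smul, sub_eq_zero] at this
  have hV0 : G y (covDeriv Γ (F i) y e) (V y) = 0 := by
    rw [covDeriv_metric_eq hl hFs hVs (hfr'.mono fun z hz ↦ hz.fv i), hVp]
    simp
  have hperp : ∀ b, τ b = 0 → G y (covDeriv Γ (F i) y e) b = 0 := by
    intro b hb
    rw [hfr.span b, (hVo b).2 hb]
    simp [hV0, hrot]
  have hcomp : ∀ b, G y (covDeriv Γ (F i) y e) b = τ b * G y (covDeriv Γ (F i) y e) e := by
    intro b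
    have := hperp (b - τ b • e) (by simp [he])
    rwa [map_sub, map_smul, sub_eq_zero] at this
  intro a b
  rw [fderiv_flat hl hFs, fderiv_flat hl hFs, hl.torsionFree b a, hcov a, hcov b]
  simp only [map_smul, smul_apply, smul_eq_mul]
  rw [hcomp a, hcomp b]
  ring

/-- Along the leaves, the form `G(U, ·)` is closed. -/
theorem eventually_leafwise_closed (h : IsLocalPPWave G Γ τ V) (he : τ e = 1)
    (hU : IsAxiallyParallel Γ τ e U) (hF : ∀ i, IsAxiallyParallel Γ τ e (F i))
    (hfr : ∀ᶠ y in 𝓝 0, IsNullFrame (G y) (V y) (U y) (fun i ↦ F i y)) :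
    ∀ᶠ y in 𝓝 0, ∀ a b, τ a = 0 → τ b = 0 → fderiv ℝ (fun z ↦ G z (U z)) y a b =
      fderiv ℝ (fun z ↦ G z (U z)) y b a := by
  have hτ : ∀ i, ∀ᶠ y in 𝓝 0, τ (F i y) = 0 := fun i ↦ by
    filter_upwards [h.orthogonal, hfr] with y h1 h2
    exact (h1 _).1 (h2.vf i)
  have hpar := eventually_all.2 fun j ↦ h.eventually_leafwise_parallel he (hF j) (hτ j)
  filter_upwards [hfr, hfr.eventually_nhds, h.leviCivita, h.smooth, hU.smooth,
    eventually_all.2 fun i ↦ (hF i).smooth, h.parallel, h.orthogonal, hpar]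
    with y hfr hfr' hl hVs hUs hFs hVp hVo hpar a b ha hb
  have hzero : ∀ a b, τ a = 0 → τ b = 0 → G y (covDeriv Γ U y a) b = 0 := by
    intro a b ha hb
    have h1 : G y (covDeriv Γ U y a) (V y) = 0 := by
      rw [covDeriv_metric_eq hl hUs hVs (hfr'.mono fun z hz ↦ hz.uv), hVp]
      simp
    have h2 : ∀ j, G y (covDeriv Γ U y a) (F j y) = 0 := by
      intro j
      rw [covDeriv_metric_eq hl hUs (hFs j) (hfr'.mono fun z hz ↦ hz.uf j), hpar j a ha]
      simp
    rw [hfr.span b, (hVo b).2 hb]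
    simp [h1, h2]
  rw [fderiv_flat hl hUs, fderiv_flat hl hUs, hl.torsionFree b a, hzero a b ha hb,
    hzero b a hb ha]

/-- Brinkmann coordinates in which the metric has the form of a pp-wave. -/
theorem exists_coordinates [CompleteSpace E] (h : IsLocalPPWave G Γ τ V) (he : τ e = 1) {U₀ : E}
    {F₀ : ι → E} (h0 : IsNullFrame (G 0) (V 0) U₀ F₀) :
    ∃ (u v k : E → ℝ) (x : ι → E → ℝ), ∀ᶠ y in 𝓝 0,
      ContDiffAt ℝ ∞ u y ∧ ContDiffAt ℝ ∞ v y ∧ ContDiffAt ℝ ∞ k y ∧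
      (∀ i, ContDiffAt ℝ ∞ (x i) y) ∧
      fderiv ℝ u y (V y) = 0 ∧ fderiv ℝ v y (V y) = 1 ∧ fderiv ℝ k y (V y) = 0 ∧
      (∀ i, fderiv ℝ (x i) y (V y) = 0) ∧
      ∀ a b, G y a b = fderiv ℝ u y a * fderiv ℝ v y b + fderiv ℝ v y a * fderiv ℝ u y b +
        k y * (fderiv ℝ u y a * fderiv ℝ u y b) +
        ∑ i, fderiv ℝ (x i) y a * fderiv ℝ (x i) y b := by
  obtain ⟨U, F, hU, hF, hfr⟩ := h.exists_frame he h0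
  have hid : ∀ y : E, ContinuousLinearMap.id ℝ E (ContinuousLinearMap.id ℝ E y) =
    ContinuousLinearMap.id ℝ E y := fun _ ↦ rfl
  have hform : ∀ X : E → E, (∀ᶠ y in 𝓝 0, ContDiffAt ℝ ∞ X y) →
      ∀ᶠ y in 𝓝 0, ContDiffAt ℝ ∞ (fun z ↦ G z (X z)) y := by
    intro X hX
    filter_upwards [h.leviCivita, hX] with y h1 h2
    exact h1.contDiffAt_metric.clm_apply h2
  have hVclosed : ∀ᶠ y in 𝓝 0, ∀ a b, fderiv ℝ (fun z ↦ G z (V z)) y a b =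
      fderiv ℝ (fun z ↦ G z (V z)) y b a := by
    filter_upwards [h.leviCivita, h.smooth, h.parallel] with y h1 h2 h3 a b
    rw [fderiv_flat h1 h2, fderiv_flat h1 h2, h3, h1.torsionFree b a]
    simp
  obtain ⟨u, hu⟩ := exists_primitive hid (hform V h.smooth)
    (hVclosed.mono fun y hy a b _ _ ↦ hy a b)
  choose x hx using fun i ↦ exists_primitive hid (hform (F i) (hF i).smooth)
    ((h.eventually_transverse_closed he hF hfr i).mono fun y hy a b _ _ ↦ hy a b)
  have hleaf : ∀ a, leafProj τ e a = a → τ a = 0 := fun a ha ↦ by rw [← ha]; simp [he]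
  obtain ⟨v, hv⟩ := exists_primitive (leafProj_idem he) (hform U hU.smooth)
    ((h.eventually_leafwise_closed he hU hF hfr).mono fun y hy a b ha hb ↦
      hy a b (hleaf a ha) (hleaf b hb))
  -- `dv` agrees with `G(U, ·)` along the leaves, so it differs from it by a multiple `k₀ du`.
  set k₀ : E → ℝ := fun y ↦ fderiv ℝ v y (U y) with hk₀
  have hk₀s : ∀ᶠ y in 𝓝 0, ContDiffAt ℝ ∞ k₀ y := by
    filter_upwards [hv, hU.smooth] with y h1 h2
    exact (h1.1.fderiv_right (m := ∞) (by simp)).clm_apply h2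
  have hdv : ∀ᶠ y in 𝓝 0, fderiv ℝ v y = G y (U y) + k₀ y • G y (V y) := by
    filter_upwards [hv, hfr, h.orthogonal] with y h1 h2 h3
    ext a
    have h4 : τ (a - G y (V y) a • U y) = 0 := by
      rw [← h3, map_sub, map_smul, h2.vu]
      simp
    have h5 := h1.2 _ (leafProj_eq_self (e := e) _ h4)
    rw [map_sub, map_sub, map_smul, map_smul, h2.uu] at h5
    simp only [smul_eq_mul, add_apply, smul_apply, hk₀] at h5 ⊢
    linarith
  have hk₀V : ∀ᶠ y in 𝓝 0, fderiv ℝ k₀ y (V y) = 0 := by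
    filter_upwards [hdv.eventually_nhds, hv, hfr.eventually_nhds, h.leviCivita, h.smooth,
      hU.smooth, h.parallel, hVclosed, hk₀s, hform V h.smooth, hform U hU.smooth]
      with y hdv hv hfr hl hVs hUs hVp hVc hks hθV hθU
    have key : ∀ a b, fderiv ℝ (fderiv ℝ v) y a b = fderiv ℝ (fun z ↦ G z (U z)) y a b +
        (k₀ y * fderiv ℝ (fun z ↦ G z (V z)) y a b + fderiv ℝ k₀ y a * G y (V y) b) := by
      intro a b
      have hd : (fun z ↦ fderiv ℝ v z) =ᶠ[𝓝 y] fun z ↦ G z (U z) + k₀ z • G z (V z) := hdv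
      have hθU := contDiffAt_infty_differentiableAt hθU
      have hθV := contDiffAt_infty_differentiableAt hθV
      have hks := contDiffAt_infty_differentiableAt hks
      rw [hd.fderiv_eq, fderiv_fun_add hθU (hks.fun_smul hθV), fderiv_fun_smul hks hθV]
      rfl
    have hs := fderiv_fderiv_symm hv.1 (V y) (U y)
    have hfr0 := hfr.self_of_nhds
    rw [key, key, hVc (U y) (V y), fderiv_flat hl hUs, fderiv_flat hl hUs,
      hl.torsionFree (U y) (V y), hfr0.vu, hfr0.vv,
      covDeriv_metric_eq hl hUs hVs (hfr.mono fun z hz ↦ hz.uv), hVp] at hs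
    have h1 := covDeriv_metric_eq hl hUs hUs (hfr.mono fun z hz ↦ hz.uu) (V y)
    rw [hl.symm (U y)] at h1
    simp only [zero_apply, map_zero] at hs
    linarith
  refine ⟨u, v, fun y ↦ -2 * k₀ y, x, ?_⟩
  filter_upwards [hu, hv, eventually_all.2 hx, hk₀s, hdv, hk₀V, hfr, h.leviCivita]
    with y hu hv hx hks hdv hkV hfr hl
  have hdu : fderiv ℝ u y = G y (V y) := by ext a; exact hu.2 a rfl
  have hdx : ∀ i, fderiv ℝ (x i) y = G y (F i y) := fun i ↦ by ext a; exact (hx i).2 a rfl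
  refine ⟨hu.1, hv.1, contDiffAt_const.mul hks, fun i ↦ (hx i).1, ?_, ?_, ?_, fun i ↦ ?_,
    fun a b ↦ ?_⟩
  · rw [hdu, hfr.vv]
  · rw [hdv]; simp [hfr.uv, hfr.vv]
  · rw [fderiv_const_mul (contDiffAt_infty_differentiableAt hks), smul_apply, hkV, smul_zero]
  · rw [hdx, hfr.fv]
  · conv_lhs => rw [hfr.span a]
    simp only [hdu, hdv, hdx, map_add, map_smul, map_sum, add_apply, smul_apply, sum_apply,
      smul_eq_mul]
    ring

end IsLocalPPWave

end Coordinates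

/-! ### Null frames of a Lorentzian form -/

section LorentzForm

theorem exists_orthonormal_basis_of_posDef {W : Type} [AddCommGroup W] [Module ℝ W]
    [FiniteDimensional ℝ W] {n : ℕ} (hn : Module.finrank ℝ W = n) (B : W →ₗ[ℝ] W →ₗ[ℝ] ℝ)
    (hsymm : ∀ x y, B x y = B y x) (hpos : ∀ x, x ≠ 0 → 0 < B x x) :
    ∃ F : Fin n → W, (∀ i j, B (F i) (F j) = if i = j then 1 else 0) ∧
      ∀ a, a = ∑ i, B (F i) a • F i := by
  have hnonneg : ∀ x, 0 ≤ B x x := fun x ↦ by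
    by_cases h : x = 0
    · simp [h]
    · exact (hpos x h).le
  let c : InnerProductSpace.Core ℝ W :=
    { inner := fun x y ↦ B x y
      conj_inner_symm := fun x y ↦ hsymm y x
      re_inner_nonneg := fun x ↦ hnonneg x
      add_left := fun x y z ↦ by simp
      smul_left := fun x y r ↦ by simp
      definite := fun x hx ↦ by
        by_contra h
        exact (hpos x h).ne' hx }
  let _ : NormedAddCommGroup W := c.toNormedAddCommGroup
  let _ : InnerProductSpace ℝ W := InnerProductSpace.ofCore c.toCore
  let b := (stdOrthonormalBasis ℝ W).reindex (finCongr hn)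
  refine ⟨b, fun i j ↦ ?_, fun a ↦ ?_⟩
  · exact orthonormal_iff_ite.1 b.orthonormal i j
  · exact (b.sum_repr' a).symm

variable {E : Type} [NormedAddCommGroup E] [NormedSpace ℝ E]

/-- A Lorentzian form is positive definite on the orthogonal complement of a timelike vector. -/
theorem lorentz_pos_of_orthogonal {B : E →L[ℝ] E →L[ℝ] ℝ} {k : ℕ}
    (b : Module.Basis (Fin (k + 1)) ℝ E)
    (hb : ∀ i j, B (b i) (b j) = if i = j then (if i = 0 then -1 else 1) else 0) {t w : E}
    (ht : B t t < 0) (htw : B t w = 0) (hw : w ≠ 0) : 0 < B w w := by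
  have hB : ∀ x y, B x y = -(b.repr x 0 * b.repr y 0) +
      ∑ i : Fin k, b.repr x i.succ * b.repr y i.succ := by
    intro x y
    conv_lhs => rw [← b.sum_repr x, ← b.sum_repr y]
    simp only [map_sum, map_smul, sum_apply, smul_apply, hb, smul_eq_mul, mul_ite, mul_one,
      mul_zero, Finset.sum_ite_eq', Finset.mem_univ, if_true]
    rw [Fin.sum_univ_succ]
    simp [Fin.succ_ne_zero, mul_comm]
  rw [hB] at ht htw ⊢
  have hcs := Finset.sum_mul_sq_le_sq_mul_sq Finset.univ (fun i : Fin k ↦ b.repr t i.succ)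
    (fun i ↦ b.repr w i.succ)
  have hS : ∑ i : Fin k, b.repr w i.succ * b.repr w i.succ = ∑ i : Fin k, b.repr w i.succ ^ 2 :=
    Finset.sum_congr rfl fun i _ ↦ (sq _).symm
  have hT : ∑ i : Fin k, b.repr t i.succ * b.repr t i.succ = ∑ i : Fin k, b.repr t i.succ ^ 2 :=
    Finset.sum_congr rfl fun i _ ↦ (sq _).symm
  have hw' : b.repr w 0 ≠ 0 ∨ ∑ i : Fin k, b.repr w i.succ ^ 2 ≠ 0 := by
    by_contra! hcon
    refine hw (b.repr.map_eq_zero_iff.1 (Finsupp.ext fun i ↦ ?_))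
    refine Fin.cases hcon.1 (fun i ↦ ?_) i
    have := (Finset.sum_eq_zero_iff_of_nonneg (fun i _ ↦ sq_nonneg _)).1 hcon.2 i (Finset.mem_univ _)
    simpa using this
  rw [hS]
  rw [hT] at ht
  have hS0 : 0 ≤ ∑ i : Fin k, b.repr w i.succ ^ 2 := Finset.sum_nonneg fun i _ ↦ sq_nonneg _
  have hT0 : 0 ≤ ∑ i : Fin k, b.repr t i.succ ^ 2 := Finset.sum_nonneg fun i _ ↦ sq_nonneg _
  have htw' : ∑ i : Fin k, b.repr t i.succ * b.repr w i.succ = b.repr t 0 * b.repr w 0 := by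
    linarith
  rw [htw'] at hcs
  generalize (∑ i : Fin k, b.repr w i.succ ^ 2) = S at *
  generalize (∑ i : Fin k, b.repr t i.succ ^ 2) = T at *
  generalize b.repr w 0 = w₀ at *
  generalize b.repr t 0 = t₀ at *
  by_contra hcon
  have h1 : S ≤ w₀ * w₀ := by linarith
  have h2 : 0 < w₀ * w₀ := by
    rcases hw' with h | h
    · exact mul_self_pos.2 h
    · exact (lt_of_le_of_ne hS0 h.symm).trans_le h1
  nlinarith [mul_le_mul_of_nonneg_left h1 hT0]

/-- A nonzero null vector of a Lorentzian form belongs to a null frame. -/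
theorem exists_isNullFrame [FiniteDimensional ℝ E] {n : ℕ} (hn : Module.finrank ℝ E = n + 2)
    {B : E →L[ℝ] E →L[ℝ] ℝ} (hsymm : ∀ x y, B x y = B y x)
    (hnd : ∀ x, (∀ y, B x y = 0) → x = 0) {k : ℕ} (b : Module.Basis (Fin (k + 1)) ℝ E)
    (hb : ∀ i j, B (b i) (b j) = if i = j then (if i = 0 then -1 else 1) else 0) {V : E}
    (hV : V ≠ 0) (hVV : B V V = 0) :
    ∃ (U : E) (F : Fin n → E), IsNullFrame B V U F := by
  obtain ⟨w, hw⟩ : ∃ w, B V w ≠ 0 := by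
    by_contra! h
    exact hV (hnd V h)
  obtain ⟨U₁, hU₁⟩ : ∃ U₁, B V U₁ = 1 := ⟨(B V w)⁻¹ • w, by simp [hw]⟩
  set U : E := U₁ - (B U₁ U₁ / 2) • V with hUdef
  have hVU : B V U = 1 := by simp [hUdef, hU₁, hVV]
  have hUV : B U V = 1 := by rw [hsymm, hVU]
  have hUU : B U U = 0 := by
    have h1 : B U₁ V = 1 := by rw [hsymm, hU₁]
    simp only [hUdef, map_sub, map_smul, sub_apply, smul_apply, smul_eq_mul, hU₁, hVV, h1]
    ring
  let f : E →ₗ[ℝ] ℝ × ℝ := ((B U : E →L[ℝ] ℝ) : E →ₗ[ℝ] ℝ).prod ((B V : E →L[ℝ] ℝ) : E →ₗ[ℝ] ℝ)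
  have hf : ∀ a, f a = (B U a, B V a) := fun a ↦ rfl
  have hsurj : Function.Surjective f := by
    rintro ⟨p, q⟩
    refine ⟨p • V + q • U, ?_⟩
    simp [hf, hUV, hVU, hUU, hVV]
  have hrank : Module.finrank ℝ (LinearMap.ker f) = n := by
    have h1 := f.finrank_range_add_finrank_ker
    rw [LinearMap.range_eq_top.2 hsurj, finrank_top, hn] at h1
    simp at h1
    omega
  have hker : ∀ w : LinearMap.ker f, B U w = 0 ∧ B V w = 0 := fun w ↦ by
    have := w.2
    rw [LinearMap.mem_ker, hf] at this
    exact ⟨congrArg Prod.fst this, congrArg Prod.snd this⟩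
  have htt : B (V - U) (V - U) < 0 := by
    simp only [map_sub, sub_apply, hUV, hVU, hUU, hVV]
    norm_num
  obtain ⟨F, hF, hspan⟩ := exists_orthonormal_basis_of_posDef hrank
    (LinearMap.mk₂ ℝ (fun x y : LinearMap.ker f ↦ B x y) (by intros; simp) (by intros; simp)
      (by intros; simp) (by intros; simp)) (fun x y ↦ hsymm x y) (fun x hx ↦ by
        refine lorentz_pos_of_orthogonal b hb htt ?_ (by simpa using hx)
        rw [map_sub, sub_apply, (hker x).1, (hker x).2, sub_zero])
  refine ⟨U, fun i ↦ F i, hVV, hUV, hVU, hUU, fun i ↦ (hker (F i)).2,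
    fun i ↦ (hsymm _ _).trans (hker (F i)).2, fun i ↦ (hker (F i)).1,
    fun i ↦ (hsymm _ _).trans (hker (F i)).1, hF, fun a ↦ ?_⟩
  have ha : a - B U a • V - B V a • U ∈ LinearMap.ker f := by
    simp [hf, hUV, hVU, hUU, hVV]
  have h1 := congrArg Subtype.val (hspan ⟨_, ha⟩)
  have h2 : ∀ i, B (F i : E) V = 0 ∧ B (F i : E) U = 0 := fun i ↦
    ⟨(hsymm _ _).trans (hker (F i)).2, (hsymm _ _).trans (hker (F i)).1⟩
  simp only [LinearMap.mk₂_apply, map_sub, map_smul, h2, smul_zero, sub_zero,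
    Submodule.coe_sum, Submodule.coe_smul] at h1
  rw [← h1]
  abel

end LorentzForm

/-! ### The Levi-Civita connection in a chart -/

section Chart

open Set Filter Topology

variable {E : Type} [NormedAddCommGroup E] [NormedSpace ℝ E] [FiniteDimensional ℝ E]
  {M : Type*} [TopologicalSpace M] [ChartedSpace E M] [IsManifold 𝓘(ℝ, E) ∞ M]
  {e : OpenPartialHomeomorph M E}

/-- The differential at `y` of the inverse of the chart `e`. -/
def chartSymmD (e : OpenPartialHomeomorph M E) (y : E) :
    E →L[ℝ] TangentSpace 𝓘(ℝ, E) (e.symm y) :=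
  mfderiv 𝓘(ℝ, E) 𝓘(ℝ, E) e.symm y

/-- The vector field `X` in the coordinates of the chart `e`. -/
def chartField (e : OpenPartialHomeomorph M E) (X : Π q : M, TangentSpace 𝓘(ℝ, E) q) (y : E) : E :=
  mpullback 𝓘(ℝ, E) 𝓘(ℝ, E) e.symm X y

/-- The vector field with coordinates `w` in the chart `e`. -/
def chartLift (e : OpenPartialHomeomorph M E) (w : E → E) (q : M) : TangentSpace 𝓘(ℝ, E) q :=
  mpullback 𝓘(ℝ, E) 𝓘(ℝ, E) e w q

/-- The vector field with constant coordinates `a` in the chart `e`. -/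
def chartConst (e : OpenPartialHomeomorph M E) (a : E) : Π q : M, TangentSpace 𝓘(ℝ, E) q :=
  chartLift e fun _ ↦ a

/-- The metric in the coordinates of the chart `e`. -/
def chartMetric (g : SemiRiemannianMetric 𝓘(ℝ, E) M) (e : OpenPartialHomeomorph M E) (y : E) :
    E →L[ℝ] E →L[ℝ] ℝ :=
  ContinuousLinearMap.bilinearComp (E := E) (F := E) (E' := E) (F' := E) (G := ℝ)
    (g.inner (e.symm y)) (chartSymmD e y) (chartSymmD e y)

theorem chartMetric_apply (g : SemiRiemannianMetric 𝓘(ℝ, E) M) (y a b : E) :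
    chartMetric g e y a b = g.inner (e.symm y) (chartSymmD e y a) (chartSymmD e y b) := rfl

theorem chart_mdifferentiable (he : e ∈ IsManifold.maximalAtlas 𝓘(ℝ, E) ∞ M) :
    e.MDifferentiable 𝓘(ℝ, E) 𝓘(ℝ, E) :=
  ⟨(contMDiffOn_of_mem_maximalAtlas he).mdifferentiableOn (by simp),
    (contMDiffOn_symm_of_mem_maximalAtlas he).mdifferentiableOn (by simp)⟩

theorem mfderiv_chartSymmD (he : e ∈ IsManifold.maximalAtlas 𝓘(ℝ, E) ∞ M) {y : E}
    (hy : y ∈ e.target) (a : E) :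
    mfderiv 𝓘(ℝ, E) 𝓘(ℝ, E) e (e.symm y) (chartSymmD e y a) = a :=
  congrArg (fun L : E →L[ℝ] E ↦ L a) ((chart_mdifferentiable he).comp_symm_deriv hy)

/-- `chartSymmD` as an equivalence, at the points of the target of the chart. -/
def chartSymmEquiv (he : e ∈ IsManifold.maximalAtlas 𝓘(ℝ, E) ∞ M) {y : E} (hy : y ∈ e.target) :
    E ≃L[ℝ] TangentSpace 𝓘(ℝ, E) (e.symm y) :=
  (chart_mdifferentiable he).symm.mfderiv hy

theorem chartSymmEquiv_apply (he : e ∈ IsManifold.maximalAtlas 𝓘(ℝ, E) ∞ M) {y : E}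
    (hy : y ∈ e.target) (a : E) : chartSymmEquiv he hy a = chartSymmD e y a := rfl

theorem isInvertible_mfderiv_chart_symm (he : e ∈ IsManifold.maximalAtlas 𝓘(ℝ, E) ∞ M) {y : E}
    (hy : y ∈ e.target) :
    (mfderiv 𝓘(ℝ, E) 𝓘(ℝ, E) e.symm y).IsInvertible :=
  ⟨chartSymmEquiv he hy, rfl⟩

theorem isInvertible_mfderiv_chart (he : e ∈ IsManifold.maximalAtlas 𝓘(ℝ, E) ∞ M) {q : M}
    (hq : q ∈ e.source) :
    (mfderiv 𝓘(ℝ, E) 𝓘(ℝ, E) e q).IsInvertible :=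
  ⟨(chart_mdifferentiable he).mfderiv hq, rfl⟩

theorem chartSymmD_chartField (he : e ∈ IsManifold.maximalAtlas 𝓘(ℝ, E) ∞ M) {y : E}
    (hy : y ∈ e.target) (X : Π q : M, TangentSpace 𝓘(ℝ, E) q) :
    chartSymmD e y (chartField e X y) = X (e.symm y) :=
  (isInvertible_mfderiv_chart_symm he hy).self_apply_inverse (X (e.symm y))

theorem chartSymmD_injective (he : e ∈ IsManifold.maximalAtlas 𝓘(ℝ, E) ∞ M) {y : E}
    (hy : y ∈ e.target) : Function.Injective (chartSymmD e y) :=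
  (chartSymmEquiv he hy).injective

theorem chartLift_symm (he : e ∈ IsManifold.maximalAtlas 𝓘(ℝ, E) ∞ M) {y : E}
    (hy : y ∈ e.target) (w : E → E) : chartLift e w (e.symm y) = chartSymmD e y (w y) := by
  have h1 := isInvertible_mfderiv_chart he (e.map_target hy)
  have h2 : mfderiv 𝓘(ℝ, E) 𝓘(ℝ, E) e (e.symm y) (chartLift e w (e.symm y)) = w y :=
    (h1.self_apply_inverse _).trans (congrArg w (e.right_inv hy))
  exact ((chart_mdifferentiable he).mfderiv (e.map_target hy)).injective
    (h2.trans (mfderiv_chartSymmD he hy (w y)).symm)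

theorem chartConst_symm (he : e ∈ IsManifold.maximalAtlas 𝓘(ℝ, E) ∞ M) {y : E}
    (hy : y ∈ e.target) (a : E) : chartConst e a (e.symm y) = chartSymmD e y a :=
  chartLift_symm he hy _

theorem chartField_chartConst (he : e ∈ IsManifold.maximalAtlas 𝓘(ℝ, E) ∞ M) {y : E}
    (hy : y ∈ e.target) (a : E) : chartField e (chartConst e a) y = a := by
  refine chartSymmD_injective he hy ?_
  rw [chartSymmD_chartField he hy, chartConst_symm he hy]

theorem contMDiffAt_chartLift (he : e ∈ IsManifold.maximalAtlas 𝓘(ℝ, E) ∞ M) {q : M}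
    (hq : q ∈ e.source) {w : E → E} (hw : ContDiffAt ℝ ∞ w (e q)) :
    CMDiffAt ∞ (T% (chartLift e w)) q := by
  refine ContMDiffAt.mpullback_vectorField_preimage (n := ∞) ?_
    (contMDiffAt_of_mem_maximalAtlas he hq) (isInvertible_mfderiv_chart he hq) (by simp)
  exact contMDiffAt_vectorSpace_iff_contDiffAt.2 hw

theorem contMDiffAt_chartConst (he : e ∈ IsManifold.maximalAtlas 𝓘(ℝ, E) ∞ M) {q : M}
    (hq : q ∈ e.source) (a : E) : CMDiffAt ∞ (T% (chartConst e a)) q :=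
  contMDiffAt_chartLift he hq contDiffAt_const

theorem contDiffAt_chartField (he : e ∈ IsManifold.maximalAtlas 𝓘(ℝ, E) ∞ M) {y : E}
    (hy : y ∈ e.target) {X : Π q : M, TangentSpace 𝓘(ℝ, E) q}
    (hX : CMDiffAt ∞ (T% X) (e.symm y)) : ContDiffAt ℝ ∞ (chartField e X) y := by
  refine contMDiffAt_vectorSpace_iff_contDiffAt.1 ?_
  exact ContMDiffAt.mpullback_vectorField_preimage (n := ∞) hX
    (contMDiffAt_symm_of_mem_maximalAtlas he hy) (isInvertible_mfderiv_chart_symm he hy) (by simp)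

theorem mvfderiv_chartSymmD (he : e ∈ IsManifold.maximalAtlas 𝓘(ℝ, E) ∞ M) {y : E}
    (hy : y ∈ e.target) {f : M → ℝ} (hf : MDiffAt f (e.symm y)) (a : E) :
    d% f (e.symm y) (chartSymmD e y a) = fderiv ℝ (f ∘ e.symm) y a := by
  have h := mfderiv_comp y hf ((chart_mdifferentiable he).mdifferentiableAt_symm hy)
  rw [mfderiv_eq_fderiv] at h
  rw [h]
  rfl

theorem mlieBracket_vectorSpace_apply (X Y : Π y : E, TangentSpace 𝓘(ℝ, E) y) (y : E) :
    mlieBracket 𝓘(ℝ, E) X Y y =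
      fderiv ℝ (F := E) Y y (X y) - fderiv ℝ (F := E) X y (Y y) := by
  rw [← mlieBracketWithin_univ, mlieBracketWithin_eq_lieBracketWithin]
  exact congrFun (lieBracketWithin_univ (𝕜 := ℝ) (V := (X : E → E)) (W := (Y : E → E))) y

theorem mlieBracket_symm (he : e ∈ IsManifold.maximalAtlas 𝓘(ℝ, E) ∞ M) {y : E}
    (hy : y ∈ e.target) {X Y : Π q : M, TangentSpace 𝓘(ℝ, E) q}
    (hX : MDiffAt (T% X) (e.symm y)) (hY : MDiffAt (T% Y) (e.symm y)) :
    mlieBracket 𝓘(ℝ, E) X Y (e.symm y) = chartSymmD e y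
      (fderiv ℝ (chartField e Y) y (chartField e X y)
        - fderiv ℝ (chartField e X) y (chartField e Y y)) := by
  have : IsManifold 𝓘(ℝ, E) (minSmoothness ℝ 2) M := by
    rw [minSmoothness_of_isRCLikeNormedField]
    exact IsManifold.of_le (n := ∞) ENat.LEInfty.out
  have h := mpullback_mlieBracket hX hY (contMDiffAt_symm_of_mem_maximalAtlas he hy)
    (by rw [minSmoothness_of_isRCLikeNormedField]; exact ENat.LEInfty.out)
  have h2 := chartSymmD_chartField he hy (mlieBracket 𝓘(ℝ, E) X Y)
  rw [← h2]
  exact congrArg (chartSymmD e y) (h.trans (mlieBracket_vectorSpace_apply _ _ y))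

theorem contDiffAt_chartMetric (g : SemiRiemannianMetric 𝓘(ℝ, E) M)
    (he : e ∈ IsManifold.maximalAtlas 𝓘(ℝ, E) ∞ M) {y : E} (hy : y ∈ e.target) :
    ContDiffAt ℝ ∞ (chartMetric g e) y := by
  suffices h : ContDiffOn ℝ ∞ (chartMetric g e) e.target from
    h.contDiffAt (e.open_target.mem_nhds hy)
  refine contDiffOn_clm_apply.2 fun a ↦ contDiffOn_clm_apply.2 fun b ↦ ?_
  have h1 : ContMDiffOn 𝓘(ℝ, E) 𝓘(ℝ, ℝ) ∞ (g.pair (chartConst e a) (chartConst e b)) e.source := by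
    intro q hq
    have := ContMDiffAt.clm_bundle_apply₂ (F₁ := E) (F₂ := E) (F₃ := ℝ)
      (E₃ := Bundle.Trivial M ℝ) (b := fun x : M ↦ x) (g.contMDiff.contMDiffAt (x := q))
      (contMDiffAt_chartConst he hq a) (contMDiffAt_chartConst he hq b)
    rw [contMDiffAt_totalSpace] at this
    exact this.2.contMDiffWithinAt
  have h2 := h1.comp (contMDiffOn_symm_of_mem_maximalAtlas he) (fun y hy ↦ e.map_target hy)
  refine (contMDiffOn_iff_contDiffOn.1 h2).congr fun y hy ↦ ?_
  simp only [Function.comp_apply, SemiRiemannianMetric.pair, chartConst_symm he hy]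
  rfl

/-- A nondegenerate bilinear form on a finite-dimensional space is an isomorphism onto the dual. -/
theorem isInvertible_of_nondegenerate {B : E →L[ℝ] E →L[ℝ] ℝ}
    (hB : ∀ a, (∀ b, B a b = 0) → a = 0) : B.IsInvertible := by
  have hker : LinearMap.ker B.toLinearMap = ⊥ := by
    refine LinearMap.ker_eq_bot'.2 fun a ha ↦ hB a fun b ↦ ?_
    exact congrArg (fun φ : E →L[ℝ] ℝ ↦ φ b) ha
  have hdim : Module.finrank ℝ E = Module.finrank ℝ (E →L[ℝ] ℝ) := by
    rw [← LinearEquiv.finrank_eq (LinearMap.toContinuousLinearMap (E := E) (F' := ℝ) (𝕜 := ℝ))]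
    exact (Subspace.dual_finrank_eq).symm
  let eq := LinearMap.linearEquivOfInjective B.toLinearMap (LinearMap.ker_eq_bot.1 hker) hdim
  exact ⟨eq.toContinuousLinearEquiv, by ext; rfl⟩

/-- The Christoffel symbols of a metric on a vector space,
`G(Γ(a, b), c) = (D G(a)(b, c) + D G(b)(a, c) - D G(c)(a, b)) / 2`. -/
def christoffel (G : E → E →L[ℝ] E →L[ℝ] ℝ) (y : E) : E →L[ℝ] E →L[ℝ] E :=
  (ContinuousLinearMap.compL ℝ E (E →L[ℝ] ℝ) E (G y).inverse).comp
    ((1 / 2 : ℝ) • (fderiv ℝ G y + (fderiv ℝ G y).flip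
      - ((ContinuousLinearMap.flipₗᵢ ℝ E E ℝ).toContinuousLinearEquiv :
          (E →L[ℝ] E →L[ℝ] ℝ) →L[ℝ] (E →L[ℝ] E →L[ℝ] ℝ)).comp (fderiv ℝ G y).flip))

theorem metric_christoffel {G : E → E →L[ℝ] E →L[ℝ] ℝ} {y : E}
    (hnd : ∀ a, (∀ b, G y a b = 0) → a = 0) (a b c : E) :
    G y (christoffel G y a b) c =
      (fderiv ℝ G y a b c + fderiv ℝ G y b a c - fderiv ℝ G y c a b) / 2 := by
  have h := (isInvertible_of_nondegenerate hnd).self_apply_inverse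
    ((1 / 2 : ℝ) • (fderiv ℝ G y a b + fderiv ℝ G y b a - ((fderiv ℝ G y).flip a).flip b))
  have h2 := congrArg (fun φ : E →L[ℝ] ℝ ↦ φ c) h
  refine h2.trans ?_
  simp
  ring

theorem contDiffAt_christoffel {G : E → E →L[ℝ] E →L[ℝ] ℝ} {y : E}
    (hG : ContDiffAt ℝ ∞ G y) (hnd : ∀ a, (∀ b, G y a b = 0) → a = 0) :
    ContDiffAt ℝ ∞ (christoffel G) y := by
  have hD : ContDiffAt ℝ ∞ (fderiv ℝ G) y := hG.fderiv_right (by simp)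
  have hinv : ContDiffAt ℝ ∞ (fun z ↦ (G z).inverse) y := by
    obtain ⟨Φ, hΦ⟩ := isInvertible_of_nondegenerate hnd
    have := contDiffAt_map_inverse (n := ∞) (𝕜 := ℝ) Φ
    rw [hΦ] at this
    exact this.comp y hG
  have hflip : ContDiffAt ℝ ∞ (fun z ↦ (fderiv ℝ G z).flip) y :=
    (ContinuousLinearMap.flipₗᵢ ℝ E E (E →L[ℝ] ℝ)).toContinuousLinearEquiv.contDiff.contDiffAt.comp
      y hD
  refine ContDiffAt.clm_comp
    ((ContinuousLinearMap.compL ℝ E (E →L[ℝ] ℝ) E).contDiff.contDiffAt.comp y hinv) ?_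
  exact ((hD.add hflip).sub (contDiffAt_const.clm_comp hflip)).const_smul (1 / 2 : ℝ)

theorem chartMetric_symm (g : SemiRiemannianMetric 𝓘(ℝ, E) M) (y a b : E) :
    chartMetric g e y a b = chartMetric g e y b a := by
  rw [chartMetric_apply, chartMetric_apply, g.symm]

theorem chartMetric_nondegenerate (g : SemiRiemannianMetric 𝓘(ℝ, E) M)
    (he : e ∈ IsManifold.maximalAtlas 𝓘(ℝ, E) ∞ M) {y : E} (hy : y ∈ e.target) (a : E)
    (ha : ∀ b, chartMetric g e y a b = 0) : a = 0 := by
  refine chartSymmD_injective he hy ?_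
  rw [map_zero]
  refine g.nondegenerate _ _ fun w ↦ ?_
  obtain ⟨b, rfl⟩ := (chartSymmEquiv he hy).surjective w
  exact ha b

/-- The Christoffel symbols of the metric in the chart `e`. -/
def chartChristoffel (g : SemiRiemannianMetric 𝓘(ℝ, E) M) (e : OpenPartialHomeomorph M E) :
    E → E →L[ℝ] E →L[ℝ] E :=
  christoffel (chartMetric g e)

theorem fderiv_chartMetric_symm (g : SemiRiemannianMetric 𝓘(ℝ, E) M)
    (he : e ∈ IsManifold.maximalAtlas 𝓘(ℝ, E) ∞ M) {y : E} (hy : y ∈ e.target) (a b c : E) :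
    fderiv ℝ (chartMetric g e) y a b c = fderiv ℝ (chartMetric g e) y a c b := by
  have hd : DifferentiableAt ℝ (chartMetric g e) y :=
    (contDiffAt_chartMetric g he hy).differentiableAt (by simp)
  have hb : ∀ b, DifferentiableAt ℝ (fun z ↦ chartMetric g e z b) y := fun b ↦
    hd.clm_apply (differentiableAt_const b)
  rw [← fderiv_clm_apply_const hd, ← fderiv_clm_apply_const hd, ← fderiv_clm_apply_const (hb b),
    ← fderiv_clm_apply_const (hb c)]
  exact congrArg (fun f ↦ fderiv ℝ f y a) (funext fun z ↦ chartMetric_symm g z b c)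

theorem isLeviCivitaAt_chart (g : SemiRiemannianMetric 𝓘(ℝ, E) M)
    (he : e ∈ IsManifold.maximalAtlas 𝓘(ℝ, E) ∞ M) {y : E} (hy : y ∈ e.target) :
    IsLeviCivitaAt (chartMetric g e) (chartChristoffel g e) y where
  contDiffAt_metric := contDiffAt_chartMetric g he hy
  contDiffAt_christoffel := contDiffAt_christoffel (contDiffAt_chartMetric g he hy)
    (chartMetric_nondegenerate g he hy)
  symm := chartMetric_symm g y
  torsionFree a b := by
    rw [← sub_eq_zero]
    refine chartMetric_nondegenerate g he hy _ fun c ↦ ?_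
    rw [map_sub, sub_apply, chartChristoffel,
      metric_christoffel (chartMetric_nondegenerate g he hy),
      metric_christoffel (chartMetric_nondegenerate g he hy), fderiv_chartMetric_symm g he hy c a b]
    ring
  compatible a b c := by
    rw [chartMetric_symm g y b, chartChristoffel,
      metric_christoffel (chartMetric_nondegenerate g he hy),
      metric_christoffel (chartMetric_nondegenerate g he hy), fderiv_chartMetric_symm g he hy a c b,
      fderiv_chartMetric_symm g he hy b a c, fderiv_chartMetric_symm g he hy c a b]
    ring

theorem mdifferentiableAt_of_contMDiffAt_infty {X : Π q : M, TangentSpace 𝓘(ℝ, E) q} {q : M}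
    (hX : CMDiffAt ∞ (T% X) q) : MDiffAt (T% X) q :=
  hX.mdifferentiableAt (by simp)

theorem pair_comp_chart_symm (g : SemiRiemannianMetric 𝓘(ℝ, E) M)
    (he : e ∈ IsManifold.maximalAtlas 𝓘(ℝ, E) ∞ M) {y : E} (hy : y ∈ e.target)
    (X Y : Π q : M, TangentSpace 𝓘(ℝ, E) q) :
    g.pair X Y (e.symm y) = chartMetric g e y (chartField e X y) (chartField e Y y) := by
  rw [chartMetric_apply, chartSymmD_chartField he hy, chartSymmD_chartField he hy]
  rfl

theorem mvfderiv_pair_chartSymmD (g : SemiRiemannianMetric 𝓘(ℝ, E) M)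
    (he : e ∈ IsManifold.maximalAtlas 𝓘(ℝ, E) ∞ M) {y : E} (hy : y ∈ e.target)
    {X Y : Π q : M, TangentSpace 𝓘(ℝ, E) q}
    (hX : CMDiffAt ∞ (T% X) (e.symm y)) (hY : CMDiffAt ∞ (T% Y) (e.symm y)) (a : E) :
    d% (g.pair X Y) (e.symm y) (chartSymmD e y a) =
      chartMetric g e y (covDeriv (chartChristoffel g e) (chartField e X) y a) (chartField e Y y)
      + chartMetric g e y (chartField e X y)
          (covDeriv (chartChristoffel g e) (chartField e Y) y a) := by
  rw [mvfderiv_chartSymmD he hy (SemiRiemannianMetric.mdifferentiableAt_pair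
    (mdifferentiableAt_of_contMDiffAt_infty hX) (mdifferentiableAt_of_contMDiffAt_infty hY)),
    ← fderiv_metric_apply (isLeviCivitaAt_chart g he hy) (contDiffAt_chartField he hy hX)
      (contDiffAt_chartField he hy hY)]
  refine congrArg (fun L : E →L[ℝ] ℝ ↦ L a) (Filter.EventuallyEq.fderiv_eq ?_)
  filter_upwards [e.open_target.mem_nhds hy] with z hz
  exact pair_comp_chart_symm g he hz X Y

/-- The Lie bracket in a chart, `[X, Y] = ∇_X Y - ∇_Y X`. -/
theorem mlieBracket_symm_covDeriv (g : SemiRiemannianMetric 𝓘(ℝ, E) M)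
    (he : e ∈ IsManifold.maximalAtlas 𝓘(ℝ, E) ∞ M) {y : E} (hy : y ∈ e.target)
    {X Y : Π q : M, TangentSpace 𝓘(ℝ, E) q}
    (hX : CMDiffAt ∞ (T% X) (e.symm y)) (hY : CMDiffAt ∞ (T% Y) (e.symm y)) :
    mlieBracket 𝓘(ℝ, E) X Y (e.symm y) = chartSymmD e y
      (covDeriv (chartChristoffel g e) (chartField e Y) y (chartField e X y)
        - covDeriv (chartChristoffel g e) (chartField e X) y (chartField e Y y)) := by
  rw [mlieBracket_symm he hy (mdifferentiableAt_of_contMDiffAt_infty hX)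
    (mdifferentiableAt_of_contMDiffAt_infty hY), covDeriv_apply, covDeriv_apply,
    (isLeviCivitaAt_chart g he hy).torsionFree (chartField e Y y)]
  congr 1
  abel

/-- In a chart, the Levi-Civita connection is given by the Christoffel symbols. -/
theorem leviCivita_chart (g : SemiRiemannianMetric 𝓘(ℝ, E) M)
    (he : e ∈ IsManifold.maximalAtlas 𝓘(ℝ, E) ∞ M) {y : E} (hy : y ∈ e.target)
    {Y : Π q : M, TangentSpace 𝓘(ℝ, E) q} (hY : CMDiffAt ∞ (T% Y) (e.symm y)) (a : E) :
    g.leviCivita Y (e.symm y) (chartSymmD e y a) =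
      chartSymmD e y (covDeriv (chartChristoffel g e) (chartField e Y) y a) := by
  rw [← sub_eq_zero]
  refine g.nondegenerate _ _ fun w ↦ ?_
  obtain ⟨c, rfl⟩ := (chartSymmEquiv he hy).surjective w
  rw [chartSymmEquiv_apply, map_sub, sub_apply, sub_eq_zero, ← chartConst_symm he hy a,
    ← chartConst_symm he hy c]
  have hA := contMDiffAt_chartConst he (e.map_target hy) a
  have hC := contMDiffAt_chartConst he (e.map_target hy) c
  refine (SemiRiemannianMetric.inner_leviCivitaFun (g := g)
    (mdifferentiableAt_of_contMDiffAt_infty hA) (mdifferentiableAt_of_contMDiffAt_infty hY)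
    (mdifferentiableAt_of_contMDiffAt_infty hC)).trans ?_
  rw [SemiRiemannianMetric.koszul, mlieBracket_symm_covDeriv g he hy hA hY,
    mlieBracket_symm_covDeriv g he hy hY hC, mlieBracket_symm_covDeriv g he hy hC hA]
  rw [← chartSymmD_chartField he hy Y, chartConst_symm he hy, chartConst_symm he hy,
    mvfderiv_pair_chartSymmD g he hy hY hC, mvfderiv_pair_chartSymmD g he hy hC hA,
    mvfderiv_pair_chartSymmD g he hy hA hY, ← chartMetric_apply, ← chartMetric_apply,
    ← chartMetric_apply, ← chartMetric_apply]
  simp only [chartField_chartConst he hy, map_sub, sub_apply]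
  rw [chartMetric_symm g y (chartField e Y y), chartMetric_symm g y a, chartMetric_symm g y c]
  ring

/-- The vector field `∇_Y Z` on `M`, for `Y` and `Z` smooth near a point, is smooth there, and its
coordinates are given by the Christoffel symbols. -/
theorem contMDiffAt_leviCivita (g : SemiRiemannianMetric 𝓘(ℝ, E) M)
    (he : e ∈ IsManifold.maximalAtlas 𝓘(ℝ, E) ∞ M) {y : E} (hy : y ∈ e.target)
    {Y Z : Π q : M, TangentSpace 𝓘(ℝ, E) q}
    (hY : ∀ᶠ z in 𝓝 y, CMDiffAt ∞ (T% Y) (e.symm z))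
    (hZ : ∀ᶠ z in 𝓝 y, CMDiffAt ∞ (T% Z) (e.symm z)) :
    CMDiffAt ∞ (T% (fun q ↦ g.leviCivita Z q (Y q))) (e.symm y) ∧
    chartField e (fun q ↦ g.leviCivita Z q (Y q)) =ᶠ[𝓝 y]
      fun z ↦ covDeriv (chartChristoffel g e) (chartField e Z) z (chartField e Y z) := by
  set w : E → E := fun z ↦ covDeriv (chartChristoffel g e) (chartField e Z) z (chartField e Y z)
  have key : ∀ᶠ z in 𝓝 y, g.leviCivita Z (e.symm z) (Y (e.symm z)) = chartSymmD e z (w z) := by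
    filter_upwards [hY, hZ, e.open_target.mem_nhds hy] with z h1 h2 hz
    rw [← leviCivita_chart g he hz h2, chartSymmD_chartField he hz]
  have hw : ContDiffAt ℝ ∞ w y :=
    (contDiffAt_covDeriv (isLeviCivitaAt_chart g he hy).contDiffAt_christoffel
      (contDiffAt_chartField he hy hZ.self_of_nhds)).clm_apply
      (contDiffAt_chartField he hy hY.self_of_nhds)
  constructor
  · have h1 : CMDiffAt ∞ (T% (chartLift e w)) (e.symm y) :=
      contMDiffAt_chartLift he (e.map_target hy) (by rwa [e.right_inv hy])
    refine h1.congr_of_eventuallyEq ?_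
    have h2 : Tendsto e (𝓝 (e.symm y)) (𝓝 y) := by
      have := e.continuousAt (e.map_target hy)
      rwa [ContinuousAt, e.right_inv hy] at this
    filter_upwards [h2.eventually key, e.open_source.mem_nhds (e.map_target hy)] with q hq hqs
    rw [← chartLift_symm he (e.map_source hqs) w, e.left_inv hqs] at hq
    exact congrArg (TotalSpace.mk' E q) hq
  · filter_upwards [key, e.open_target.mem_nhds hy] with z h1 hz
    exact chartSymmD_injective he hz ((chartSymmD_chartField he hz _).trans h1)

theorem covDeriv_apply_field {Γ : E → E →L[ℝ] E →L[ℝ] E} {Y Z : E → E} {y : E}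
    (hΓ : ContDiffAt ℝ ∞ Γ y) (hY : ContDiffAt ℝ ∞ Y y) (hZ : ContDiffAt ℝ ∞ Z y) (a : E) :
    covDeriv Γ (fun z ↦ covDeriv Γ Z z (Y z)) y a =
      covDeriv Γ (fun z ↦ covDeriv Γ Z z (Y y)) y a + covDeriv Γ Z y (fderiv ℝ Y y a) := by
  have h1 := contDiffAt_infty_differentiableAt (contDiffAt_covDeriv hΓ hZ)
  rw [covDeriv_apply (X := fun z ↦ covDeriv Γ Z z (Y z)),
    covDeriv_apply (X := fun z ↦ covDeriv Γ Z z (Y y)),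
    fderiv_clm_apply_apply h1 (contDiffAt_infty_differentiableAt hY), fderiv_clm_apply_const h1]
  abel

/-- In a chart, the curvature is given by the Christoffel symbols. -/
theorem curvature_chart (g : SemiRiemannianMetric 𝓘(ℝ, E) M)
    (he : e ∈ IsManifold.maximalAtlas 𝓘(ℝ, E) ∞ M) {y : E} (hy : y ∈ e.target)
    {X Y Z : Π q : M, TangentSpace 𝓘(ℝ, E) q}
    (hX : ∀ᶠ z in 𝓝 y, CMDiffAt ∞ (T% X) (e.symm z))
    (hY : ∀ᶠ z in 𝓝 y, CMDiffAt ∞ (T% Y) (e.symm z))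
    (hZ : ∀ᶠ z in 𝓝 y, CMDiffAt ∞ (T% Z) (e.symm z)) :
    curvature g.leviCivita X Y Z (e.symm y) = chartSymmD e y
      (christoffelCurvature (chartChristoffel g e) y
        (chartField e X y) (chartField e Y y) (chartField e Z y)) := by
  have hΓ := (isLeviCivitaAt_chart g he hy).contDiffAt_christoffel
  have hX' := contDiffAt_chartField he hy hX.self_of_nhds
  have hY' := contDiffAt_chartField he hy hY.self_of_nhds
  have hZ' := contDiffAt_chartField he hy hZ.self_of_nhds
  obtain ⟨hYZ, hYZ'⟩ := contMDiffAt_leviCivita g he hy hY hZ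
  obtain ⟨hXZ, hXZ'⟩ := contMDiffAt_leviCivita g he hy hX hZ
  have hcongr : ∀ {u v : E → E}, u =ᶠ[𝓝 y] v → ∀ a,
      covDeriv (chartChristoffel g e) u y a = covDeriv (chartChristoffel g e) v y a := by
    intro u v huv a
    rw [covDeriv_apply, covDeriv_apply, huv.fderiv_eq, huv.eq_of_nhds]
  rw [curvature, ← chartSymmD_chartField he hy X, ← chartSymmD_chartField he hy Y,
    leviCivita_chart g he hy hYZ, leviCivita_chart g he hy hXZ,
    mlieBracket_symm he hy (mdifferentiableAt_of_contMDiffAt_infty hX.self_of_nhds)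
      (mdifferentiableAt_of_contMDiffAt_infty hY.self_of_nhds),
    leviCivita_chart g he hy hZ.self_of_nhds, hcongr hYZ', hcongr hXZ',
    covDeriv_apply_field hΓ hY' hZ', covDeriv_apply_field hΓ hX' hZ',
    ← covDeriv_covDeriv_sub hΓ hZ', ← map_sub, ← map_sub]
  congr 1
  rw [map_sub]
  abel

end Chart

/-! ### From the normal form to the geometry -/

section NormalForm

open Set Filter Topology

variable {n : ℕ} {M : Type*} [TopologicalSpace M]
  [ChartedSpace (EuclideanSpace ℝ (Fin (n + 2))) M] [IsManifold (𝓡 (n + 2)) ∞ M]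
  {e : OpenPartialHomeomorph M (EuclideanSpace ℝ (Fin (n + 2)))}
  {g : SemiRiemannianMetric (𝓡 (n + 2)) M} {V : Π x : M, TangentSpace (𝓡 (n + 2)) x}
  {y : EuclideanSpace ℝ (Fin (n + 2))}

theorem coordDiff_chartSymmD (he : e ∈ IsManifold.maximalAtlas (𝓡 (n + 2)) ∞ M)
    (hy : y ∈ e.target) (i : Fin (n + 2)) (a : EuclideanSpace ℝ (Fin (n + 2))) :
    coordDiff e i (e.symm y) (chartSymmD e y a) = a i :=
  congrArg (fun z : EuclideanSpace ℝ (Fin (n + 2)) ↦ z i) (mfderiv_chartSymmD he hy a)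

theorem mem_orthogonal_chartSymmD (he : e ∈ IsManifold.maximalAtlas (𝓡 (n + 2)) ∞ M)
    (hy : y ∈ e.target) (a : EuclideanSpace ℝ (Fin (n + 2))) :
    chartSymmD e y a ∈ g.orthogonal V (e.symm y) ↔ chartMetric g e y (chartField e V y) a = 0 := by
  rw [chartMetric_apply, chartSymmD_chartField he hy]
  rfl

theorem contMDiffAt_of_isSmoothSectionOn {D : Π x : M, Submodule ℝ (TangentSpace (𝓡 (n + 2)) x)}
    {U : Set M} {X : Π x : M, TangentSpace (𝓡 (n + 2)) x} (hX : IsSmoothSectionOn D U X)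
    {q : M} (hq : q ∈ U) :
    ContMDiffAt (𝓡 (n + 2)) (𝓡 (n + 2)).tangent ∞
      (fun q ↦ (⟨q, X q⟩ : TangentBundle (𝓡 (n + 2)) M)) q :=
  (hX.2.1 q hq).contMDiffAt (hX.1.mem_nhds hq)

theorem IsPPWaveChart.chartField_eq (h : IsPPWaveChart g V e) (hy : y ∈ e.target) :
    chartField e V y = EuclideanSpace.single 1 1 := by
  ext i
  rw [← coordDiff_chartSymmD h.1 hy, chartSymmD_chartField h.1 hy, h.2.1 _ (e.map_target hy)]
  simp

/-- The metric in a chart as in the definition of `IsPPWaveChart`, where the coefficient of `du²`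
is written as a function `k` of all the coordinates that does not depend on `v`. -/
theorem IsPPWaveChart.exists_metric_eq (h : IsPPWaveChart g V e) :
    ∃ k : EuclideanSpace ℝ (Fin (n + 2)) → ℝ,
      (∀ z (t : ℝ), k (z + t • EuclideanSpace.single 1 1) = k z) ∧
      ∀ y ∈ e.target, ∀ a b, chartMetric g e y a b =
        a 0 * b 1 + a 1 * b 0 + k y * (a 0 * b 0) + ∑ i : Fin n, a i.succ.succ * b i.succ.succ := by
  obtain ⟨he, -, H, -, hH⟩ := h
  refine ⟨fun z ↦ H (z 0, transverse z), fun z t ↦ ?_, fun y hy a b ↦ ?_⟩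
  · have h0 : (z + t • EuclideanSpace.single (1 : Fin (n + 2)) (1 : ℝ)) 0 = z 0 := by simp
    have h1 : transverse (z + t • EuclideanSpace.single (1 : Fin (n + 2)) (1 : ℝ)) =
        transverse z := by
      ext i
      have : (i.succ.succ : Fin (n + 2)) ≠ 1 := by simp [Fin.ext_iff]
      simp [transverse, this]
    simp only [h0, h1]
  · rw [chartMetric_apply, hH _ (e.map_target hy)]
    simp only [coordDiff_chartSymmD he hy, e.right_inv hy]

/-- In a chart as in the definition of `IsPPWaveChart`, the Christoffel symbols `Γ(a, b)` vanish if
`b = ∂_v`, and if `a` and `b` are tangent to the levels of `u`. -/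
theorem IsPPWaveChart.christoffel_eq_zero (h : IsPPWaveChart g V e) (hy : y ∈ e.target)
    (a b : EuclideanSpace ℝ (Fin (n + 2)))
    (hab : b = EuclideanSpace.single 1 1 ∨ (a 0 = 0 ∧ b 0 = 0)) :
    chartChristoffel g e y a b = 0 := by
  obtain ⟨k, hk, hG⟩ := h.exists_metric_eq
  have hGd := contDiffAt_chartMetric g h.1 hy
  have hk1 : k =ᶠ[𝓝 y] fun z ↦
      chartMetric g e z (EuclideanSpace.single 0 1) (EuclideanSpace.single 0 1) := by
    filter_upwards [e.open_target.mem_nhds hy] with z hz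
    rw [hG z hz]
    simp
  have hkd : DifferentiableAt ℝ k y :=
    (((hGd.clm_apply contDiffAt_const).clm_apply contDiffAt_const).congr_of_eventuallyEq
      hk1).differentiableAt (by simp)
  have hkv : fderiv ℝ k y (EuclideanSpace.single 1 1) = 0 := by
    rw [← hkd.lineDeriv_eq_fderiv, lineDeriv]
    simp only [hk, deriv_const]
  have hDG : ∀ a b c, fderiv ℝ (chartMetric g e) y c a b = fderiv ℝ k y c * (a 0 * b 0) := by
    intro a b c
    have h1 : DifferentiableAt ℝ (chartMetric g e) y := hGd.differentiableAt (by simp)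
    rw [← fderiv_clm_apply_const h1,
      ← fderiv_clm_apply_const (h1.clm_apply (differentiableAt_const a))]
    have h2 : (fun z ↦ chartMetric g e z a b) =ᶠ[𝓝 y] fun z ↦ k z * (a 0 * b 0) +
        (a 0 * b 1 + a 1 * b 0 + ∑ i : Fin n, a i.succ.succ * b i.succ.succ) := by
      filter_upwards [e.open_target.mem_nhds hy] with z hz
      rw [hG z hz]
      ring
    rw [h2.fderiv_eq, fderiv_add_const, fderiv_mul_const hkd]
    simp [mul_comm]
  refine chartMetric_nondegenerate g h.1 hy _ fun c ↦ ?_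
  rw [chartChristoffel, metric_christoffel (chartMetric_nondegenerate g h.1 hy), hDG, hDG, hDG]
  rcases hab with rfl | ⟨ha, hb⟩
  · simp [hkv]
  · simp [ha, hb]

theorem IsPPWaveChart.metric_field (h : IsPPWaveChart g V e) (hy : y ∈ e.target)
    (a : EuclideanSpace ℝ (Fin (n + 2))) :
    chartMetric g e y (chartField e V y) a = a 0 := by
  obtain ⟨k, -, hG⟩ := h.exists_metric_eq
  have : ∀ i : Fin n, (i.succ.succ : Fin (n + 2)) ≠ 1 := by simp [Fin.ext_iff]
  rw [hG y hy, h.chartField_eq hy]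
  simp [this]

theorem IsPPWaveChart.mem_orthogonal (h : IsPPWaveChart g V e) (hy : y ∈ e.target)
    (a : EuclideanSpace ℝ (Fin (n + 2))) :
    chartSymmD e y a ∈ g.orthogonal V (e.symm y) ↔ a 0 = 0 := by
  rw [mem_orthogonal_chartSymmD h.1 hy, h.metric_field hy]

theorem IsPPWaveChart.parallel (h : IsPPWaveChart g V e) (hV : IsSmoothVectorField V)
    (hy : y ∈ e.target) (w : TangentSpace (𝓡 (n + 2)) (e.symm y)) :
    g.leviCivita V (e.symm y) w = 0 := by
  obtain ⟨a, rfl⟩ := (chartSymmEquiv h.1 hy).surjective w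
  rw [chartSymmEquiv_apply, leviCivita_chart g h.1 hy (hV _)]
  have h1 : chartField e V =ᶠ[𝓝 y] fun _ ↦ EuclideanSpace.single 1 1 := by
    filter_upwards [e.open_target.mem_nhds hy] with z hz using h.chartField_eq hz
  rw [covDeriv_apply, h1.fderiv_eq, h.chartField_eq hy, h.christoffel_eq_zero hy _ _ (Or.inl rfl)]
  simp

theorem IsPPWaveChart.chartField_section_apply_zero (h : IsPPWaveChart g V e) (hy : y ∈ e.target)
    {U : Set M} {X : Π x : M, TangentSpace (𝓡 (n + 2)) x}
    (hX : IsSmoothSectionOn (g.orthogonal V) U X) (hq : e.symm y ∈ U) : chartField e X y 0 = 0 := by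
  rw [← h.mem_orthogonal hy, chartSymmD_chartField h.1 hy]
  exact hX.2.2 _ hq

/-- A manifold covered by charts as in the definition of `IsPPWaveChart` is a pp-wave. -/
theorem isPPWave_of_charts (hg : g.IsLorentzian) (hV : IsSmoothVectorField V)
    (hch : ∀ p : M, ∃ e : OpenPartialHomeomorph M (EuclideanSpace ℝ (Fin (n + 2))),
      p ∈ e.source ∧ IsPPWaveChart g V e) : IsPPWave g V := by
  have hpt : ∀ q : M, ∃ (e : OpenPartialHomeomorph M (EuclideanSpace ℝ (Fin (n + 2)))),
      IsPPWaveChart g V e ∧ ∃ y ∈ e.target, q = e.symm y := fun q ↦ by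
    obtain ⟨e, hq, he⟩ := hch q
    exact ⟨e, he, e q, e.map_source hq, (e.left_inv hq).symm⟩
  have hnear : ∀ {e : OpenPartialHomeomorph M (EuclideanSpace ℝ (Fin (n + 2)))}
      {y : EuclideanSpace ℝ (Fin (n + 2))} {U : Set M}, y ∈ e.target → IsOpen U → e.symm y ∈ U →
      ∀ᶠ z in 𝓝 y, z ∈ e.target ∧ e.symm z ∈ U := fun {e y U} hy hU hq ↦ by
    filter_upwards [e.open_target.mem_nhds hy,
      (e.continuousAt_symm hy).eventually (hU.mem_nhds hq)] with z h1 h2 using ⟨h1, h2⟩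
  have hpar : ∀ (q : M) (w : TangentSpace (𝓡 (n + 2)) q), g.leviCivita V q w = 0 := by
    intro q w
    obtain ⟨e, he, y, hy, rfl⟩ := hpt q
    exact he.parallel hV hy w
  refine ⟨⟨⟨hg, hV, ?_, ?_, fun q ↦ hpar q _, ?_, ?_⟩, hpar⟩, ?_⟩
  · intro q h0
    obtain ⟨e, he, y, hy, rfl⟩ := hpt q
    have h1 := he.2.1 _ (e.map_target hy) 1
    rw [h0, map_zero] at h1
    simp at h1
  · intro q
    obtain ⟨e, he, y, hy, rfl⟩ := hpt q
    rw [← chartSymmD_chartField he.1 hy V, ← chartMetric_apply, he.metric_field hy,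
      he.chartField_eq hy]
    simp
  · intro p
    obtain ⟨e, hp, he⟩ := hch p
    refine ⟨e, he.1, hp, fun q hq ↦ ?_⟩
    obtain ⟨y, hy, rfl⟩ : ∃ y ∈ e.target, q = e.symm y :=
      ⟨e q, e.map_source hq, (e.left_inv hq).symm⟩
    ext w
    obtain ⟨a, rfl⟩ := (chartSymmEquiv he.1 hy).surjective w
    rw [chartSymmEquiv_apply, he.mem_orthogonal hy, ← coordDiff_chartSymmD he.1 hy]
    rfl
  · intro U X Y hX hY q hq
    obtain ⟨e, he, y, hy, rfl⟩ := hpt q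
    have hX0 := he.chartField_section_apply_zero hy hX hq
    have hY0 := he.chartField_section_apply_zero hy hY hq
    have hYs := contMDiffAt_of_isSmoothSectionOn hY hq
    have hYd : DifferentiableAt ℝ (chartField e Y) y :=
      (contDiffAt_chartField he.1 hy hYs).differentiableAt (by simp)
    rw [← chartSymmD_chartField he.1 hy X, leviCivita_chart g he.1 hy hYs, he.mem_orthogonal hy,
      covDeriv_apply, he.christoffel_eq_zero hy _ _ (Or.inr ⟨hX0, hY0⟩), add_zero]
    let P : EuclideanSpace ℝ (Fin (n + 2)) →L[ℝ] ℝ := EuclideanSpace.proj 0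
    have h1 : (P ∘ chartField e Y) =ᶠ[𝓝 y] fun _ ↦ 0 := by
      filter_upwards [hnear hy hX.1 hq] with z hz
      exact he.chartField_section_apply_zero hz.1 hY hz.2
    have h2 := P.hasFDerivAt.comp y hYd.hasFDerivAt
    have h3 := h2.fderiv.symm.trans h1.fderiv_eq
    simpa [P] using congrArg (fun L : EuclideanSpace ℝ (Fin (n + 2)) →L[ℝ] ℝ ↦
      L (chartField e X y)) h3
  · intro U X Y Z hX hY hZ q hq
    obtain ⟨e, he, y, hy, rfl⟩ := hpt q
    have hs : ∀ {W : Π x : M, TangentSpace (𝓡 (n + 2)) x},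
        IsSmoothSectionOn (g.orthogonal V) U W →
        ∀ᶠ z in 𝓝 y, ContMDiffAt (𝓡 (n + 2)) (𝓡 (n + 2)).tangent ∞
          (fun q ↦ (⟨q, W q⟩ : TangentBundle (𝓡 (n + 2)) M)) (e.symm z) := fun hW ↦ by
      filter_upwards [hnear hy hX.1 hq] with z hz using contMDiffAt_of_isSmoothSectionOn hW hz.2
    have hX0 := he.chartField_section_apply_zero hy hX hq
    have hY0 := he.chartField_section_apply_zero hy hY hq
    have hZ0 := he.chartField_section_apply_zero hy hZ hq
    rw [curvature_chart g he.1 hy (hs hX) (hs hY) (hs hZ)]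
    have hΓ : DifferentiableAt ℝ (chartChristoffel g e) y :=
      (isLeviCivitaAt_chart g he.1 hy).contDiffAt_christoffel.differentiableAt (by simp)
    have hD : ∀ a b c : EuclideanSpace ℝ (Fin (n + 2)), b 0 = 0 → c 0 = 0 →
        fderiv ℝ (chartChristoffel g e) y a b c = 0 := by
      intro a b c hb hc
      rw [← fderiv_clm_apply_const hΓ,
        ← fderiv_clm_apply_const (hΓ.clm_apply (differentiableAt_const b))]
      have h1 : (fun z ↦ chartChristoffel g e z b c) =ᶠ[𝓝 y] fun _ ↦ 0 := by
        filter_upwards [e.open_target.mem_nhds hy] with z hz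
        exact he.christoffel_eq_zero hz _ _ (Or.inr ⟨hb, hc⟩)
      rw [h1.fderiv_eq]
      simp
    rw [christoffelCurvature, hD _ _ _ hY0 hZ0, hD _ _ _ hX0 hZ0,
      he.christoffel_eq_zero hy _ _ (Or.inr ⟨hY0, hZ0⟩),
      he.christoffel_eq_zero hy _ _ (Or.inr ⟨hX0, hZ0⟩)]
    simp

end NormalForm

/-! ### Changes of coordinates -/

section ChangeOfCoordinates

open Set Filter Topology

variable {E : Type} [NormedAddCommGroup E] [NormedSpace ℝ E] [FiniteDimensional ℝ E]
  {M : Type*} [TopologicalSpace M] [ChartedSpace E M] [IsManifold 𝓘(ℝ, E) ∞ M]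
  {e : OpenPartialHomeomorph M E} {ψ : OpenPartialHomeomorph E E}

theorem trans_mem_maximalAtlas (he : e ∈ IsManifold.maximalAtlas 𝓘(ℝ, E) ∞ M)
    (h1 : ContDiffOn ℝ ∞ ψ ψ.source) (h2 : ContDiffOn ℝ ∞ ψ.symm ψ.target) :
    e.trans ψ ∈ IsManifold.maximalAtlas 𝓘(ℝ, E) ∞ M := by
  refine OpenPartialHomeomorph.mem_maximalAtlas_of_contMDiffOn _ ?_ ?_
  · exact (contMDiffOn_iff_contDiffOn.2 h1).comp
      ((contMDiffOn_of_mem_maximalAtlas he).mono inter_subset_left)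
      fun q hq ↦ hq.2
  · exact (contMDiffOn_symm_of_mem_maximalAtlas he).comp
      ((contMDiffOn_iff_contDiffOn.2 h2).mono inter_subset_left)
      fun q hq ↦ hq.2

theorem mfderiv_trans_chartSymmD (he : e ∈ IsManifold.maximalAtlas 𝓘(ℝ, E) ∞ M)
    (hψ : ContDiffOn ℝ ∞ ψ ψ.source) {y : E} (hy : y ∈ e.target) (hy' : y ∈ ψ.source) (a : E) :
    (mfderiv 𝓘(ℝ, E) 𝓘(ℝ, E) (e.trans ψ) (e.symm y) (chartSymmD e y a) : E) =
      fderiv ℝ ψ y a := by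
  have h0 : MDifferentiableAt 𝓘(ℝ, E) 𝓘(ℝ, E) (e.trans ψ) (e.symm y) := by
    refine MDifferentiableAt.comp (I' := 𝓘(ℝ, E)) (g := ψ) (f := e) _ ?_
      ((chart_mdifferentiable he).mdifferentiableAt (e.map_target hy))
    rw [e.right_inv hy]
    exact ((hψ.contDiffAt (ψ.open_source.mem_nhds hy')).differentiableAt
      (by simp)).mdifferentiableAt
  have h := mfderiv_comp y h0 ((chart_mdifferentiable he).mdifferentiableAt_symm hy)
  have h1 : (e.trans ψ) ∘ e.symm =ᶠ[𝓝 y] ψ := by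
    filter_upwards [e.open_target.mem_nhds hy] with z hz
    simp [e.right_inv hz]
  rw [mfderiv_eq_fderiv, h1.fderiv_eq] at h
  rw [h]
  rfl

/-- Every chart may be translated so that a given point has coordinates zero. -/
theorem exists_centered_chart (he : e ∈ IsManifold.maximalAtlas 𝓘(ℝ, E) ∞ M) {p : M}
    (hp : p ∈ e.source) :
    ∃ e' ∈ IsManifold.maximalAtlas 𝓘(ℝ, E) ∞ M, p ∈ e'.source ∧ e'.source ⊆ e.source ∧
      e' p = 0 ∧ ∀ q ∈ e'.source,
        mfderiv 𝓘(ℝ, E) 𝓘(ℝ, E) e' q = mfderiv 𝓘(ℝ, E) 𝓘(ℝ, E) e q := by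
  let ψ : OpenPartialHomeomorph E E := (Homeomorph.addRight (-e p)).toOpenPartialHomeomorph
  have hψ : ContDiff ℝ ∞ ψ := contDiff_id.add contDiff_const
  have hψ' : ContDiff ℝ ∞ ψ.symm := contDiff_id.add contDiff_const
  refine ⟨e.trans ψ, trans_mem_maximalAtlas he hψ.contDiffOn hψ'.contDiffOn,
    ⟨hp, mem_univ _⟩, inter_subset_left,
    add_neg_cancel (e p), fun q hq ↦ ?_⟩
  have hq := hq.1
  obtain ⟨y, hy, rfl⟩ : ∃ y ∈ e.target, q = e.symm y :=
    ⟨e q, e.map_source hq, (e.left_inv hq).symm⟩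
  ext w
  obtain ⟨a, rfl⟩ := (chartSymmEquiv he hy).surjective w
  have h1 : fderiv ℝ ψ y a = a := by
    change fderiv ℝ (fun z ↦ z + -e p) y a = a
    simp
  exact ((mfderiv_trans_chartSymmD he hψ.contDiffOn hy (mem_univ _) a).trans h1).trans
    (mfderiv_chartSymmD he hy a).symm

/-- The inverse function theorem for a map that is smooth with injective differential on an open
set: it restricts to a diffeomorphism onto a ball. -/
theorem exists_local_diffeomorph {f : E → E} {O : Set E} (hO : IsOpen O) {x : E} (hx : x ∈ O)
    (hf : ∀ y ∈ O, ContDiffAt ℝ ∞ f y) (hinj : ∀ y ∈ O, ∀ a, fderiv ℝ f y a = 0 → a = 0) :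
    ∃ ψ : OpenPartialHomeomorph E E, (ψ : E → E) = f ∧ x ∈ ψ.source ∧ ψ.source ⊆ O ∧
      (∃ r, ψ.target = Metric.ball (f x) r) ∧ ContDiffOn ℝ ∞ ψ ψ.source ∧
      ContDiffOn ℝ ∞ ψ.symm ψ.target := by
  have hequiv : ∀ y ∈ O, ∃ A : E ≃L[ℝ] E, HasFDerivAt f (A : E →L[ℝ] E) y := by
    intro y hy
    have hker : LinearMap.ker (fderiv ℝ f y).toLinearMap = ⊥ :=
      LinearMap.ker_eq_bot'.2 (hinj y hy)
    let A := (LinearEquiv.ofInjectiveEndo (fderiv ℝ f y).toLinearMap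
      (LinearMap.ker_eq_bot.1 hker)).toContinuousLinearEquiv
    refine ⟨A, ?_⟩
    have hA : (A : E →L[ℝ] E) = fderiv ℝ f y := by ext; rfl
    rw [hA]
    exact ((hf y hy).differentiableAt (by simp)).hasFDerivAt
  obtain ⟨A, hA⟩ := hequiv x hx
  let φ := (hf x hx).toOpenPartialHomeomorph f hA (by simp)
  have hφ : (φ : E → E) = f := rfl
  have hxφ : x ∈ φ.source := (hf x hx).mem_toOpenPartialHomeomorph_source hA (by simp)
  have hopen : IsOpen (φ.target ∩ φ.symm ⁻¹' O) := φ.symm.isOpen_inter_preimage hO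
  have hmem : f x ∈ φ.target ∩ φ.symm ⁻¹' O := by
    refine ⟨φ.map_source hxφ, ?_⟩
    have := φ.left_inv hxφ
    rw [hφ] at this
    rwa [mem_preimage, this]
  obtain ⟨r, hr, hball⟩ := Metric.isOpen_iff.1 hopen _ hmem
  let ψ := (φ.symm.restrOpen (Metric.ball (f x) r) Metric.isOpen_ball).symm
  have hsrc : ∀ y ∈ ψ.source, y ∈ φ.source ∧ f y ∈ Metric.ball (f x) r := fun y hy ↦ hy
  have htgt : ψ.target = Metric.ball (f x) r := by
    change φ.target ∩ Metric.ball (f x) r = _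
    exact inter_eq_right.2 fun z hz ↦ (hball hz).1
  have hsO : ψ.source ⊆ O := fun y hy ↦ by
    have h1 := (hball (hsrc y hy).2).2
    rwa [mem_preimage, ← hφ, φ.left_inv (hsrc y hy).1] at h1
  refine ⟨ψ, rfl, ⟨hxφ, Metric.mem_ball_self hr⟩, hsO, ⟨r, htgt⟩,
    fun y hy ↦ (hf y (hsO hy)).contDiffWithinAt, fun z hz ↦ ?_⟩
  have hz' := hsO (ψ.map_target hz)
  obtain ⟨B, hB⟩ := hequiv _ hz'
  exact (ψ.contDiffAt_symm hz hB (hf _ hz')).contDiffWithinAt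

end ChangeOfCoordinates

/-! ### From the geometry to the normal form -/

section Brinkmann

open Set Filter Topology

variable {n : ℕ} {M : Type*} [TopologicalSpace M]
  [ChartedSpace (EuclideanSpace ℝ (Fin (n + 2))) M] [IsManifold (𝓡 (n + 2)) ∞ M]
  {e : OpenPartialHomeomorph M (EuclideanSpace ℝ (Fin (n + 2)))}
  {g : SemiRiemannianMetric (𝓡 (n + 2)) M} {V : Π x : M, TangentSpace (𝓡 (n + 2)) x}
  {y : EuclideanSpace ℝ (Fin (n + 2))}

/-- In a foliation chart around a point with coordinates zero, a pp-wave is a local pp-wave. -/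
theorem IsPPWave.isLocalPPWave_chart (h : IsPPWave g V)
    (he : e ∈ IsManifold.maximalAtlas (𝓡 (n + 2)) ∞ M) (h0 : 0 ∈ e.target)
    (hD : ∀ q ∈ e.source, g.orthogonal V q = LinearMap.ker (coordDiff e 0 q).toLinearMap) :
    IsLocalPPWave (chartMetric g e) (chartChristoffel g e) (EuclideanSpace.proj 0)
      (chartField e V) := by
  have htgt : ∀ᶠ y in 𝓝 0, y ∈ e.target := e.open_target.mem_nhds h0
  have hmem : ∀ y ∈ e.target, ∀ a, chartSymmD e y a ∈ g.orthogonal V (e.symm y) ↔ a 0 = 0 := by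
    intro y hy a
    rw [hD _ (e.map_target hy), ← coordDiff_chartSymmD he hy]
    rfl
  have hsec : ∀ a : EuclideanSpace ℝ (Fin (n + 2)), a 0 = 0 →
      IsSmoothSectionOn (g.orthogonal V) e.source (chartConst e a) := fun a ha ↦
    ⟨e.open_source, fun q hq ↦ (contMDiffAt_chartConst he hq a).contMDiffWithinAt, fun q hq ↦ by
      obtain ⟨y, hy, rfl⟩ : ∃ y ∈ e.target, q = e.symm y :=
        ⟨e q, e.map_source hq, (e.left_inv hq).symm⟩
      rwa [chartConst_symm he hy, hmem y hy]⟩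
  refine ⟨?_, ?_, ?_, ?_, ?_⟩
  · filter_upwards [htgt] with y hy using isLeviCivitaAt_chart g he hy
  · filter_upwards [htgt] with y hy using contDiffAt_chartField he hy (h.smooth _)
  · filter_upwards [htgt] with y hy
    ext1 a
    refine chartSymmD_injective he hy ?_
    rw [← leviCivita_chart g he hy (h.smooth _), h.parallel, zero_apply, map_zero]
  · filter_upwards [htgt] with y hy a
    rw [← mem_orthogonal_chartSymmD he hy, hmem y hy]
    rfl
  · filter_upwards [htgt] with y hy a b c ha hb hc
    refine chartSymmD_injective he hy ?_
    have hs : ∀ a, ∀ᶠ z in 𝓝 y, ContMDiffAt (𝓡 (n + 2)) (𝓡 (n + 2)).tangent ∞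
        (fun q ↦ (⟨q, chartConst e a q⟩ : TangentBundle (𝓡 (n + 2)) M)) (e.symm z) := fun a ↦ by
      filter_upwards [e.open_target.mem_nhds hy] with z hz
      exact contMDiffAt_chartConst he (e.map_target hz) a
    have h1 := curvature_chart g he hy (hs a) (hs b) (hs c)
    rw [chartField_chartConst he hy, chartField_chartConst he hy, chartField_chartConst he hy] at h1
    rw [← h1, map_zero]
    exact h.flat _ _ _ _ (hsec a ha) (hsec b hb) (hsec c hc) _ (e.map_target hy)

/-- A lightlike vector field that vanishes nowhere is part of a null frame at every point. -/
theorem exists_isNullFrame_chart (hg : g.IsLorentzian)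
    (he : e ∈ IsManifold.maximalAtlas (𝓡 (n + 2)) ∞ M) (hy : y ∈ e.target)
    (hV : V (e.symm y) ≠ 0) (hVV : g.inner (e.symm y) (V (e.symm y)) (V (e.symm y)) = 0) :
    ∃ (U : EuclideanSpace ℝ (Fin (n + 2))) (F : Fin n → EuclideanSpace ℝ (Fin (n + 2))),
      IsNullFrame (chartMetric g e y) (chartField e V y) U F := by
  obtain ⟨k, b, hb⟩ := hg (e.symm y)
  refine exists_isNullFrame (by simp) (chartMetric_symm g y) (chartMetric_nondegenerate g he hy)
    (b.map (chartSymmEquiv he hy).symm.toLinearEquiv) (fun i j ↦ ?_) (fun h0 ↦ hV ?_) ?_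
  · rw [← hb, chartMetric_apply]
    have : ∀ i, chartSymmD e y (b.map (chartSymmEquiv he hy).symm.toLinearEquiv i) = b i := fun i ↦
      (chartSymmEquiv he hy).apply_symm_apply (b i)
    rw [this, this]
  · rw [← chartSymmD_chartField he hy V, h0, map_zero]
  · rw [chartMetric_apply, chartSymmD_chartField he hy, hVV]

/-- A smooth function on a ball whose derivative in the direction `w` vanishes is constant along
segments in that direction. -/
theorem eq_of_fderiv_apply_eq_zero {E : Type} [NormedAddCommGroup E] [NormedSpace ℝ E] {s : Set E}
    (hs : Convex ℝ s) {f : E → ℝ} {w : E} (hf : ∀ z ∈ s, DifferentiableAt ℝ f z)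
    (hw : ∀ z ∈ s, fderiv ℝ f z w = 0) {z : E} {t : ℝ} (hz : z ∈ s) (hz' : z + t • w ∈ s) :
    f (z + t • w) = f z := by
  have hmem : ∀ r ∈ Icc (0 : ℝ) 1, z + r • t • w ∈ s := fun r hr ↦ by
    have := hs.add_smul_sub_mem hz hz' hr
    rwa [add_sub_cancel_left] at this
  have hd : ∀ r ∈ Icc (0 : ℝ) 1, HasDerivAt (fun r : ℝ ↦ f (z + r • t • w)) 0 r := by
    intro r hr
    have h1 : HasDerivAt (fun r : ℝ ↦ z + r • t • w) (t • w) r := by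
      simpa using ((hasDerivAt_id r).smul_const (t • w)).const_add z
    have h2 := (hf _ (hmem r hr)).hasFDerivAt.comp_hasDerivAt r h1
    rwa [map_smul, hw _ (hmem r hr), smul_zero] at h2
  have := constant_of_has_deriv_right_zero (f := fun r : ℝ ↦ f (z + r • t • w)) (a := 0) (b := 1)
    (fun r hr ↦ (hd r hr).continuousAt.continuousWithinAt)
    (fun r hr ↦ (hd r (Ico_subset_Icc_self hr)).hasDerivWithinAt) 1 (right_mem_Icc.2 zero_le_one)
  simpa using this

/-- The point with coordinates `(u, v, x)`. -/
def coordPoint (u v : ℝ) (x : Fin n → ℝ) : EuclideanSpace ℝ (Fin (n + 2)) :=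
  WithLp.toLp 2 (Fin.cons u (Fin.cons v x))

@[simp] theorem coordPoint_zero (u v : ℝ) (x : Fin n → ℝ) : coordPoint u v x 0 = u := rfl

@[simp] theorem coordPoint_succ (u v : ℝ) (x : Fin n → ℝ) (i : Fin n) :
    coordPoint u v x i.succ.succ = x i := rfl

theorem coordPoint_eta (z : EuclideanSpace ℝ (Fin (n + 2))) (v : ℝ) :
    coordPoint (z 0) v (transverse z) = z + (v - z 1) • EuclideanSpace.single 1 1 := by
  ext i
  refine Fin.cases ?_ (fun i ↦ Fin.cases ?_ (fun i ↦ ?_) i) i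
  · simp
  · change v = z 1 + (v - z 1) * _
    simp
  · have : (i.succ.succ : Fin (n + 2)) ≠ 1 := by simp [Fin.ext_iff]
    simp [transverse, this]

theorem contDiffAt_coordPoint {E : Type} [NormedAddCommGroup E] [NormedSpace ℝ E] {u v : E → ℝ}
    {x : E → Fin n → ℝ} {y : E} (hu : ContDiffAt ℝ ∞ u y) (hv : ContDiffAt ℝ ∞ v y)
    (hx : ∀ i, ContDiffAt ℝ ∞ (fun z ↦ x z i) y) :
    ContDiffAt ℝ ∞ (fun z ↦ coordPoint (u z) (v z) (x z)) y := by
  rw [contDiffAt_euclidean]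
  exact Fin.cases hu (Fin.cases hv hx)

/-- Replacing the coordinate `v` of a point of a ball by that of its centre gives a point of the
ball. -/
theorem coordPoint_mem_ball {z c : EuclideanSpace ℝ (Fin (n + 2))} {r : ℝ}
    (hz : z ∈ Metric.ball c r) : coordPoint (z 0) (c 1) (transverse z) ∈ Metric.ball c r := by
  rw [Metric.mem_ball, EuclideanSpace.dist_eq] at hz ⊢
  refine lt_of_le_of_lt (Real.sqrt_le_sqrt (Finset.sum_le_sum fun i _ ↦ ?_)) hz
  refine Fin.cases ?_ (fun i ↦ Fin.cases ?_ (fun i ↦ ?_) i) i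
  · simp
  · change dist (c 1) (c 1) ^ 2 ≤ _
    simp
  · simp [transverse]

/-- A function on a ball that does not depend on the coordinate `v` is a smooth function of the
remaining coordinates. -/
theorem exists_transverse_function {c : EuclideanSpace ℝ (Fin (n + 2))} {r : ℝ}
    {K : EuclideanSpace ℝ (Fin (n + 2)) → ℝ} (hK : ∀ z ∈ Metric.ball c r, ContDiffAt ℝ ∞ K z)
    (hKv : ∀ z ∈ Metric.ball c r, fderiv ℝ K z (EuclideanSpace.single 1 1) = 0) :
    ∃ H : ℝ × EuclideanSpace ℝ (Fin n) → ℝ,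
      ContDiffOn ℝ ∞ H
        ((fun y : EuclideanSpace ℝ (Fin (n + 2)) ↦ (y 0, transverse y)) '' Metric.ball c r) ∧
      ∀ z ∈ Metric.ball c r, H (z 0, transverse z) = K z := by
  refine ⟨fun q ↦ K (coordPoint q.1 (c 1) q.2), ?_, fun z hz ↦ ?_⟩
  · rintro _ ⟨z, hz, rfl⟩
    refine ContDiffAt.contDiffWithinAt ?_
    refine ContDiffAt.comp (f := fun q : ℝ × EuclideanSpace ℝ (Fin n) ↦
      coordPoint q.1 (c 1) q.2) _ (hK _ (coordPoint_mem_ball hz)) ?_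
    refine contDiffAt_coordPoint contDiffAt_fst contDiffAt_const fun i ↦ ?_
    exact (contDiffAt_euclidean.1 contDiffAt_snd i)
  · have h1 := coordPoint_mem_ball hz
    simp only
    rw [coordPoint_eta] at h1 ⊢
    exact eq_of_fderiv_apply_eq_zero (convex_ball c r)
      (fun z hz ↦ (hK z hz).differentiableAt (by simp)) hKv hz h1

/-- The differential of a map into Euclidean space, coordinate by coordinate. -/
theorem fderiv_euclidean_apply {E : Type} [NormedAddCommGroup E] [NormedSpace ℝ E] {m : ℕ}
    {f : E → EuclideanSpace ℝ (Fin m)} {y : E} (hf : DifferentiableAt ℝ f y) (a : E) (i : Fin m) :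
    fderiv ℝ f y a i = fderiv ℝ (fun z ↦ f z i) y a := by
  let P : EuclideanSpace ℝ (Fin m) →L[ℝ] ℝ := EuclideanSpace.proj i
  exact (congrArg (fun L : E →L[ℝ] ℝ ↦ L a) (P.hasFDerivAt.comp y hf.hasFDerivAt).fderiv).symm

/-- Coordinates `(u, v, x)` in which the metric has the normal form, and which satisfy
`V u = V x = 0` and `V v = 1`, form a chart as in the definition of `IsPPWaveChart`. -/
theorem exists_isPPWaveChart_of_coordinates
    (he : e ∈ IsManifold.maximalAtlas (𝓡 (n + 2)) ∞ M) (hy : y ∈ e.target)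
    {u v k : EuclideanSpace ℝ (Fin (n + 2)) → ℝ} {x : Fin n → EuclideanSpace ℝ (Fin (n + 2)) → ℝ}
    (h : ∀ᶠ y in 𝓝 y,
      ContDiffAt ℝ ∞ u y ∧ ContDiffAt ℝ ∞ v y ∧ ContDiffAt ℝ ∞ k y ∧
      (∀ i, ContDiffAt ℝ ∞ (x i) y) ∧
      fderiv ℝ u y (chartField e V y) = 0 ∧ fderiv ℝ v y (chartField e V y) = 1 ∧
      fderiv ℝ k y (chartField e V y) = 0 ∧ (∀ i, fderiv ℝ (x i) y (chartField e V y) = 0) ∧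
      ∀ a b, chartMetric g e y a b =
        fderiv ℝ u y a * fderiv ℝ v y b + fderiv ℝ v y a * fderiv ℝ u y b +
        k y * (fderiv ℝ u y a * fderiv ℝ u y b) +
        ∑ i, fderiv ℝ (x i) y a * fderiv ℝ (x i) y b) :
    ∃ e' : OpenPartialHomeomorph M (EuclideanSpace ℝ (Fin (n + 2))),
      e.symm y ∈ e'.source ∧ IsPPWaveChart g V e' := by
  obtain ⟨O, hOsub, hO, hyO⟩ := eventually_nhds_iff.1 (h.and (e.open_target.mem_nhds hy))
  let f : EuclideanSpace ℝ (Fin (n + 2)) → EuclideanSpace ℝ (Fin (n + 2)) := fun z ↦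
    coordPoint (u z) (v z) fun i ↦ x i z
  have hf : ∀ z ∈ O, ContDiffAt ℝ ∞ f z := fun z hz ↦ by
    obtain ⟨⟨hu, hv, -, hx, -⟩, -⟩ := hOsub z hz
    exact contDiffAt_coordPoint hu hv hx
  have hfd : ∀ z ∈ O, DifferentiableAt ℝ f z := fun z hz ↦ (hf z hz).differentiableAt (by simp)
  have hf0 : ∀ z ∈ O, ∀ a, fderiv ℝ f z a 0 = fderiv ℝ u z a := fun z hz a ↦
    fderiv_euclidean_apply (hfd z hz) a 0
  have hf1 : ∀ z ∈ O, ∀ a, fderiv ℝ f z a 1 = fderiv ℝ v z a := fun z hz a ↦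
    fderiv_euclidean_apply (hfd z hz) a 1
  have hf2 : ∀ z ∈ O, ∀ a (i : Fin n), fderiv ℝ f z a i.succ.succ = fderiv ℝ (x i) z a :=
    fun z hz a i ↦ fderiv_euclidean_apply (hfd z hz) a i.succ.succ
  have hmetric : ∀ z ∈ O, ∀ a b, chartMetric g e z a b =
      fderiv ℝ f z a 0 * fderiv ℝ f z b 1 + fderiv ℝ f z a 1 * fderiv ℝ f z b 0 +
      k z * (fderiv ℝ f z a 0 * fderiv ℝ f z b 0) +
      ∑ i : Fin n, fderiv ℝ f z a i.succ.succ * fderiv ℝ f z b i.succ.succ := by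
    intro z hz a b
    simp only [hf0 z hz, hf1 z hz, hf2 z hz]
    exact (hOsub z hz).1.2.2.2.2.2.2.2.2 a b
  have hinj : ∀ z ∈ O, ∀ a, fderiv ℝ f z a = 0 → a = 0 := fun z hz a ha ↦
    chartMetric_nondegenerate g he (hOsub z hz).2 a fun b ↦ by
      rw [hmetric z hz, ha]
      simp
  have hfV : ∀ z ∈ O, fderiv ℝ f z (chartField e V z) = EuclideanSpace.single 1 1 := by
    intro z hz
    obtain ⟨⟨-, -, -, -, hu, hv, -, hx, -⟩, -⟩ := hOsub z hz
    ext i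
    refine Fin.cases ?_ (fun i ↦ Fin.cases ?_ (fun i ↦ ?_) i) i
    · rw [hf0 z hz, hu]
      simp
    · exact (hf1 z hz _).trans (hv.trans (by simp))
    · have : (i.succ.succ : Fin (n + 2)) ≠ 1 := by simp [Fin.ext_iff]
      rw [hf2 z hz, hx]
      simp [this]
  obtain ⟨ψ, hψf, hyψ, hψO, ⟨r, hr⟩, hψ, hψ'⟩ := exists_local_diffeomorph hO hyO hf hinj
  have hball : ∀ z ∈ Metric.ball (f y) r, z ∈ ψ.target := fun z hz ↦ hr ▸ hz
  have hK : ∀ z ∈ Metric.ball (f y) r, ContDiffAt ℝ ∞ (k ∘ ψ.symm) z := by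
    intro z hz
    have h1 := hψO (ψ.map_target (hball z hz))
    exact (hOsub _ h1).1.2.2.1.comp z (hψ'.contDiffAt (ψ.open_target.mem_nhds (hball z hz)))
  have hKv : ∀ z ∈ Metric.ball (f y) r,
      fderiv ℝ (k ∘ ψ.symm) z (EuclideanSpace.single 1 1) = 0 := by
    intro z hz
    have hz' := ψ.map_target (hball z hz)
    have h1 := hψO hz'
    have hkd : DifferentiableAt ℝ k (ψ.symm z) := (hOsub _ h1).1.2.2.1.differentiableAt (by simp)
    have hKd : DifferentiableAt ℝ (k ∘ ψ.symm) (f (ψ.symm z)) := by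
      rw [← hψf, ψ.right_inv (hball z hz)]
      exact (hK z hz).differentiableAt (by simp)
    -- `k = (k ∘ ψ⁻¹) ∘ f` near `ψ⁻¹ z`, and `f` maps `V` to `∂_v`
    have h2 := fderiv_comp (ψ.symm z) hKd (hfd _ h1)
    have h3 : (k ∘ ψ.symm) ∘ f =ᶠ[𝓝 (ψ.symm z)] k := by
      filter_upwards [ψ.open_source.mem_nhds hz'] with w hw
      rw [Function.comp_apply, Function.comp_apply, ← hψf, ψ.left_inv hw]
    rw [h3.fderiv_eq] at h2
    have h4 := congrArg (fun L : EuclideanSpace ℝ (Fin (n + 2)) →L[ℝ] ℝ ↦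
      L (chartField e V (ψ.symm z))) h2
    simp only [ContinuousLinearMap.comp_apply] at h4
    rw [hfV _ h1, (hOsub _ h1).1.2.2.2.2.2.2.1, ← hψf, ψ.right_inv (hball z hz)] at h4
    exact h4.symm
  obtain ⟨H, hHs, hH⟩ := exists_transverse_function hK hKv
  have htgt : (e.trans ψ).target = Metric.ball (f y) r := by
    refine Subset.antisymm (fun z hz ↦ hr ▸ hz.1) fun z hz ↦ ⟨hball z hz, ?_⟩
    exact (hOsub _ (hψO (ψ.map_target (hball z hz)))).2
  have hsrc : ∀ q ∈ (e.trans ψ).source, ∃ z ∈ e.target, z ∈ ψ.source ∧ q = e.symm z := fun q hq ↦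
    ⟨e q, e.map_source hq.1, hq.2, (e.left_inv hq.1).symm⟩
  have hcoord : ∀ z ∈ e.target, z ∈ ψ.source → ∀ i a,
      coordDiff (e.trans ψ) i (e.symm z) (chartSymmD e z a) = fderiv ℝ f z a i := by
    intro z hz hz' i a
    rw [← hψf]
    exact congrArg (fun w : EuclideanSpace ℝ (Fin (n + 2)) ↦ w i)
      (mfderiv_trans_chartSymmD he hψ hz hz' a)
  refine ⟨e.trans ψ, ⟨e.map_target hy, ?_⟩, trans_mem_maximalAtlas he hψ hψ', ?_, H, ?_, ?_⟩
  · change e (e.symm y) ∈ ψ.source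
    rwa [e.right_inv hy]
  · intro q hq i
    obtain ⟨z, hz, hz', rfl⟩ := hsrc q hq
    rw [← chartSymmD_chartField he hz V, hcoord z hz hz', hfV z (hψO hz')]
    simp
  · rwa [htgt]
  · intro q hq a b
    obtain ⟨z, hz, hz', rfl⟩ := hsrc q hq
    obtain ⟨a, rfl⟩ := (chartSymmEquiv he hz).surjective a
    obtain ⟨b, rfl⟩ := (chartSymmEquiv he hz).surjective b
    simp only [chartSymmEquiv_apply]
    rw [← chartMetric_apply, hmetric z (hψO hz')]
    simp only [hcoord z hz hz']
    have h1 : (e.trans ψ) (e.symm z) = ψ z := congrArg ψ (e.right_inv hz)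
    have h2 : ψ z ∈ Metric.ball (f y) r := hr ▸ ψ.map_source hz'
    rw [h1, hH _ h2, Function.comp_apply, ψ.left_inv hz']

/-- A pp-wave is covered by charts as in the definition of `IsPPWaveChart`. -/
theorem IsPPWave.exists_chart (h : IsPPWave g V) (p : M) :
    ∃ e : OpenPartialHomeomorph M (EuclideanSpace ℝ (Fin (n + 2))),
      p ∈ e.source ∧ IsPPWaveChart g V e := by
  obtain ⟨e₀, he₀, hp₀, hD₀⟩ := h.integrable p
  obtain ⟨e, he, hp, hsub, hep, hd⟩ := exists_centered_chart he₀ hp₀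
  have h0 : 0 ∈ e.target := hep ▸ e.map_source hp
  have hD : ∀ q ∈ e.source, g.orthogonal V q = LinearMap.ker (coordDiff e 0 q).toLinearMap := by
    intro q hq
    rw [hD₀ q (hsub hq), coordDiff, coordDiff, hd q hq]
  obtain ⟨U, F, hUF⟩ := exists_isNullFrame_chart h.lorentzian he h0 (h.ne_zero _) (h.lightlike _)
  obtain ⟨u, v, k, x, hx⟩ := (h.isLocalPPWave_chart he h0 hD).exists_coordinates
    (e := EuclideanSpace.single 0 1) (by simp) hUF
  obtain ⟨e', hp', he'⟩ := exists_isPPWaveChart_of_coordinates he h0 hx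
  rw [← hep, e.left_inv hp] at hp'
  exact ⟨e', hp', he'⟩

end Brinkmann

end

theorem mainTheorem6 (n : ℕ) (M : Type*) [TopologicalSpace M]
    [ChartedSpace (EuclideanSpace ℝ (Fin (n + 2))) M] [IsManifold (𝓡 (n + 2)) ∞ M]
    (g : SemiRiemannianMetric (𝓡 (n + 2)) M) (hg : g.IsLorentzian)
    (V : Π x : M, TangentSpace (𝓡 (n + 2)) x) (hV : IsSmoothVectorField V) :
    IsPPWave g V ↔
      ∀ p : M, ∃ e : OpenPartialHomeomorph M (EuclideanSpace ℝ (Fin (n + 2))),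
        p ∈ e.source ∧ IsPPWaveChart g V e :=
  ⟨fun h p ↦ h.exists_chart p, isPPWave_of_charts hg hV⟩
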